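/- Let $\gamma\in(0,\pi/2]$, $\kappa\in\mathbb C$, $N,M\ge 0$ integers, $s=N+1-M$, and let $\nu_1,\dots,\nu_{2N+2}\in\mathbb C$ satisfy $\nu_{2j-1}\ne\nu_{2k}$ mod $\pi i$ for all $j,k$. Put $K(\lambda)=\coth(\lambda+i\gamma)-\coth(\lambda-i\gamma)$ and $b(\lambda,\mu)=\sinh(\lambda-\mu)/\sinh(\lambda-\mu-i\gamma)$. Let $\lambda_1,\dots,\lambda_M$ be pairwise distinct Bethe roots, i.e. $\mathfrak a_n(\lambda_j)=-1$ for all $j$, where $$\mathfrak a_n(\lambda)=e^{2i\gamma\kappa}\prod_{k=1}^{N+1}\frac{b(\lambda,\nu_{2k-1})}{b(\nu_{2k},\lambda)}\prod_{k=1}^M\frac{\sinh(\lambda-\lambda_k-i\gamma)}{\sinh(\lambda-\lambda_k+i\gamma)} .$$ A *contour* is a closed piecewise $C^1$ curve in $\mathbb C$ with winding number $0$ or $1$ about every point off it; the points with winding number $1$ are *inside*. For a contour $\mathcal C$ on which $1+\mathfrak a_n$ has neither zeros nor poles, and with $dm_0(\lambda)=\frac{d\lambda}{2\pi i(1+\mathfrak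 a_n(\lambda))}$, let $$\det_{dm_0,\mathcal C}\{1-\widehat K\}=\sum_{m\ge0}\frac{(-1)^m}{m!}\int_{\mathcal C^m}\det\bigl[K(z_i-z_j)\bigr]_{i,j=1}^m\prod_{i=1}^m dm_0(z_i).$$ Let $\mathcal C_n$ and $\mathcal C_{0,s}$ (the reference contour) be contours such that all $\nu_{2k}$ are inside both of them, the points $\nu_{2k}$ are the only singular points of $\mathfrak a_n$ (zeros of $\sinh(\lambda-\nu_{2k})$, $\sinh(\lambda-\nu_{2k-1}-i\gamma)$ or $\sinh(\lambda-\lambda_k+i\gamma)$ for some $k$) on or inside either of them, and $z-w\not\equiv\pm i\gamma$ mod $\pi i$ whenever each of $z,w$ lies on or inside $\mathcal C_n$ or $\mathcal C_{0,s}$. Assume that all Bethe roots are inside $\mathcal C_n$, that no other zero of $1+\mathfrak a_n$ is on or inside $\mathcal C_n$, and that no zero of $1+\mathfrak a_n$ is on $\mathcal C_{0,s}$. Let $x_1,\dots,x_{n_h}$ (holes) be the distinct zeros of $1+\mathfrak a_n$ inside $\mathcal C_{0,s}$ which are not Bethe roots and $y_1,\dots,y_{n_p}$ (particles) the distinct Bethe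 roots which are not inside $\mathcal C_{0,s}$, and assume $\mathfrak a_n'(x_j)\ne0$, $\mathfrak a_n'(y_j)\neq0$ for all $j$. Let $\mathfrak a(\lambda|\{u\},\{v\})$ be a function of $\lambda$, $u\in\mathbb C^{n_h}$ and $v\in\mathbb C^{n_p}$ which for all $(u,v)$ near $(x,y)$ solves the nonlinear integral equation $$\ln\mathfrak a(\lambda)=i\pi s+2i\gamma\kappa-\varepsilon(\lambda)+i\sum_{j=1}^{n_h}\theta(\lambda-u_j)-i\sum_{k=1}^{n_p}\theta(\lambda-v_k)-\int_{\mathcal C_{0,s}}\frac{d\mu}{2\pi i}K(\lambda-\mu)\ln(1+\mathfrak a)(\mu),$$ $$e^{\varepsilon(\lambda)}=\prod_{k=1}^{N+1}\frac{\sinh(\lambda-\nu_{2k})\sinh(\lambda-\nu_{2k-1}-i\gamma)}{\sinh(\lambda-\nu_{2k-1})\sinh(\lambda-\nu_{2k}-i\gamma)},\qquad e^{i\theta(\lambda)}=\frac{\sinh(i\gamma+\lambda)}{\sinh(i\gamma-\lambda)},$$ (understood as the equality of the exponentials of both sides) for all $\lambda$ in the set $D_v$ of those $\lambda$ for which $\lambda\pm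 i\gamma$ differ mod $\pi i$ from all points on or inside $\mathcal C_{0,s}$ and none of $\sinh(\lambda-\nu_{2k})$, $\sinh(\lambda-\nu_{2k-1}-i\gamma)$, $\sinh(\lambda-v_k+i\gamma)$ vanishes. Here, for these $(u,v)$, $\mathfrak a$ is analytic in $\lambda$ and $1+\mathfrak a\neq0$ on $\mathcal C_{0,s}$, and $\ln(1+\mathfrak a)$ is the integral of $\mathfrak a'/(1+\mathfrak a)$ along $\mathcal C_{0,s}$ from its base point, required to have trivial monodromy. Assume that $\mathfrak a$ is holomorphic in $(\lambda,u,v)$ at $(\lambda,x,y)$ for $\lambda\in D_y$ and that $\mathfrak a(\lambda|\{x\},\{y\})=\mathfrak a_n(\lambda)$ for $\lambda\in D_y$ (so that $x,y$ solve the subsidiary conditions $\mathfrak a(x_j|\{x\},\{y\})=\mathfrak a(y_k|\{x\},\{y\})=-1$). Then the series defining $\det_{dm_0,\mathcal C_n}\{1-\widehat K\}$ and $\det_{dm_0,\mathcal C_{0,s}}\{1-\widehat K\}$ converge absolutely, and $$\det_{dm_0,\mathcal C_n}\{1-\widehat K\}=\det_{dm_0,\mathcal C_{0,s}}\{1-\widehat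 K\}\;\prod_{j=1}^{n_h}\frac1{\mathfrak a_n'(x_j)}\;\prod_{j=1}^{n_p}\frac1{\mathfrak a_n'(y_j)}\;\det\begin{pmatrix}\partial_{u_k}\mathfrak a(u_j|\{u\},\{v\})&\partial_{v_k}\mathfrak a(u_j|\{u\},\{v\})\\ \partial_{u_k}\mathfrak a(v_j|\{u\},\{v\})&\partial_{v_k}\mathfrak a(v_j|\{u\},\{v\})\end{pmatrix}_{u=x,\;v=y},$$ where the partial derivatives also act on the first argument $u_j$ or $v_j$ of $\mathfrak a$. -/

import Mathlib

open scoped Topology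

noncomputable section

namespace XXZ

/-! ### Contours -/

/-- The winding number `(1 / 2πi) ∫ dζ / (ζ - z)` of the closed curve `c : [0,1] → ℂ` about `z`. -/
def windingNumber (c : ℝ → ℂ) (z : ℂ) : ℂ :=
  (2 * Real.pi * Complex.I)⁻¹ * ∫ t in (0 : ℝ)..1, deriv c t / (c t - z)

/-- A contour: a closed, piecewise continuously differentiable curve `[0,1] → ℂ` which winds zero
times or once around every point off the curve. Every positively oriented piecewise smooth
simple closed curve is of this kind. -/
structure Contour where
  toFun : ℝ → ℂ
  closed : toFun 0 = toFun 1
  /-- `C¹` on every closed subinterval of `[0,1]` without a break point in its interior -/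
  piecewise_contDiff : ∃ S : Finset ℝ, ∀ a b : ℝ, 0 ≤ a → a < b → b ≤ 1 →
    (∀ t ∈ S, t ∉ Set.Ioo a b) → ContDiffOn ℝ 1 toFun (Set.Icc a b)
  winding : ∀ z : ℂ, z ∉ toFun '' Set.Icc 0 1 →
    windingNumber toFun z = 0 ∨ windingNumber toFun z = 1

namespace Contour

/-- The points on the contour. -/
def trace (C : Contour) : Set ℂ := C.toFun '' Set.Icc 0 1

/-- The points inside (enclosed by) the contour. -/
def inside (C : Contour) : Set ℂ := {z | z ∉ C.trace ∧ windingNumber C.toFun z = 1}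

/-- The points on or inside the contour. -/
def hull (C : Contour) : Set ℂ := C.trace ∪ C.inside

/-- The determination of `ln (1 + f)` along the contour, as a function of the curve parameter:
the integral of `f' / (1 + f)` along the contour from its base point `C(0)` up to `C(t)`. -/
def logOneAdd (C : Contour) (f : ℂ → ℂ) (t : ℝ) : ℂ :=
  ∫ τ in (0 : ℝ)..t, deriv f (C.toFun τ) / (1 + f (C.toFun τ)) * deriv C.toFun τ

end Contour

/-! ### Fredholm determinants -/

/-- The `n`-th term
`((-1)^n / n!) ∫_C ⋯ ∫_C det (k(z_i, z_j)) ρ(z_1) dz_1 ⋯ ρ(z_n) dz_n`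
of the Fredholm series of the integral operator with kernel `k` and measure `ρ(z) dz` on `C`. -/
def fredholmTerm (C : Contour) (ρ : ℂ → ℂ) (k : ℂ → ℂ → ℂ) (n : ℕ) : ℂ :=
  (-1) ^ n / (n.factorial : ℂ) *
    ∫ t in Set.Icc (0 : Fin n → ℝ) 1,
      (Matrix.of fun i j : Fin n => k (C.toFun (t i)) (C.toFun (t j))).det *
        ∏ i, (ρ (C.toFun (t i)) * deriv C.toFun (t i))

/-- The Fredholm determinant `det_{ρ dz, C} (1 - k)`. -/
def fredholmDet (C : Contour) (ρ : ℂ → ℂ) (k : ℂ → ℂ → ℂ) : ℂ :=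
  ∑' n : ℕ, fredholmTerm C ρ k n

/-! ### The auxiliary functions

Throughout `γ` is the anisotropy parameter (`q = exp (-iγ)`), `κ` the twist, and
`νo k`, `νe k` stand for the inhomogeneities `ν_{2k-1}`, `ν_{2k}`, `k = 1, …, N+1`. -/

/-- The kernel `K(z) = coth (z + iγ) - coth (z - iγ)`. -/
def kernelK (γ : ℝ) (z : ℂ) : ℂ :=
  Complex.cosh (z + Complex.I * γ) / Complex.sinh (z + Complex.I * γ) -
    Complex.cosh (z - Complex.I * γ) / Complex.sinh (z - Complex.I * γ)

/-- The weight `b(z, w) = sinh (z - w) / sinh (z - w - iγ)` of the `R`-matrix. -/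
def weightB (γ : ℝ) (z w : ℂ) : ℂ :=
  Complex.sinh (z - w) / Complex.sinh (z - w - Complex.I * γ)

/-- The vacuum eigenvalue `a(z) = q^κ ∏ b(ν_{2k}, z)`. -/
def vacA (γ : ℝ) (κ : ℂ) {N : ℕ} (νe : Fin (N + 1) → ℂ) (z : ℂ) : ℂ :=
  Complex.exp (-(Complex.I * γ * κ)) * ∏ k, weightB γ (νe k) z

/-- The vacuum eigenvalue `d(z) = q^{-κ} ∏ b(z, ν_{2k-1})`. -/
def vacD (γ : ℝ) (κ : ℂ) {N : ℕ} (νo : Fin (N + 1) → ℂ) (z : ℂ) : ℂ :=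
  Complex.exp (Complex.I * γ * κ) * ∏ k, weightB γ z (νo k)

/-- The auxiliary function
`𝔞(z | {λ_k}, κ) = (d(z) / a(z)) ∏ sinh (z - λ_k - iγ) / sinh (z - λ_k + iγ)`. -/
def aux (γ : ℝ) (κ : ℂ) {N M : ℕ} (νo νe : Fin (N + 1) → ℂ) (rt : Fin M → ℂ) (z : ℂ) : ℂ :=
  vacD γ κ νo z / vacA γ κ νe z *
    ∏ k, (Complex.sinh (z - rt k - Complex.I * γ) / Complex.sinh (z - rt k + Complex.I * γ))

/-- `{λ_k}` is a set of pairwise distinct Bethe roots: `𝔞(λ_j | {λ_k}, κ) = -1` for all `j`. -/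
def IsBetheSolution (γ : ℝ) (κ : ℂ) {N M : ℕ} (νo νe : Fin (N + 1) → ℂ) (rt : Fin M → ℂ) : Prop :=
  Function.Injective rt ∧ ∀ j, aux γ κ νo νe rt (rt j) = -1

/-- The singular points of `aux`: the zeros of the denominators. -/
def IsSingular (γ : ℝ) {N M : ℕ} (νo νe : Fin (N + 1) → ℂ) (rt : Fin M → ℂ) (z : ℂ) : Prop :=
  (∃ k, Complex.sinh (z - νe k) = 0) ∨ (∃ k, Complex.sinh (z - νo k - Complex.I * γ) = 0) ∨
    ∃ k, Complex.sinh (z - rt k + Complex.I * γ) = 0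

/-- On and inside `C`, the only poles of the auxiliary function are those at the `ν_{2k}`, and all
of these are inside. -/
def HasStandardPoles (γ : ℝ) {N M : ℕ} (νo νe : Fin (N + 1) → ℂ) (rt : Fin M → ℂ)
    (C : Contour) : Prop :=
  (∀ k, νe k ∈ C.inside) ∧ ∀ z ∈ C.hull, IsSingular γ νo νe rt z → ∃ k, z = νe k

/-- `C` is a contour `𝒞_n` of the state with Bethe roots `{λ_k}`: all Bethe roots, but no other
zeros of `1 + 𝔞_n`, and no poles except those at the `ν_{2k}`, are on or inside `C`. -/
def IsStateContour (γ : ℝ) (κ : ℂ) {N M : ℕ} (νo νe : Fin (N + 1) → ℂ) (rt : Fin M → ℂ)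
    (C : Contour) : Prop :=
  HasStandardPoles γ νo νe rt C ∧ (∀ j, rt j ∈ C.inside) ∧
    ∀ z ∈ C.hull, aux γ κ νo νe rt z = -1 → ∃ j, z = rt j

/-- `x` lists the holes and `y` the particles with respect to the reference contour `C`, both
without repetition: the holes are the zeros of `1 + 𝔞_n` inside `C` that are not Bethe roots, the
particles are the Bethe roots outside `C`. No zero of `1 + 𝔞_n` is on `C`. -/
def AreHolesAndParticles (γ : ℝ) (κ : ℂ) {N M nh np : ℕ} (νo νe : Fin (N + 1) → ℂ)
    (rt : Fin M → ℂ) (C : Contour) (x : Fin nh → ℂ) (y : Fin np → ℂ) : Prop :=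
  (∀ z ∈ C.trace, aux γ κ νo νe rt z ≠ -1) ∧
    Function.Injective x ∧
    Set.range x = {z | z ∈ C.inside ∧ aux γ κ νo νe rt z = -1 ∧ z ∉ Set.range rt} ∧
    Function.Injective y ∧
    Set.range y = {z | z ∈ Set.range rt ∧ z ∉ C.inside}

/-! ### The nonlinear integral equation in particle-hole form -/

/-- The points `z` for which `K(z - μ)` has no pole at any `μ` on or inside `C` and which are
not singularities of the driving terms of the nonlinear integral equation. -/
def nlieDomain (γ : ℝ) {N np : ℕ} (νo νe : Fin (N + 1) → ℂ) (C : Contour) (v : Fin np → ℂ) :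
    Set ℂ :=
  {z | (∀ w ∈ C.hull, Complex.sinh (z - w + Complex.I * γ) ≠ 0 ∧
          Complex.sinh (z - w - Complex.I * γ) ≠ 0) ∧
    (∀ k, Complex.sinh (z - νe k) ≠ 0) ∧ (∀ k, Complex.sinh (z - νo k - Complex.I * γ) ≠ 0) ∧
    ∀ k, Complex.sinh (Complex.I * γ + (z - v k)) ≠ 0}

/-- `exp (iθ(z)) = sinh (iγ + z) / sinh (iγ - z)`, with `θ` the bare phase. -/
def expPhase (γ : ℝ) (z : ℂ) : ℂ :=
  Complex.sinh (Complex.I * γ + z) / Complex.sinh (Complex.I * γ - z)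

/-- The exponential of the inhomogeneity `2iγκ - k_s e_N(z)/T`. -/
def expDriving (γ : ℝ) (κ : ℂ) {N : ℕ} (νo νe : Fin (N + 1) → ℂ) (z : ℂ) : ℂ :=
  Complex.exp (2 * Complex.I * γ * κ) *
    ∏ k, (Complex.sinh (z - νo k) / Complex.sinh (z - νe k) *
      (Complex.sinh (z - νe k - Complex.I * γ) / Complex.sinh (z - νo k - Complex.I * γ)))

/-- `f` solves, for the pseudo-spin `s` and the parameters `u` (holes) and `v` (particles), the
nonlinear integral equation with respect to `C`
`ln f(z) = iπs + 2iγκ - k_s e_N(z)/T + i ∑ θ(z - u_j) - i ∑ θ(z - v_k)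
  - ∫_C dμ/(2πi) K(z - μ) ln (1 + f)(μ)`
(here exponentiated, which makes it independent of the branches of the logarithms), where
`ln (1 + f)` has trivial monodromy along `C`. -/
structure SolvesNLIE (γ : ℝ) (κ : ℂ) {N nh np : ℕ} (s : ℤ) (νo νe : Fin (N + 1) → ℂ) (C : Contour)
    (u : Fin nh → ℂ) (v : Fin np → ℂ) (f : ℂ → ℂ) : Prop where
  analytic : ∀ z ∈ C.trace, AnalyticAt ℂ f z
  ne_zero : ∀ z ∈ C.trace, 1 + f z ≠ 0
  monodromy : C.logOneAdd f 1 = 0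
  equation : ∀ z ∈ nlieDomain γ νo νe C v,
    f z = (-1) ^ s * expDriving γ κ νo νe z * (∏ j, expPhase γ (z - u j)) *
      (∏ k, expPhase γ (z - v k))⁻¹ *
      Complex.exp (-((2 * Real.pi * Complex.I)⁻¹ *
        ∫ t in (0 : ℝ)..1, kernelK γ (z - C.toFun t) * C.logOneAdd f t * deriv C.toFun t))

/-- `A z u v` is, for `(u, v)` in a neighbourhood of `(x, y)`, a solution of the nonlinear integral
equation with parameters `u` and `v`, and it is holomorphic in `(z, u, v)` there. -/
structure IsSolutionFamily (γ : ℝ) (κ : ℂ) {N nh np : ℕ} (s : ℤ) (νo νe : Fin (N + 1) → ℂ)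
    (C : Contour) (x : Fin nh → ℂ) (y : Fin np → ℂ)
    (A : ℂ → (Fin nh → ℂ) → (Fin np → ℂ) → ℂ) : Prop where
  solves : ∀ᶠ p : (Fin nh → ℂ) × (Fin np → ℂ) in 𝓝 (x, y),
    SolvesNLIE γ κ s νo νe C p.1 p.2 (fun z => A z p.1 p.2)
  holomorphic : ∀ z ∈ nlieDomain γ νo νe C y,
    AnalyticAt ℂ (fun p : ℂ × (Fin nh → ℂ) × (Fin np → ℂ) => A p.1 p.2.1 p.2.2) (z, x, y)

/-- The Jacobian matrix of `(u, v) ↦ (A(u_j | u, v), A(v_j | u, v))` at `(x, y)`, made up of the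
partial derivatives `∂/∂u_k` and `∂/∂v_k`, which also act on the first argument. -/
def jacobian {nh np : ℕ} (A : ℂ → (Fin nh → ℂ) → (Fin np → ℂ) → ℂ)
    (x : Fin nh → ℂ) (y : Fin np → ℂ) : Matrix (Fin nh ⊕ Fin np) (Fin nh ⊕ Fin np) ℂ :=
  Matrix.fromBlocks
    (Matrix.of fun j k => deriv
      (fun z => A (Function.update x k z j) (Function.update x k z) y) (x k))
    (Matrix.of fun j k => deriv
      (fun z => A (x j) x (Function.update y k z)) (y k))
    (Matrix.of fun j k => deriv
      (fun z => A (y j) (Function.update x k z) y) (x k))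
    (Matrix.of fun j k => deriv
      (fun z => A (Function.update y k z j) x (Function.update y k z)) (y k))

/-- The density of the measure `dm_0(z) = dz / (2πi (1 + 𝔞_n(z)))`. -/
def densityM0 (f : ℂ → ℂ) (z : ℂ) : ℂ := 1 / (2 * Real.pi * Complex.I * (1 + f z))

end XXZ

end

/-! Write `𝔞_n = num / den` with the entire functions `auxNum` and `auxDen`. On the contours the
density of `dm_0` is `den / (2πi (den + num))`, so the poles of `𝔞_n` at the `ν_{2k}` are harmless,
and on the hulls the only poles are zeros of `1 + 𝔞_n`. Bethe roots inside both contours are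
encircled once by each and drop out of the difference, whatever their multiplicity. Hence, against a
function meromorphic in the plane and analytic on both hulls, `dm_0` on `C_n` equals `dm_0` on
`C_{0,s}` plus masses `w = 1/𝔞_n'` at the particles and `w = -1/𝔞_n'` at the holes
(`integral_densityM0_sub`). Since differences of points of the hulls avoid `±iγ`, `det K(z_i - z_j)`
is such a function of each variable, and the measure can be exchanged one variable at a time
(`integral_pi_transfer`).

Let `z_j` be the holes and particles. A determinant with two equal rows vanishes, so each point mass
is met at most once in a term of the Fredholm series; the masses therefore amount to a finite border
of rows and columns (`borderedDet_add_sum_dirac`). If `h_j = K(· - z_j) + K̂ h_j`, then adding the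
image of `w_j h_j` under `1 - K̂` to the `j`-th border column does not change the value
(`borderedDet_update_add`), clears that column on the contour and leaves `δ_ij - w_j h_j(z_i)` in
the corner. The quotient of the two Fredholm determinants is thus a finite determinant
(`tsum_seriesTerm_eq_mul_det`). Only the existence of the `h_j` enters, not the invertibility of `1
- K̂`.

The `h_j` come from the nonlinear integral equation. Its derivative in the position of the `k`-th
hole (`ε_k = -1`) or particle (`ε_k = 1`) is `∂_k ln 𝔞 = ε_k H_k`, where `H_k = K(· - z_k) - (2πi)⁻¹
∫ K H_k 𝔞/(1 + 𝔞)`. Here `𝔞/(1 + 𝔞) = 1 - 1/(1 + 𝔞)`, and the `1` contributes nothing by Cauchy's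
theorem, `H_k` being a superposition of kernels `K(· - w)`. What remains is the equation required of
`h_k` (`exists_dressed`). As `𝔞 = -1` at `z_i`, the Jacobian has entries `δ_ik 𝔞'(z_i) - ε_k
H_k(z_i) = 𝔞'(z_k) (δ_ik - w_k H_k(z_i))`, which is the same finite determinant with its columns
scaled by `𝔞'(z_k)`. Convergence of all series follows from Hadamard's inequality. -/

namespace XXZ

open MeasureTheory Set Filter

/-! ### Piecewise `C¹` contours: regularity, integrals, winding numbers, compactness of the hull -/

namespace Contour

variable (C : Contour)

/-- The piece extends to the next break point after `t`, or to `1` if there is none. -/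
lemma exists_right_piece {t : ℝ} (h0 : 0 ≤ t) (h1 : t < 1) :
    ∃ b, t < b ∧ b ≤ 1 ∧ ContDiffOn ℝ 1 C.toFun (Icc t b) := by
  classical
  obtain ⟨S, hS⟩ := C.piecewise_contDiff
  have hne : (insert 1 (S.filter (t < ·))).Nonempty := Finset.insert_nonempty _ _
  refine ⟨(insert 1 (S.filter (t < ·))).min' hne, ?_, Finset.min'_le _ _ (by simp), ?_⟩
  · rw [Finset.lt_min'_iff]
    intro s hs
    rcases Finset.mem_insert.1 hs with rfl | hs
    exacts [h1, (Finset.mem_filter.1 hs).2]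
  · refine hS _ _ h0 ?_ (Finset.min'_le _ _ (by simp)) fun s hs hs' => ?_
    · rw [Finset.lt_min'_iff]
      intro s hs
      rcases Finset.mem_insert.1 hs with rfl | hs
      exacts [h1, (Finset.mem_filter.1 hs).2]
    · exact absurd (Finset.min'_le _ s (by simp [hs, hs'.1])) (not_le.2 hs'.2)

lemma exists_left_piece {t : ℝ} (h0 : 0 < t) (h1 : t ≤ 1) :
    ∃ a, 0 ≤ a ∧ a < t ∧ ContDiffOn ℝ 1 C.toFun (Icc a t) := by
  classical
  obtain ⟨S, hS⟩ := C.piecewise_contDiff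
  have hne : (insert 0 (S.filter (· < t))).Nonempty := Finset.insert_nonempty _ _
  have hlt : (insert 0 (S.filter (· < t))).max' hne < t := by
    rw [Finset.max'_lt_iff]
    intro s hs
    rcases Finset.mem_insert.1 hs with rfl | hs
    exacts [h0, (Finset.mem_filter.1 hs).2]
  have hle : 0 ≤ (insert 0 (S.filter (· < t))).max' hne := Finset.le_max' _ _ (by simp)
  refine ⟨_, hle, hlt, hS _ _ hle hlt h1 fun s hs hs' => ?_⟩
  exact absurd (Finset.le_max' _ s (by simp [hs, hs'.2])) (not_le.2 hs'.1)

lemma continuousOn : ContinuousOn C.toFun (Icc 0 1) := by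
  intro t ht
  have hl : ContinuousWithinAt C.toFun (Icc 0 t) t := by
    rcases eq_or_lt_of_le ht.1 with rfl | h0
    · simp [continuousWithinAt_singleton]
    · obtain ⟨a, _, hat, hC⟩ := C.exists_left_piece h0 ht.2
      refine (hC.continuousOn t ⟨hat.le, le_rfl⟩).mono_of_mem_nhdsWithin ?_
      filter_upwards [mem_nhdsWithin_of_mem_nhds (Ioi_mem_nhds hat), self_mem_nhdsWithin]
        with s hs hs' using ⟨le_of_lt hs, hs'.2⟩
  have hr : ContinuousWithinAt C.toFun (Icc t 1) t := by
    rcases eq_or_lt_of_le ht.2 with rfl | h0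
    · simp [continuousWithinAt_singleton]
    · obtain ⟨b, htb, _, hC⟩ := C.exists_right_piece ht.1 h0
      refine (hC.continuousOn t ⟨le_rfl, htb.le⟩).mono_of_mem_nhdsWithin ?_
      filter_upwards [mem_nhdsWithin_of_mem_nhds (Iio_mem_nhds htb), self_mem_nhdsWithin]
        with s hs hs' using ⟨hs'.1, le_of_lt hs⟩
  exact (hl.union hr).mono (Icc_subset_Icc_union_Icc)

lemma exists_bound_piece {a b : ℝ} (hab : a < b) (hC : ContDiffOn ℝ 1 C.toFun (Icc a b)) :
    ∃ B, ∀ t ∈ Ioo a b, ‖deriv C.toFun t‖ ≤ B := by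
  obtain ⟨B, hB⟩ := isCompact_Icc.exists_bound_of_continuousOn
    (hC.continuousOn_derivWithin (uniqueDiffOn_Icc hab) le_rfl)
  refine ⟨B, fun t ht => ?_⟩
  rw [← derivWithin_of_mem_nhds (Icc_mem_nhds ht.1 ht.2)]
  exact hB t (Ioo_subset_Icc_self ht)

/-- At a break point `deriv` is whatever value Lean assigns to it. It is bounded locally, from the
smooth pieces on either side together with that single value, and compactness of `[0,1]` makes the
bound global. -/
lemma exists_deriv_bound : ∃ B, 0 ≤ B ∧ ∀ t ∈ Icc (0 : ℝ) 1, ‖deriv C.toFun t‖ ≤ B := by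
  suffices h : ∃ B, ∀ t ∈ Icc (0 : ℝ) 1, ‖deriv C.toFun t‖ ≤ B by
    obtain ⟨B, hB⟩ := h
    exact ⟨max B 0, le_max_right _ _, fun t ht => (hB t ht).trans (le_max_left _ _)⟩
  refine isCompact_Icc.induction_on (p := fun s => ∃ B, ∀ t ∈ s, ‖deriv C.toFun t‖ ≤ B)
    ⟨0, by simp⟩ (fun s t hst ⟨B, hB⟩ => ⟨B, fun x hx => hB x (hst hx)⟩)
    (fun s t ⟨B, hB⟩ ⟨B', hB'⟩ => ⟨max B B', ?_⟩) fun t ht => ?_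
  · rintro x (hx | hx)
    exacts [(hB x hx).trans (le_max_left _ _), (hB' x hx).trans (le_max_right _ _)]
  · obtain ⟨a, B₁, hat, hB₁⟩ : ∃ a B, a < t ∧ ∀ s ∈ Icc (0 : ℝ) 1, a < s → s < t →
        ‖deriv C.toFun s‖ ≤ B := by
      rcases eq_or_lt_of_le ht.1 with rfl | h0
      · exact ⟨-1, 0, by norm_num, fun s hs _ h => absurd hs.1 (not_le.2 h)⟩
      · obtain ⟨a, _, hat, hC⟩ := C.exists_left_piece h0 ht.2
        obtain ⟨B, hB⟩ := C.exists_bound_piece hat hC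
        exact ⟨a, B, hat, fun s _ h h' => hB s ⟨h, h'⟩⟩
    obtain ⟨b, B₂, htb, hB₂⟩ : ∃ b B, t < b ∧ ∀ s ∈ Icc (0 : ℝ) 1, t < s → s < b →
        ‖deriv C.toFun s‖ ≤ B := by
      rcases eq_or_lt_of_le ht.2 with rfl | h0
      · exact ⟨2, 0, by norm_num, fun s hs h _ => absurd hs.2 (not_le.2 h)⟩
      · obtain ⟨b, htb, _, hC⟩ := C.exists_right_piece ht.1 h0
        obtain ⟨B, hB⟩ := C.exists_bound_piece htb hC
        exact ⟨b, B, htb, fun s _ h h' => hB s ⟨h, h'⟩⟩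
    refine ⟨Icc 0 1 ∩ Ioo a b, inter_mem_nhdsWithin _ (Ioo_mem_nhds hat htb),
      max ‖deriv C.toFun t‖ (max B₁ B₂), fun s hs => ?_⟩
    rcases lt_trichotomy s t with h | rfl | h
    · exact (hB₁ s hs.1 hs.2.1 h).trans ((le_max_left _ _).trans (le_max_right _ _))
    · exact le_max_left _ _
    · exact (hB₂ s hs.1 h hs.2.2).trans ((le_max_right _ _).trans (le_max_right _ _))

lemma exists_finite_break : ∃ S : Set ℝ, S.Countable ∧ ∀ t ∈ Ioo (0 : ℝ) 1, t ∉ S →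
    DifferentiableAt ℝ C.toFun t := by
  obtain ⟨S, hS⟩ := C.piecewise_contDiff
  refine ⟨S, S.countable_toSet, fun t ht htS => ?_⟩
  have hU : (Ioo (0 : ℝ) 1 \ S) ∈ 𝓝 t :=
    (isOpen_Ioo.sdiff S.finite_toSet.isClosed).mem_nhds ⟨ht, htS⟩
  obtain ⟨ε, hε, hball⟩ := Metric.mem_nhds_iff.1 hU
  have hsub : Icc (t - ε / 2) (t + ε / 2) ⊆ Ioo (0 : ℝ) 1 \ S := by
    refine Subset.trans (fun s hs => ?_) hball
    rw [Metric.mem_ball, Real.dist_eq, abs_lt]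
    constructor <;> linarith [hs.1, hs.2]
  have hlt : t - ε / 2 < t + ε / 2 := by linarith
  have h1 := hsub (left_mem_Icc.2 hlt.le)
  have h2 := hsub (right_mem_Icc.2 hlt.le)
  have := hS _ _ h1.1.1.le hlt h2.1.2.le fun s hs hs' => (hsub (Ioo_subset_Icc_self hs')).2 hs
  exact (this.contDiffAt (Icc_mem_nhds (by linarith) (by linarith))).differentiableAt one_ne_zero

lemma mem_trace {t : ℝ} (ht : t ∈ Icc (0 : ℝ) 1) : C.toFun t ∈ C.trace := mem_image_of_mem _ ht

lemma isCompact_trace : IsCompact C.trace := isCompact_Icc.image_of_continuousOn C.continuousOn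

lemma intervalIntegrable_of_continuousOn {f : ℝ → ℂ} (hf : ContinuousOn f (Icc 0 1)) {a b : ℝ}
    (ha : a ∈ Icc (0 : ℝ) 1) (hb : b ∈ Icc (0 : ℝ) 1) :
    IntervalIntegrable (fun t => f t * deriv C.toFun t) volume a b := by
  obtain ⟨B, hB0, hB⟩ := C.exists_deriv_bound
  obtain ⟨D, hD⟩ := isCompact_Icc.exists_bound_of_continuousOn hf
  have h01 : IntegrableOn (fun t => f t * deriv C.toFun t) (Icc 0 1) := by
    refine Integrable.of_bound (C := D * B) ?_ ?_
    · exact (hf.aestronglyMeasurable measurableSet_Icc).mul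
        (measurable_deriv _).aestronglyMeasurable
    · refine (ae_restrict_iff' measurableSet_Icc).2 (.of_forall fun t ht => ?_)
      rw [norm_mul]
      exact mul_le_mul (hD t ht) (hB t ht) (norm_nonneg _) ((norm_nonneg _).trans (hD t ht))
  rw [intervalIntegrable_iff]
  exact h01.mono_set (uIoc_subset_uIcc.trans (uIcc_subset_Icc ha hb))

lemma continuousOn_comp {f : ℂ → ℂ} (hf : ContinuousOn f C.trace) :
    ContinuousOn (fun t => f (C.toFun t)) (Icc 0 1) :=
  hf.comp C.continuousOn fun _ ht => C.mem_trace ht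

/-- The integral of a derivative along an initial piece of a contour. -/
lemma integral_deriv_comp {F F' : ℂ → ℂ} (hF : ∀ w ∈ C.trace, HasDerivAt F (F' w) w)
    (hF' : ContinuousOn F' C.trace) {b : ℝ} (hb : b ∈ Icc (0 : ℝ) 1) :
    ∫ t in (0 : ℝ)..b, F' (C.toFun t) * deriv C.toFun t = F (C.toFun b) - F (C.toFun 0) := by
  obtain ⟨S, hS, hd⟩ := C.exists_finite_break
  have hsub : uIcc 0 b ⊆ Icc (0 : ℝ) 1 := uIcc_subset_Icc (by simp) hb
  refine integral_eq_of_hasDerivAt_off_countable (fun t => F (C.toFun t)) _ hS ?_ ?_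
    (C.intervalIntegrable_of_continuousOn (C.continuousOn_comp hF') (by simp) hb)
  · refine (C.continuousOn_comp fun w hw => ?_).mono hsub
    exact (hF w hw).continuousAt.continuousWithinAt
  · rintro t ⟨ht, htS⟩
    rw [min_eq_left hb.1, max_eq_right hb.1] at ht
    have ht' : t ∈ Ioo (0 : ℝ) 1 := ⟨ht.1, ht.2.trans_le hb.2⟩
    exact (hF _ (C.mem_trace (Ioo_subset_Icc_self ht'))).scomp t (hd t ht' htS).hasDerivAt
      |>.congr_deriv (by simp [mul_comm])

/-- The integral of a function along a contour. -/
noncomputable def integral (f : ℂ → ℂ) : ℂ := ∫ t in (0 : ℝ)..1, f (C.toFun t) * deriv C.toFun t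

lemma intervalIntegrable {f : ℂ → ℂ} (hf : ContinuousOn f C.trace) :
    IntervalIntegrable (fun t => f (C.toFun t) * deriv C.toFun t) volume 0 1 :=
  C.intervalIntegrable_of_continuousOn (C.continuousOn_comp hf) (by simp) (by simp)

lemma integral_congr {f g : ℂ → ℂ} (h : ∀ w ∈ C.trace, f w = g w) :
    C.integral f = C.integral g := by
  refine intervalIntegral.integral_congr fun t ht => ?_
  rw [uIcc_of_le zero_le_one] at ht
  simp only [h _ (C.mem_trace ht)]

lemma integral_add {f g : ℂ → ℂ} (hf : ContinuousOn f C.trace) (hg : ContinuousOn g C.trace) :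
    C.integral (fun z => f z + g z) = C.integral f + C.integral g := by
  rw [integral, integral, integral, ← intervalIntegral.integral_add (C.intervalIntegrable hf)
    (C.intervalIntegrable hg)]
  simp only [add_mul]

lemma integral_const_mul (c : ℂ) (f : ℂ → ℂ) :
    C.integral (fun z => c * f z) = c * C.integral f := by
  simp only [integral, mul_assoc, intervalIntegral.integral_const_mul]

lemma integral_eq_zero_of_hasDerivAt {F F' : ℂ → ℂ} (hF : ∀ w ∈ C.trace, HasDerivAt F (F' w) w)
    (hF' : ContinuousOn F' C.trace) : C.integral F' = 0 := by
  rw [integral, C.integral_deriv_comp hF hF' (by simp), C.closed, sub_self]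

lemma integral_inv_sub (z : ℂ) :
    C.integral (fun w => (w - z)⁻¹) = 2 * Real.pi * Complex.I * windingNumber C.toFun z := by
  have : (2 * Real.pi * Complex.I : ℂ) ≠ 0 := by simp [Real.pi_ne_zero]
  rw [windingNumber, mul_inv_cancel_left₀ this]
  exact intervalIntegral.integral_congr fun t _ => by simp [div_eq_mul_inv, mul_comm]

lemma norm_integral_le {B : ℝ} (hB : ∀ t ∈ Icc (0 : ℝ) 1, ‖deriv C.toFun t‖ ≤ B) {f : ℂ → ℂ}
    {D : ℝ} (hD0 : 0 ≤ D) (hD : ∀ w ∈ C.trace, ‖f w‖ ≤ D) : ‖C.integral f‖ ≤ D * B := by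
  have := intervalIntegral.norm_integral_le_of_norm_le_const (a := 0) (b := 1) (C := D * B)
    (f := fun t => f (C.toFun t) * deriv C.toFun t) fun t ht => by
      rw [uIoc_of_le zero_le_one] at ht
      have ht := Ioc_subset_Icc_self ht
      rw [norm_mul]
      exact mul_le_mul (hD _ (C.mem_trace ht)) (hB t ht) (norm_nonneg _) hD0
  simpa [integral] using this

lemma windingNumber_eq_zero {z : ℂ} (hz : z ∉ C.hull) : windingNumber C.toFun z = 0 := by
  have h : z ∉ C.trace := fun h => hz (Or.inl h)
  exact (C.winding z h).resolve_right fun h1 => hz (Or.inr ⟨h, h1⟩)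

lemma inside_subset_hull : C.inside ⊆ C.hull := subset_union_right

lemma trace_subset_hull : C.trace ⊆ C.hull := subset_union_left

lemma continuousAt_windingNumber {z : ℂ} (hz : z ∉ C.trace) :
    ContinuousAt (windingNumber C.toFun) z := by
  obtain ⟨B, hB0, hB⟩ := C.exists_deriv_bound
  obtain ⟨ε, hε, hball⟩ := Metric.isOpen_iff.1 C.isCompact_trace.isClosed.isOpen_compl z hz
  refine ContinuousAt.mul continuousAt_const ?_
  -- `ε` is a distance from `z` that the trace avoids, so points within `ε / 2` of `z` stay at
  -- distance `ε / 2` from the trace.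
  refine intervalIntegral.continuousAt_of_dominated_interval (bound := fun _ => B / (ε / 2))
    ?_ ?_ (by simp) ?_
  · filter_upwards [Metric.ball_mem_nhds z hε] with w hw
    refine (intervalIntegrable_iff.1 (C.intervalIntegrable
      (f := fun u => (u - w)⁻¹) ?_)).aestronglyMeasurable.congr
      (.of_forall fun t => by simp [div_eq_mul_inv, mul_comm])
    exact (continuousOn_id.sub continuousOn_const).inv₀ fun u hu h =>
      hball hw ((sub_eq_zero.1 h : u = w) ▸ hu)
  · filter_upwards [Metric.ball_mem_nhds z (half_pos hε)] with w hw
    refine .of_forall fun t ht => ?_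
    rw [uIoc_of_le zero_le_one] at ht
    have ht := Ioc_subset_Icc_self ht
    rw [norm_div]
    refine div_le_div₀ hB0 (hB t ht) (half_pos hε) ?_
    have h1 : ε ≤ dist (C.toFun t) z := not_lt.1 fun h => hball h (C.mem_trace ht)
    have h2 := dist_triangle (C.toFun t) w z
    rw [Metric.mem_ball] at hw
    rw [← dist_eq_norm]
    linarith
  · refine .of_forall fun t ht => ?_
    rw [uIoc_of_le zero_le_one] at ht
    refine continuousAt_const.div (continuousAt_const.sub continuousAt_id) ?_
    exact sub_ne_zero.2 fun h => hz (h ▸ C.mem_trace (Ioc_subset_Icc_self ht))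

/-- Off the hull the winding number is `0`; by continuity its norm stays below `1` nearby, so it
cannot jump to `1`. -/
lemma isClosed_hull : IsClosed C.hull := by
  rw [← isOpen_compl_iff, isOpen_iff_mem_nhds]
  intro z hz
  have hzt : z ∉ C.trace := fun h => hz (C.trace_subset_hull h)
  have h0 := C.windingNumber_eq_zero hz
  have hc := (C.continuousAt_windingNumber hzt).norm.eventually_lt (continuousAt_const (y := (1:ℝ)))
    (by simp [h0])
  filter_upwards [hc, C.isCompact_trace.isClosed.isOpen_compl.mem_nhds hzt] with w hw hw'
  rintro (h | h)
  · exact hw' h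
  · simp [h.2] at hw

/-- Beyond distance `B + 1` from the trace the integral defining `2πi` times the winding number has
norm at most `B / (B + 1)`, which is less than `2π`. -/
lemma isBounded_hull : Bornology.IsBounded C.hull := by
  obtain ⟨B, hB0, hB⟩ := C.exists_deriv_bound
  obtain ⟨R, hR⟩ := C.isCompact_trace.isBounded.exists_norm_le
  refine isBounded_iff_forall_norm_le.2 ⟨|R| + B + 1, ?_⟩
  rintro z (hz | ⟨hz, h1⟩)
  · linarith [hR z hz, le_abs_self R]
  · by_contra! hlt
    have hle : ‖C.integral (fun w => (w - z)⁻¹)‖ ≤ (B + 1)⁻¹ * B := by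
      refine C.norm_integral_le hB (by positivity) fun w hw => ?_
      rw [norm_inv]
      refine inv_anti₀ (by positivity) ?_
      have := norm_sub_norm_le z w
      rw [norm_sub_rev] at this
      linarith [hR w hw, le_abs_self R]
    rw [integral_inv_sub, h1, mul_one] at hle
    have h2 : ‖(2 * Real.pi * Complex.I : ℂ)‖ = 2 * Real.pi := by
      simp [abs_of_pos Real.pi_pos]
    rw [h2] at hle
    have h3 : (B + 1)⁻¹ * B ≤ 1 := by
      rw [inv_mul_le_iff₀ (by positivity)]; linarith
    linarith [Real.pi_gt_three]

lemma isCompact_hull : IsCompact C.hull :=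
  Metric.isCompact_of_isClosed_isBounded C.isClosed_hull C.isBounded_hull

end Contour

end XXZ

/-! ### The residue theorem for contours with arbitrary winding numbers -/

namespace XXZ

open MeasureTheory Set Filter

/-- `h` agrees near `z`, except possibly at `z`, with a function analytic at `z`. -/
def Removable (h : ℂ → ℂ) (z : ℂ) : Prop := ∃ g, AnalyticAt ℂ g z ∧ h =ᶠ[𝓝[≠] z] g

lemma Removable.of_analyticAt {h : ℂ → ℂ} {z : ℂ} (hh : AnalyticAt ℂ h z) : Removable h z :=
  ⟨h, hh, .rfl⟩

lemma Removable.congr {h k : ℂ → ℂ} {z : ℂ} (hh : Removable h z) (hk : h =ᶠ[𝓝[≠] z] k) :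
    Removable k z :=
  hh.imp fun _ hg => ⟨hg.1, hk.symm.trans hg.2⟩

lemma Removable.add {h k : ℂ → ℂ} {z : ℂ} (hh : Removable h z) (hk : Removable k z) :
    Removable (fun w => h w + k w) z := by
  obtain ⟨g, hg, hhg⟩ := hh
  obtain ⟨l, hl, hkl⟩ := hk
  exact ⟨_, hg.add hl, hhg.add hkl⟩

lemma Contour.integral_inv_pow (C : Contour) {z : ℂ} (hz : z ∉ C.trace) (n : ℕ) :
    C.integral (fun w => ((w - z) ^ (n + 1))⁻¹) =
      if n = 0 then 2 * Real.pi * Complex.I * windingNumber C.toFun z else 0 := by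
  split_ifs with hn
  · simp [hn, C.integral_inv_sub]
  · have hne : ∀ w ∈ C.trace, w - z ≠ 0 := fun w hw h => hz (sub_eq_zero.1 h ▸ hw)
    refine C.integral_eq_zero_of_hasDerivAt (F := fun w => -(n : ℂ)⁻¹ * ((w - z) ^ n)⁻¹)
      (fun w hw => ?_) fun w hw => ?_
    · have h1 := ((((hasDerivAt_id w).sub_const z).pow n).inv (pow_ne_zero n (hne w hw))).const_mul
        (-(n : ℂ)⁻¹)
      refine h1.congr_deriv ?_
      have := hne w hw
      obtain ⟨m, rfl⟩ := Nat.exists_eq_succ_of_ne_zero hn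
      have hm : ((m : ℂ) + 1) ≠ 0 := by exact_mod_cast m.succ_ne_zero
      simp only [id, Nat.succ_eq_add_one, Nat.cast_add, Nat.cast_one, Nat.add_sub_cancel,
        Pi.pow_apply]
      field_simp
      ring
    · exact (((continuousAt_id.sub continuousAt_const).pow _).inv₀
        (pow_ne_zero _ (hne w hw))).continuousWithinAt

/-- Induction on the order of the pole: the leading term is peeled off, and of the pure powers only
the first inverse power has a nonzero integral. The factor `2πi` is included in `r`. -/
lemma exists_principal_part_of_pow {z₀ : ℂ} (n : ℕ) : ∀ {h : ℂ → ℂ},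
    Removable (fun z => (z - z₀) ^ n * h z) z₀ →
    ∃ (P g : ℂ → ℂ) (r : ℂ), AnalyticAt ℂ g z₀ ∧ (h =ᶠ[𝓝[≠] z₀] fun z => P z + g z) ∧
      (∀ z ≠ z₀, AnalyticAt ℂ P z) ∧
      ∀ C : Contour, z₀ ∉ C.trace → C.integral P = r * windingNumber C.toFun z₀ := by
  induction n with
  | zero =>
    rintro h ⟨g, hg, hhg⟩
    refine ⟨0, g, 0, hg, ?_, fun z _ => analyticAt_const, fun C _ => by simp [Contour.integral]⟩
    simpa using hhg
  | succ n ih =>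
    rintro h ⟨g, hg, hhg⟩
    -- With `g = (z - z₀)^(n+1) h`, removing `g(z₀) (z - z₀)^(-(n+1))` from `h` leaves `(g - g(z₀))
    -- / (z - z₀)` after multiplication by `(z - z₀)^n`, an analytic function.
    obtain ⟨P, k, r, hk, hPk, hP, hr⟩ :=
      ih (h := fun z => h z - g z₀ * ((z - z₀) ^ (n + 1))⁻¹) ⟨dslope g z₀, by
        obtain ⟨p, hp⟩ := hg
        exact hp.has_fpower_series_dslope_fslope.analyticAt, by
        filter_upwards [hhg, self_mem_nhdsWithin] with z hz hne
        have : z - z₀ ≠ 0 := sub_ne_zero.2 hne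
        rw [dslope_of_ne _ hne, slope_def_field, ← hz]
        field_simp
        ring⟩
    have hP' : ∀ z ≠ z₀, AnalyticAt ℂ (fun z => ((z - z₀) ^ (n + 1))⁻¹) z := fun z hz =>
      ((analyticAt_id.sub analyticAt_const).pow _).inv (pow_ne_zero _ (sub_ne_zero.2 hz))
    refine ⟨fun z => P z + g z₀ * ((z - z₀) ^ (n + 1))⁻¹, k,
      r + if n = 0 then g z₀ * (2 * Real.pi * Complex.I) else 0, hk, ?_,
      fun z hz => (hP z hz).add (analyticAt_const.mul (hP' z hz)), fun C hC => ?_⟩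
    · filter_upwards [hPk] with z hz
      linear_combination hz
    · have hne : ∀ w ∈ C.trace, w ≠ z₀ := fun w hw h => hC (h ▸ hw)
      rw [C.integral_add (f := P) (g := fun z => g z₀ * ((z - z₀) ^ (n + 1))⁻¹)
        (fun w hw => (hP w (hne w hw)).continuousAt.continuousWithinAt)
        (fun w hw => (analyticAt_const.mul (hP' w (hne w hw))).continuousAt.continuousWithinAt),
        hr C hC, C.integral_const_mul, C.integral_inv_pow hC]
      split_ifs <;> ring

/-- The case distinction secures `r = 0` at removable singularities, so that these can later be left
out of the sum over residues. -/
lemma exists_principal_part {h : ℂ → ℂ} {z₀ : ℂ} (hh : MeromorphicAt h z₀) :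
    ∃ (P g : ℂ → ℂ) (r : ℂ), AnalyticAt ℂ g z₀ ∧ (h =ᶠ[𝓝[≠] z₀] fun z => P z + g z) ∧
      (∀ z ≠ z₀, AnalyticAt ℂ P z) ∧
      (∀ C : Contour, z₀ ∉ C.trace → C.integral P = r * windingNumber C.toFun z₀) ∧
      (Removable h z₀ → r = 0) := by
  by_cases hrem : Removable h z₀
  · obtain ⟨g, hg, hhg⟩ := hrem
    exact ⟨0, g, 0, hg, by simpa using hhg, fun z _ => analyticAt_const,
      fun C _ => by simp [Contour.integral], fun _ => rfl⟩
  · obtain ⟨n, hn⟩ := hh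
    obtain ⟨P, g, r, h1, h2, h3, h4⟩ := exists_principal_part_of_pow n (Removable.of_analyticAt hn)
    exact ⟨P, g, r, h1, h2, h3, h4, fun h => absurd h hrem⟩

/-- The principal parts are subtracted one by one; what is left is analytic on a disc and has a
primitive there, so that it integrates to zero along every closed curve. -/
lemma residue_theorem_aux {R : ℝ} (S : Finset ℂ) : ∀ {h : ℂ → ℂ},
    (∀ z ∈ Metric.ball (0 : ℂ) R, z ∉ S → AnalyticAt ℂ h z) → (∀ z ∈ S, MeromorphicAt h z) →
    ∃ r : ℂ → ℂ, (∀ z ∈ S, Removable h z → r z = 0) ∧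
      ∀ C : Contour, C.trace ⊆ Metric.ball 0 R → (∀ z ∈ S, z ∉ C.trace) →
        C.integral h = ∑ z ∈ S, r z * windingNumber C.toFun z := by
  classical
  induction S using Finset.induction_on with
  | empty =>
    intro h hh _
    refine ⟨0, by simp, fun C hC _ => ?_⟩
    have hd : DifferentiableOn ℂ h (Metric.ball 0 R) := fun z hz =>
      (hh z hz (by simp)).differentiableAt.differentiableWithinAt
    obtain ⟨F, hF⟩ := hd.isExactOn_ball
    rw [Finset.sum_empty]
    exact C.integral_eq_zero_of_hasDerivAt (fun w hw => hF w (hC hw))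
      (hd.continuousOn.mono hC)
  | insert z₀ S hz₀ ih =>
    intro h hh hmer
    obtain ⟨P, g, r₀, hg, hPg, hP, hr₀, hrem⟩ :=
      exists_principal_part (hmer z₀ (Finset.mem_insert_self _ _))
    -- The value at `z₀` is corrected so that the difference is analytic there and not merely
    -- removable.
    set k : ℂ → ℂ := Function.update (fun z => h z - P z) z₀ (g z₀) with hk
    have hkne : ∀ z ≠ z₀, k =ᶠ[𝓝 z] fun z => h z - P z := fun z hz => by
      filter_upwards [isOpen_ne.mem_nhds hz] with w hw
      rw [hk, Function.update_of_ne hw]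
    have hkz₀ : AnalyticAt ℂ k z₀ := by
      refine hg.congr ?_
      have := eventually_nhdsWithin_iff.1 hPg
      filter_upwards [this] with w hw
      rcases eq_or_ne w z₀ with rfl | hne
      · simp [hk]
      · rw [hk, Function.update_of_ne hne, hw hne]; ring
    obtain ⟨r, hr, hrC⟩ := ih (h := k) (fun z hz hzS => by
        rcases eq_or_ne z z₀ with rfl | hne
        · exact hkz₀
        · exact ((hh z hz (by simp [hne, hzS])).sub (hP z hne)).congr (hkne z hne).symm)
      (fun z hz => by
        have hne : z ≠ z₀ := fun h => hz₀ (h ▸ hz)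
        exact ((hmer z (Finset.mem_insert_of_mem hz)).sub (hP z hne).meromorphicAt).congr
          ((hkne z hne).symm.filter_mono nhdsWithin_le_nhds))
    refine ⟨Function.update r z₀ r₀, fun z hz hzr => ?_, fun C hC hCS => ?_⟩
    · rcases eq_or_ne z z₀ with rfl | hne
      · simpa using hrem hzr
      · rw [Function.update_of_ne hne]
        refine hr z ((Finset.mem_insert.1 hz).resolve_left hne) ?_
        refine (hzr.add (.of_analyticAt (hP z hne).neg)).congr ?_
        filter_upwards [(hkne z hne).filter_mono nhdsWithin_le_nhds] with w hw
        rw [hw, Pi.neg_apply, sub_eq_add_neg]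
    · have hz₀C := hCS z₀ (Finset.mem_insert_self _ _)
      have hne : ∀ w ∈ C.trace, w ≠ z₀ := fun w hw h => hz₀C (h ▸ hw)
      rw [Finset.sum_insert hz₀, Function.update_self,
        Finset.sum_congr rfl (g := fun z => r z * windingNumber C.toFun z) fun z hz => by
          rw [Function.update_of_ne (ne_of_mem_of_not_mem hz hz₀)],
        ← hrC C hC (fun z hz => hCS z (Finset.mem_insert_of_mem hz)), ← hr₀ C hz₀C,
        ← C.integral_add]
      · refine C.integral_congr fun w hw => ?_
        rw [hk, Function.update_of_ne (hne w hw)]; ring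
      · exact fun w hw => (hP w (hne w hw)).continuousAt.continuousWithinAt
      · intro w hw
        have hwS : w ∉ insert z₀ S := fun h => hCS w h hw
        exact (((hh w (hC hw) hwS).sub (hP w (hne w hw))).congr
          (hkne w (hne w hw)).symm).continuousAt.continuousWithinAt

/-- A meromorphic function is analytic in a punctured neighbourhood of every point, so its singular
points cannot accumulate in a compact set. -/
lemma finite_not_analyticAt {h : ℂ → ℂ} (hh : ∀ z, MeromorphicAt h z) {K : Set ℂ}
    (hK : IsCompact K) : {z ∈ K | ¬ AnalyticAt ℂ h z}.Finite := by
  by_contra hinf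
  obtain ⟨z, hz, hacc⟩ := Set.Infinite.exists_accPt_of_subset_isCompact hinf hK (sep_subset _ _)
  rw [accPt_iff_frequently_nhdsNE] at hacc
  exact hacc ((hh z).eventually_analyticAt.mono fun w hw h => h.2 hw)

/-- The residue theorem for functions meromorphic in the plane. -/
theorem residue_theorem {h : ℂ → ℂ} (hh : ∀ z, MeromorphicAt h z) (R : ℝ) :
    ∃ (S : Finset ℂ) (r : ℂ → ℂ), (∀ z ∈ S, ¬ Removable h z) ∧
      ∀ C : Contour, C.trace ⊆ Metric.ball 0 R → (∀ z ∈ C.trace, AnalyticAt ℂ h z) →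
        C.integral h = ∑ z ∈ S, r z * windingNumber C.toFun z := by
  classical
  have hfin := finite_not_analyticAt hh (isCompact_closedBall (0 : ℂ) R)
  obtain ⟨r, hr, hrC⟩ := residue_theorem_aux (R := R) hfin.toFinset (h := h)
    (fun z hz hzS => by
      by_contra hna
      exact hzS (hfin.mem_toFinset.2 ⟨Metric.ball_subset_closedBall hz, hna⟩))
    (fun z _ => hh z)
  refine ⟨hfin.toFinset.filter fun z => ¬ Removable h z, r,
    fun z hz => (Finset.mem_filter.1 hz).2, fun C hC han => ?_⟩
  rw [hrC C hC fun z hz hzC => (hfin.mem_toFinset.1 hz).2 (han z hzC), Finset.sum_filter]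
  refine Finset.sum_congr rfl fun z hz => ?_
  split_ifs with hrem
  · rw [hr z hz hrem, zero_mul]
  · rfl

lemma Contour.exists_trace_subset_ball (C : Contour) : ∃ R, C.trace ⊆ Metric.ball 0 R :=
  C.isCompact_trace.isBounded.subset_ball 0

/-- Both contours are placed in one disc, so that the same residues serve for both. -/
theorem Contour.integral_eq_integral {h : ℂ → ℂ} (hh : ∀ z, MeromorphicAt h z) {C D : Contour}
    (hC : ∀ z ∈ C.trace, AnalyticAt ℂ h z) (hD : ∀ z ∈ D.trace, AnalyticAt ℂ h z)
    (hw : ∀ z, ¬ Removable h z → windingNumber C.toFun z = windingNumber D.toFun z) :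
    C.integral h = D.integral h := by
  obtain ⟨R, hR⟩ := C.exists_trace_subset_ball
  obtain ⟨R', hR'⟩ := D.exists_trace_subset_ball
  obtain ⟨S, r, hS, hI⟩ := residue_theorem hh (max R R')
  rw [hI C (hR.trans (Metric.ball_subset_ball (le_max_left _ _))) hC,
    hI D (hR'.trans (Metric.ball_subset_ball (le_max_right _ _))) hD]
  exact Finset.sum_congr rfl fun z hz => by rw [hw z (hS z hz)]

theorem Contour.integral_eq_zero {h : ℂ → ℂ} (hh : ∀ z, MeromorphicAt h z) {C : Contour}
    (hC : ∀ z ∈ C.hull, AnalyticAt ℂ h z) : C.integral h = 0 := by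
  obtain ⟨R, hR⟩ := C.exists_trace_subset_ball
  obtain ⟨S, r, hS, hI⟩ := residue_theorem hh R
  rw [hI C hR fun z hz => hC z (C.trace_subset_hull hz)]
  refine Finset.sum_eq_zero fun z hz => ?_
  rw [C.windingNumber_eq_zero fun h => hS z hz (.of_analyticAt (hC z h)), mul_zero]

end XXZ

/-! ### Hadamard's inequality and convergence of the Fredholm series -/

namespace XXZ

open MeasureTheory Set Filter

lemma prod_le_pow_arith_mean {ι : Type*} [Fintype ι] (z : ι → ℝ) (hz : ∀ i, 0 ≤ z i) {S : ℝ}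
    (hS : ∑ i, z i ≤ Fintype.card ι * S) : ∏ i, z i ≤ S ^ Fintype.card ι := by
  rcases isEmpty_or_nonempty ι with h | h
  · simp
  have hc : (0 : ℝ) < Fintype.card ι := by exact_mod_cast Fintype.card_pos
  have h1 := Real.geom_mean_le_arith_mean Finset.univ (fun _ => (1 : ℝ)) z (fun _ _ => zero_le_one)
    (by simpa using hc) fun i _ => hz i
  simp only [Real.rpow_one, Finset.sum_const, Finset.card_univ, nsmul_eq_mul, mul_one,
    one_mul] at h1
  have hP : 0 ≤ ∏ i, z i := Finset.prod_nonneg fun i _ => hz i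
  have h2 : (∏ i, z i) ^ ((Fintype.card ι : ℝ)⁻¹) ≤ S :=
    h1.trans (by rw [div_le_iff₀ hc, mul_comm]; exact hS)
  calc ∏ i, z i = ((∏ i, z i) ^ ((Fintype.card ι : ℝ)⁻¹)) ^ Fintype.card ι := by
        rw [← Real.rpow_natCast, ← Real.rpow_mul hP, inv_mul_cancel₀ hc.ne', Real.rpow_one]
    _ ≤ S ^ Fintype.card ι := pow_le_pow_left₀ (Real.rpow_nonneg hP _) h2 _

open scoped ComplexOrder in
/-- Hadamard's inequality for matrices with bounded entries. -/
theorem norm_det_le_hadamard {n : Type*} [Fintype n] [DecidableEq n] (A : Matrix n n ℂ) {B : ℝ}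
    (hB0 : 0 ≤ B) (hB : ∀ i j, ‖A i j‖ ≤ B) :
    ‖A.det‖ ≤ (√(Fintype.card n) * B) ^ Fintype.card n := by
  have hpsd := Matrix.posSemidef_conjTranspose_mul_self A
  have hdet : ∏ i, hpsd.1.eigenvalues i = ‖A.det‖ ^ 2 := by
    have h1 := hpsd.1.det_eq_prod_eigenvalues
    rw [Matrix.det_mul, Matrix.det_conjTranspose] at h1
    have h2 : (star A.det * A.det : ℂ) = ((‖A.det‖ ^ 2 : ℝ) : ℂ) := by
      rw [Complex.ofReal_pow, ← Complex.conj_mul']; rfl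
    rw [h2] at h1
    have h3 : ((‖A.det‖ ^ 2 : ℝ) : ℂ) = ((∏ i, hpsd.1.eigenvalues i : ℝ) : ℂ) := by
      rw [h1]; push_cast; rfl
    exact_mod_cast h3.symm
  have htr : ∑ i, hpsd.1.eigenvalues i = ∑ i, ∑ j, ‖A j i‖ ^ 2 := by
    have h1 := hpsd.1.trace_eq_sum_eigenvalues
    have h3 : ((∑ i, hpsd.1.eigenvalues i : ℝ) : ℂ) = ((∑ i, ∑ j, ‖A j i‖ ^ 2 : ℝ) : ℂ) := by
      push_cast
      refine Eq.trans ?_ (h1.symm.trans ?_)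
      · rfl
      · simp only [Matrix.trace, Matrix.diag, Matrix.mul_apply, Matrix.conjTranspose_apply]
        refine Finset.sum_congr rfl fun i _ => Finset.sum_congr rfl fun j _ => ?_
        rw [← Complex.conj_mul']; rfl
    exact_mod_cast h3
  -- The inequality of the means, applied to the eigenvalues of `Aᴴ A`: their product is `|det A|²`
  -- and their sum is the sum of the squared entries.
  have hle : ∏ i, hpsd.1.eigenvalues i ≤ (Fintype.card n * B ^ 2) ^ Fintype.card n := by
    refine prod_le_pow_arith_mean _ hpsd.eigenvalues_nonneg ?_
    rw [htr]
    calc ∑ i, ∑ j, ‖A j i‖ ^ 2 ≤ ∑ _i : n, ∑ _j : n, B ^ 2 := by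
          gcongr with i _ j _
          exact hB j i
      _ = _ := by simp
  rw [hdet] at hle
  refine le_of_sq_le_sq (hle.trans_eq ?_) (by positivity)
  rw [← pow_mul, mul_comm _ 2, pow_mul, mul_pow √_ B 2, Real.sq_sqrt (Nat.cast_nonneg _)]

lemma sqrt_pow_self_le (n : ℕ) : √n ^ n ≤ √(Real.exp n) * √(n.factorial) := by
  rw [← Real.sqrt_mul (Real.exp_pos _).le]
  refine Real.le_sqrt_of_sq_le ?_
  rw [← pow_mul, mul_comm, pow_mul, Real.sq_sqrt (Nat.cast_nonneg _)]
  have := Real.pow_div_factorial_le_exp (n : ℝ) (Nat.cast_nonneg n) n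
  rwa [div_le_iff₀ (by positivity)] at this

/-- From `n^n ≤ e^n n!` the numerator grows at most like `√(n!)` times a geometric factor, leaving a
series with denominators `√(n!)`. -/
lemma summable_sqrt_pow_div_factorial {D : ℝ} (hD : 0 ≤ D) :
    Summable fun n : ℕ => (√n * D) ^ n / n.factorial := by
  have hs : Summable fun n : ℕ => (√(Real.exp 1) * D) ^ n / √(n.factorial) := by
    rcases hD.eq_or_lt with rfl | hD
    · refine summable_of_ne_finset_zero (s := {0}) fun n hn => ?_
      simp [Finset.mem_singleton.not.1 hn]
    · have hpos : 0 < √(Real.exp 1) * D := by positivity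
      refine summable_of_ratio_test_tendsto_lt_one (l := 0) zero_lt_one
        (.of_forall fun n => by positivity) ?_
      have : ∀ n : ℕ, ‖(√(Real.exp 1) * D) ^ (n + 1) / √((n + 1).factorial)‖ /
          ‖(√(Real.exp 1) * D) ^ n / √(n.factorial)‖ = (√(Real.exp 1) * D) / √((n : ℝ) + 1) := by
        intro n
        have h1 : (0 : ℝ) < √(n.factorial) := Real.sqrt_pos.2 (by positivity)
        have h2 : (0 : ℝ) < √((n : ℝ) + 1) := Real.sqrt_pos.2 (by positivity)
        rw [Real.norm_of_nonneg (by positivity), Real.norm_of_nonneg (by positivity),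
          Nat.factorial_succ, Nat.cast_mul, Real.sqrt_mul (by positivity)]
        push_cast
        field_simp
        exact pow_succ' _ _
      simp only [this]
      refine Tendsto.div_atTop tendsto_const_nhds ?_
      exact Real.tendsto_sqrt_atTop.comp
        (tendsto_atTop_add_const_right _ _ tendsto_natCast_atTop_atTop)
  refine hs.of_nonneg_of_le (fun n => by positivity) fun n => ?_
  have h1 : (0 : ℝ) < √(n.factorial) := Real.sqrt_pos.2 (by positivity)
  rw [div_le_div_iff₀ (by positivity) h1, mul_pow, mul_pow]
  have h2 := sqrt_pow_self_le n
  have h3 : √(Real.exp n) = √(Real.exp 1) ^ n := by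
    rw [← Real.sqrt_sq (pow_nonneg (Real.sqrt_nonneg (Real.exp 1)) n), ← pow_mul, mul_comm, pow_mul,
      Real.sq_sqrt (Real.exp_pos _).le, ← Real.exp_nat_mul, mul_one]
  have h4 : (n.factorial : ℝ) = √(n.factorial) * √(n.factorial) :=
    (Real.mul_self_sqrt (Nat.cast_nonneg _)).symm
  rw [h3] at h2
  calc √n ^ n * D ^ n * √(n.factorial)
      ≤ √(Real.exp 1) ^ n * √(n.factorial) * D ^ n * √(n.factorial) := by gcongr
    _ = √(Real.exp 1) ^ n * D ^ n * n.factorial := by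
      conv_rhs => rw [h4]
      ring

/-- The bound which dominates the Fredholm series. -/
lemma summable_hadamard_bound (r : ℕ) {B V : ℝ} (hB : 0 ≤ B) (hV : 0 ≤ V) :
    Summable fun n : ℕ => (√(r + n : ℕ) * B) ^ (r + n) * V ^ n / n.factorial := by
  -- With a base of at least `1` the exponent `n` can be raised to `r + n`, the exponent of the
  -- Hadamard bound for a matrix with `r` border rows.
  set W := max V 1
  have hW : 1 ≤ W := le_max_right _ _
  have hs := (summable_nat_add_iff r).2
    (summable_sqrt_pow_div_factorial (D := B * W * 2) (by positivity))
  refine (hs.mul_left (r.factorial : ℝ)).of_nonneg_of_le (fun n => by positivity) fun n => ?_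
  rw [add_comm n r]
  have hch : ((r + n).factorial : ℝ) ≤ 2 ^ (r + n) * (r.factorial * n.factorial) := by
    have h1 := Nat.add_choose_mul_factorial_mul_factorial r n
    have h2 : (r + n).choose n ≤ 2 ^ (r + n) := Nat.choose_le_two_pow _ _
    rw [← h1, mul_assoc]
    exact_mod_cast Nat.mul_le_mul_right _ h2
  have hVW : V ^ n ≤ W ^ (r + n) :=
    (pow_le_pow_left₀ hV (le_max_left _ _) n).trans (pow_le_pow_right₀ hW (by omega))
  rw [div_le_iff₀ (by positivity), mul_div_assoc', div_mul_eq_mul_div,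
    le_div_iff₀ (by positivity)]
  calc (√(r + n : ℕ) * B) ^ (r + n) * V ^ n * (r + n).factorial
      ≤ (√(r + n : ℕ) * B) ^ (r + n) * W ^ (r + n) *
        (2 ^ (r + n) * (r.factorial * n.factorial)) := by gcongr
    _ = _ := by simp only [mul_pow]; ring

end XXZ

/-! ### Bordered Fredholm determinants and column operations -/

namespace XXZ

open MeasureTheory Set Filter

/-- Bounded measurable functions. -/
structure BddMeas {α : Type*} [MeasurableSpace α] (f : α → ℂ) : Prop where
  measurable : Measurable f
  bound : ∃ B, ∀ x, ‖f x‖ ≤ B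

namespace BddMeas

variable {α β : Type*} [MeasurableSpace α] [MeasurableSpace β] {f g : α → ℂ}

lemma const (c : ℂ) : BddMeas fun _ : α => c := ⟨measurable_const, ‖c‖, fun _ => le_rfl⟩

lemma comp (hf : BddMeas f) {φ : β → α} (hφ : Measurable φ) : BddMeas fun x => f (φ x) :=
  ⟨hf.measurable.comp hφ, hf.bound.imp fun _ h x => h (φ x)⟩

lemma add (hf : BddMeas f) (hg : BddMeas g) : BddMeas fun x => f x + g x := by
  obtain ⟨A, hA⟩ := hf.bound
  obtain ⟨B, hB⟩ := hg.bound
  exact ⟨hf.measurable.add hg.measurable, A + B, fun x =>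
    (norm_add_le _ _).trans (add_le_add (hA x) (hB x))⟩

lemma mul (hf : BddMeas f) (hg : BddMeas g) : BddMeas fun x => f x * g x := by
  obtain ⟨A, hA⟩ := hf.bound
  obtain ⟨B, hB⟩ := hg.bound
  refine ⟨hf.measurable.mul hg.measurable, A * B, fun x => ?_⟩
  rw [norm_mul]
  exact mul_le_mul (hA x) (hB x) (norm_nonneg _) ((norm_nonneg _).trans (hA x))

lemma neg (hf : BddMeas f) : BddMeas fun x => -f x := by
  simpa using (const (α := α) (-1)).mul hf

lemma sum {ι : Type*} (s : Finset ι) {F : ι → α → ℂ} (hF : ∀ i ∈ s, BddMeas (F i)) :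
    BddMeas fun x => ∑ i ∈ s, F i x := by
  classical
  induction s using Finset.induction_on with
  | empty => simpa using const (α := α) 0
  | insert i s hi ih =>
    simp only [Finset.sum_insert hi]
    exact (hF i (by simp)).add (ih fun j hj => hF j (by simp [hj]))

lemma prod {ι : Type*} (s : Finset ι) {F : ι → α → ℂ} (hF : ∀ i ∈ s, BddMeas (F i)) :
    BddMeas fun x => ∏ i ∈ s, F i x := by
  classical
  induction s using Finset.induction_on with
  | empty => simpa using const (α := α) 1
  | insert i s hi ih =>
    simp only [Finset.prod_insert hi]
    exact (hF i (by simp)).mul (ih fun j hj => hF j (by simp [hj]))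

lemma det {n : Type*} [Fintype n] [DecidableEq n] {M : α → Matrix n n ℂ}
    (hM : ∀ i j, BddMeas fun x => M x i j) : BddMeas fun x => (M x).det := by
  simp only [Matrix.det_apply']
  exact sum _ fun σ _ => (const _).mul (prod _ fun i _ => hM _ _)

lemma sumElim {f : α → ℂ} {g : β → ℂ} (hf : BddMeas f) (hg : BddMeas g) :
    BddMeas (Sum.elim f g) := by
  obtain ⟨A, hA⟩ := hf.bound
  obtain ⟨B, hB⟩ := hg.bound
  refine ⟨hf.measurable.sumElim hg.measurable, max A B, ?_⟩
  rintro (x | x)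
  exacts [(hA x).trans (le_max_left _ _), (hB x).trans (le_max_right _ _)]

lemma integrable (hf : BddMeas f) (μ : Measure α) [IsFiniteMeasure μ] : Integrable f μ := by
  obtain ⟨A, hA⟩ := hf.bound
  exact .of_bound hf.measurable.aestronglyMeasurable A (.of_forall hA)

lemma integral_right {f : α → β → ℂ} (hf : BddMeas fun p : α × β => f p.1 p.2) (μ : Measure β)
    [IsFiniteMeasure μ] : BddMeas fun x => ∫ y, f x y ∂μ := by
  obtain ⟨A, hA⟩ := hf.bound
  exact ⟨hf.measurable.stronglyMeasurable.integral_prod_right.measurable, A * μ.real univ,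
    fun x => norm_integral_le_of_norm_le_const (.of_forall fun y => hA (x, y))⟩

end BddMeas

section Bordered

set_option linter.unusedSectionVars false

variable {X ι : Type*} [MeasurableSpace X] [Fintype ι] [DecidableEq ι] [MeasurableSpace ι]

/-- The matrix of a kernel `κ` at the points `t`, bordered by the columns `Ψ`. -/
def borderedMatrix {n : ℕ} (Ψ : ι → ι ⊕ X → ℂ) (κ : ι ⊕ X → X → ℂ) (t : Fin n → X) :
    Matrix (ι ⊕ Fin n) (ι ⊕ Fin n) ℂ :=
  .of fun a => Sum.elim (fun j => Ψ j (Sum.map id t a)) fun l => κ (Sum.map id t a) (t l)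

/-- A term of the bordered Fredholm series. -/
noncomputable def borderedTerm (μ : Measure X) (Ψ : ι → ι ⊕ X → ℂ) (κ : ι ⊕ X → X → ℂ) (n : ℕ) :
    ℂ :=
  (n.factorial : ℂ)⁻¹ * ∫ t, (borderedMatrix Ψ κ t).det ∂Measure.pi fun _ : Fin n => μ

/-- The bordered Fredholm determinant. -/
noncomputable def borderedDet (μ : Measure X) (Ψ : ι → ι ⊕ X → ℂ) (κ : ι ⊕ X → X → ℂ) : ℂ :=
  ∑' n, borderedTerm μ Ψ κ n

variable {Ψ : ι → ι ⊕ X → ℂ} {κ : ι ⊕ X → X → ℂ}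

lemma measurable_sumMap_id {n : ℕ} (a : ι ⊕ Fin n) :
    Measurable fun t : Fin n → X => (Sum.map id t a : ι ⊕ X) := by
  rcases a with i | l
  · exact measurable_const
  · exact measurable_inr.comp (measurable_pi_apply l)

lemma bddMeas_borderedMatrix (hΨ : ∀ j, BddMeas (Ψ j))
    (hκ : BddMeas fun p : (ι ⊕ X) × X => κ p.1 p.2) {n : ℕ} (a b : ι ⊕ Fin n) :
    BddMeas fun t : Fin n → X => borderedMatrix Ψ κ t a b := by
  rcases b with j | l
  · exact (hΨ j).comp (measurable_sumMap_id a)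
  · exact hκ.comp ((measurable_sumMap_id a).prodMk (measurable_pi_apply l))

lemma exists_borderedMatrix_bound (hΨ : ∀ j, BddMeas (Ψ j))
    (hκ : BddMeas fun p : (ι ⊕ X) × X => κ p.1 p.2) :
    ∃ B, 0 ≤ B ∧ ∀ (n : ℕ) (t : Fin n → X) a b, ‖borderedMatrix Ψ κ t a b‖ ≤ B := by
  choose A hA using fun j => (hΨ j).bound
  obtain ⟨B, hB⟩ := hκ.bound
  refine ⟨∑ j, |A j| + |B|, by positivity, fun n t a b => ?_⟩
  rcases b with j | l
  · refine (hA j _).trans ((le_abs_self _).trans ?_)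
    have := Finset.single_le_sum (f := fun j => |A j|) (fun _ _ => abs_nonneg _)
      (Finset.mem_univ j)
    exact this.trans (le_add_of_nonneg_right (abs_nonneg _))
  · refine (hB (_, _)).trans ((le_abs_self _).trans ?_)
    exact le_add_of_nonneg_left (Finset.sum_nonneg fun _ _ => abs_nonneg _)

lemma summable_borderedTerm (μ : Measure X) [IsFiniteMeasure μ] (hΨ : ∀ j, BddMeas (Ψ j))
    (hκ : BddMeas fun p : (ι ⊕ X) × X => κ p.1 p.2) : Summable (borderedTerm μ Ψ κ) := by
  obtain ⟨B, hB0, hB⟩ := exists_borderedMatrix_bound hΨ hκ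
  refine .of_norm_bounded (summable_hadamard_bound (Fintype.card ι) hB0
    (measureReal_nonneg (μ := μ) (s := univ))) fun n => ?_
  have h1 := norm_integral_le_of_norm_le_const (μ := Measure.pi fun _ : Fin n => μ)
    (.of_forall fun t => norm_det_le_hadamard (borderedMatrix Ψ κ t) hB0 (hB n t))
  have h2 : (Measure.pi fun _ : Fin n => μ).real univ = μ.real univ ^ n := by
    simp [Measure.real, Measure.pi_univ]
  rw [h2] at h1
  simp only [Fintype.card_sum, Fintype.card_fin] at h1
  rw [borderedTerm, norm_mul, norm_inv, Complex.norm_natCast, div_eq_inv_mul]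
  gcongr

lemma borderedMatrix_update {n : ℕ} (t : Fin n → X) (j : ι) (φ : ι ⊕ X → ℂ) :
    borderedMatrix (Function.update Ψ j φ) κ t =
      (borderedMatrix Ψ κ t).updateCol (.inl j) fun a => φ (Sum.map id t a) := by
  ext a (i | l)
  · rcases eq_or_ne i j with rfl | h
    · simp [borderedMatrix]
    · simp [borderedMatrix, h]
  · simp [borderedMatrix]

/-- Laplace expansion along the replaced column. It makes linearity in that column explicit, and the
cofactors do not depend on the new column. -/
lemma det_borderedMatrix_update {n : ℕ} (t : Fin n → X) (j : ι) (φ : ι ⊕ X → ℂ) :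
    (borderedMatrix (Function.update Ψ j φ) κ t).det =
      ∑ a, (borderedMatrix Ψ κ t).adjugate (.inl j) a * φ (Sum.map id t a) := by
  rw [borderedMatrix_update, ← Matrix.cramer_apply, Matrix.cramer_eq_adjugate_mulVec]
  rfl

lemma BddMeas.update (hΨ : ∀ j, BddMeas (Ψ j)) (j : ι) {φ : ι ⊕ X → ℂ} (hφ : BddMeas φ) (i : ι) :
    BddMeas (Function.update Ψ j φ i) := by
  rcases eq_or_ne i j with rfl | h
  · simpa using hφ
  · simpa [h] using hΨ i

/-- The bijection singling out the `m`-th of `n + 1` points. -/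
noncomputable def singleOut (ι : Type*) {n : ℕ} (m : Fin (n + 1)) :
    Unit ⊕ (ι ⊕ Fin n) ≃ ι ⊕ Fin (n + 1) :=
  Equiv.ofBijective (Sum.elim (fun _ => .inr m) (Sum.map id m.succAbove)) (by
    constructor
    · rintro (_ | i | i) (_ | j | j) <;> simp [Fin.succAbove_ne, (Fin.succAbove_ne _ _).symm]
    · rintro (i | l)
      · exact ⟨.inr (.inl i), rfl⟩
      · rcases Fin.eq_self_or_eq_succAbove m l with rfl | ⟨k, rfl⟩
        · exact ⟨.inl (), rfl⟩
        · exact ⟨.inr (.inr k), rfl⟩)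

/-- The cofactor is the determinant with column `j` replaced by the unit vector at the `m`-th point.
Exchanging columns `j` and `m` costs a sign and makes the matrix block triangular once point `m` is
singled out: the unit vector splits off, and the kernel column of the point `s` is left in place
`j`. -/
lemma adjugate_borderedMatrix {n : ℕ} (j : ι) (m : Fin (n + 1)) (s : X) (t : Fin n → X) :
    (borderedMatrix Ψ κ (m.insertNth (α := fun _ => X) s t)).adjugate (.inl j) (.inr m) =
      -(borderedMatrix (Function.update Ψ j fun q => κ q s) κ t).det := by
  set A := borderedMatrix Ψ κ (m.insertNth (α := fun _ => X) s t)
  set A' := A.updateCol (.inl j) (Pi.single (.inr m) 1)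
  have h1 : A.adjugate (.inl j) (.inr m) = A'.det := by
    rw [← Matrix.cramer_apply, Matrix.cramer_eq_adjugate_mulVec, Matrix.mulVec_single_one]
    rfl
  have h2 : ((A'.submatrix id (Equiv.swap (.inl j) (.inr m))).submatrix
      (singleOut ι m) (singleOut ι m)).det = -A'.det := by
    rw [Matrix.det_submatrix_equiv_self, Matrix.det_permute', Equiv.Perm.sign_swap (by simp)]
    simp
  have h3 : ((A'.submatrix id (Equiv.swap (.inl j) (.inr m))).submatrix
      (singleOut ι m) (singleOut ι m)) = Matrix.fromBlocks 1
        (.of fun _ b => A' (.inr m) (Equiv.swap (.inl j) (.inr m) (singleOut ι m (.inr b)))) 0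
        (borderedMatrix (Function.update Ψ j fun q => κ q s) κ t) := by
    have hmap : ∀ a : ι ⊕ Fin n, Sum.map id (m.insertNth (α := fun _ => X) s t)
        (Sum.map id m.succAbove a) = (Sum.map id t a : ι ⊕ X) := by
      rintro (i | l) <;> simp
    have hinl : ∀ u, singleOut ι m (.inl u) = .inr m := fun _ => rfl
    ext (_ | a) (_ | b)
    · simp [hinl, A']
    · rfl
    · have ha : singleOut ι m (.inr a) = Sum.map id m.succAbove a := rfl
      rcases a with a | a <;> simp [hinl, ha, A']
    · have ha : singleOut ι m (.inr a) = Sum.map id m.succAbove a := rfl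
      rcases b with b | b
      · rcases eq_or_ne b j with rfl | hb
        · have : singleOut ι m (.inr (.inl b)) = .inl b := rfl
          simp [this, ha, A', A, borderedMatrix, hmap]
        · have h : singleOut ι m (.inr (.inl b)) = .inl b := rfl
          have h' : Equiv.swap (.inl j) (.inr m) (.inl b : ι ⊕ Fin (n + 1)) = .inl b :=
            Equiv.swap_apply_of_ne_of_ne (by simpa using hb) (by simp)
          simp [h, h', ha, A', A, borderedMatrix, hmap, hb]
      · have h : singleOut ι m (.inr (.inr b)) = .inr (m.succAbove b) := rfl
        have h' : Equiv.swap (.inl j) (.inr m) (.inr (m.succAbove b) : ι ⊕ Fin (n + 1)) =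
            .inr (m.succAbove b) :=
          Equiv.swap_apply_of_ne_of_ne (by simp) (by simp [Fin.succAbove_ne])
        simp [h, h', ha, A', A, borderedMatrix, hmap]
  rw [h1, ← neg_eq_iff_eq_neg, ← h2, h3, Matrix.det_fromBlocks_zero₂₁, Matrix.det_one, one_mul]

end Bordered

end XXZ

namespace XXZ

open MeasureTheory Set Filter

section Bordered

set_option linter.unusedSectionVars false

variable {X ι : Type*} [MeasurableSpace X] [Fintype ι] [DecidableEq ι] [MeasurableSpace ι]
variable {Ψ : ι → ι ⊕ X → ℂ} {κ : ι ⊕ X → X → ℂ}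

lemma integral_insertNth (μ : Measure X) [IsFiniteMeasure μ] {n : ℕ} (m : Fin (n + 1))
    (F : (Fin (n + 1) → X) → ℂ) :
    ∫ t, F t ∂Measure.pi (fun _ : Fin (n + 1) => μ) =
      ∫ p : X × (Fin n → X), F (m.insertNth (α := fun _ => X) p.1 p.2)
        ∂μ.prod (Measure.pi fun _ : Fin n => μ) :=
  (((measurePreserving_piFinSuccAbove (fun _ : Fin (n + 1) => μ) m).symm).integral_comp' F).symm

lemma bddMeas_adjugate (hΨ : ∀ j, BddMeas (Ψ j))
    (hκ : BddMeas fun p : (ι ⊕ X) × X => κ p.1 p.2) {n : ℕ} (a b : ι ⊕ Fin n) :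
    BddMeas fun t : Fin n → X => (borderedMatrix Ψ κ t).adjugate a b := by
  simp only [Matrix.adjugate_apply]
  refine BddMeas.det fun i k => ?_
  simp only [Matrix.updateRow_apply]
  split_ifs
  · exact .const _
  · exact bddMeas_borderedMatrix hΨ hκ i k

lemma bddMeas_det (hΨ : ∀ j, BddMeas (Ψ j))
    (hκ : BddMeas fun p : (ι ⊕ X) × X => κ p.1 p.2) {n : ℕ} :
    BddMeas fun t : Fin n → X => (borderedMatrix Ψ κ t).det :=
  .det (bddMeas_borderedMatrix hΨ hκ)

lemma bddMeas_det_update (hΨ : ∀ j, BddMeas (Ψ j))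
    (hκ : BddMeas fun p : (ι ⊕ X) × X => κ p.1 p.2) {n : ℕ} (j : ι) :
    BddMeas fun p : X × (Fin n → X) =>
      (borderedMatrix (Function.update Ψ j fun q => κ q p.1) κ p.2).det := by
  simp only [det_borderedMatrix_update]
  refine BddMeas.sum _ fun a _ => ((bddMeas_adjugate hΨ hκ _ _).comp measurable_snd).mul ?_
  exact hκ.comp (((measurable_sumMap_id a).comp measurable_snd).prodMk measurable_fst)

/-- Linearity in column `j` allows the integral over `s` to be taken out of the determinant. -/
lemma integral_det_update_integral (μ : Measure X) [IsFiniteMeasure μ] (hΨ : ∀ j, BddMeas (Ψ j))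
    (hκ : BddMeas fun p : (ι ⊕ X) × X => κ p.1 p.2) {h : X → ℂ} (hh : BddMeas h) (j : ι) (n : ℕ) :
    ∫ t, (borderedMatrix (Function.update Ψ j fun q => ∫ s, κ q s * h s ∂μ) κ t).det
        ∂Measure.pi (fun _ : Fin n => μ) =
      ∫ p : X × (Fin n → X), h p.1 *
        (borderedMatrix (Function.update Ψ j fun q => κ q p.1) κ p.2).det
          ∂μ.prod (Measure.pi fun _ : Fin n => μ) := by
  rw [integral_prod_symm _ (((hh.comp measurable_fst).mul
    (bddMeas_det_update hΨ hκ j)).integrable _)]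
  refine integral_congr_ae (.of_forall fun t => ?_)
  simp only [det_borderedMatrix_update, Finset.mul_sum]
  rw [integral_finsetSum _ fun a _ => ?_]
  · refine Finset.sum_congr rfl fun a _ => ?_
    rw [← integral_const_mul]
    exact integral_congr_ae (.of_forall fun s => by ring)
  · exact ((hh.mul ((BddMeas.const _).mul (hκ.comp (φ := fun s => (Sum.map id t a, s))
      (by fun_prop)))).integrable μ)

/-- In the expansion along column `j` only the rows of the `n + 1` points contribute. By symmetry
they contribute equally, each giving minus the determinant at the remaining `n` points with a kernel
column in place `j`. -/
lemma integral_det_update_elim (μ : Measure X) [IsFiniteMeasure μ] (hΨ : ∀ j, BddMeas (Ψ j))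
    (hκ : BddMeas fun p : (ι ⊕ X) × X => κ p.1 p.2) {h : X → ℂ} (hh : BddMeas h) (j : ι) (n : ℕ) :
    ∫ t, (borderedMatrix (Function.update Ψ j (Sum.elim (fun _ => 0) h)) κ t).det
        ∂Measure.pi (fun _ : Fin (n + 1) => μ) =
      -((n : ℂ) + 1) *
        ∫ t, (borderedMatrix (Function.update Ψ j fun q => ∫ s, κ q s * h s ∂μ) κ t).det
          ∂Measure.pi (fun _ : Fin n => μ) := by
  have h1 : ∀ t : Fin (n + 1) → X,
      (borderedMatrix (Function.update Ψ j (Sum.elim (fun _ => 0) h)) κ t).det =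
        ∑ m, (borderedMatrix Ψ κ t).adjugate (.inl j) (.inr m) * h (t m) := by
    intro t
    rw [det_borderedMatrix_update, Fintype.sum_sum_type]
    simp
  simp only [h1]
  rw [integral_finsetSum _ fun m _ => ((bddMeas_adjugate hΨ hκ _ _).mul
    (hh.comp (measurable_pi_apply m))).integrable _, integral_det_update_integral μ hΨ hκ hh]
  rw [Finset.sum_congr rfl (g := fun _ => -∫ p : X × (Fin n → X), h p.1 *
        (borderedMatrix (Function.update Ψ j fun q => κ q p.1) κ p.2).det
          ∂μ.prod (Measure.pi fun _ : Fin n => μ)) fun m _ => ?_]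
  · simp only [Finset.sum_const, Finset.card_univ, Fintype.card_fin, nsmul_eq_mul]
    push_cast
    ring
  · rw [integral_insertNth μ m, ← integral_neg]
    refine integral_congr_ae (.of_forall fun p => ?_)
    simp only [adjugate_borderedMatrix, Fin.insertNth_apply_same]
    ring

lemma bddMeas_column (μ : Measure X) [IsFiniteMeasure μ]
    (hκ : BddMeas fun p : (ι ⊕ X) × X => κ p.1 p.2) {h : X → ℂ} (hh : BddMeas h) :
    BddMeas fun q => ∫ s, κ q s * h s ∂μ :=
  BddMeas.integral_right (f := fun q s => κ q s * h s) (hκ.mul (hh.comp measurable_snd)) μ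

lemma borderedTerm_update_add (μ : Measure X) [IsFiniteMeasure μ] (hΨ : ∀ j, BddMeas (Ψ j))
    (hκ : BddMeas fun p : (ι ⊕ X) × X => κ p.1 p.2) (j : ι) {φ ψ : ι ⊕ X → ℂ} (hφ : BddMeas φ)
    (hψ : BddMeas ψ) (n : ℕ) :
    borderedTerm μ (Function.update Ψ j fun q => φ q + ψ q) κ n =
      borderedTerm μ (Function.update Ψ j φ) κ n + borderedTerm μ (Function.update Ψ j ψ) κ n := by
  rw [borderedTerm, borderedTerm, borderedTerm, ← mul_add,
    ← integral_add ((bddMeas_det (BddMeas.update hΨ j hφ) hκ).integrable _)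
      ((bddMeas_det (BddMeas.update hΨ j hψ) hκ).integrable _)]
  simp only [det_borderedMatrix_update, mul_add, Finset.sum_add_distrib]

/-- Adding the image `h + κ h` of a function to a column does not alter the determinant. -/
lemma borderedDet_update_add (μ : Measure X) [IsFiniteMeasure μ] (hΨ : ∀ j, BddMeas (Ψ j))
    (hκ : BddMeas fun p : (ι ⊕ X) × X => κ p.1 p.2) {h : X → ℂ} (hh : BddMeas h) (j : ι) :
    borderedDet μ (Function.update Ψ j
      fun q => Ψ j q + (Sum.elim (fun _ => 0) h q + ∫ s, κ q s * h s ∂μ)) κ = borderedDet μ Ψ κ := by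
  have hcol := bddMeas_column μ hκ hh
  have h0 : BddMeas (Sum.elim (fun _ : ι => 0) h) := BddMeas.sumElim (BddMeas.const 0) hh
  have hT := borderedTerm_update_add μ hΨ hκ j (hΨ j) (h0.add hcol)
  have hT' := borderedTerm_update_add μ hΨ hκ j h0 hcol
  have hs0 := summable_borderedTerm μ (BddMeas.update hΨ j h0) hκ
  have hsc := summable_borderedTerm μ (BddMeas.update hΨ j hcol) hκ
  have hs := summable_borderedTerm μ hΨ hκ
  rw [borderedDet, borderedDet, tsum_congr hT, Function.update_eq_self]
  rw [Summable.tsum_add hs ((summable_congr hT').2 (hs0.add hsc)), tsum_congr hT',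
    Summable.tsum_add hs0 hsc, hs0.tsum_eq_zero_add]
  have hz : borderedTerm μ (Function.update Ψ j (Sum.elim (fun _ => 0) h)) κ 0 = 0 := by
    have : ∀ t : Fin 0 → X,
        (borderedMatrix (Function.update Ψ j (Sum.elim (fun _ => 0) h)) κ t).det = 0 := by
      intro t
      rw [det_borderedMatrix_update, Fintype.sum_sum_type]
      simp
    simp [borderedTerm, this]
  -- The factor `n + 1` turns `1/(n+1)!` into `1/n!`, so the contribution of `h` at order `n + 1`
  -- cancels that of `κ h` at order `n`.
  have hsucc : ∀ n, borderedTerm μ (Function.update Ψ j (Sum.elim (fun _ => 0) h)) κ (n + 1) =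
      -borderedTerm μ (Function.update Ψ j fun q => ∫ s, κ q s * h s ∂μ) κ n := by
    intro n
    have h1 : ((n : ℂ) + 1) ≠ 0 := by exact_mod_cast n.succ_ne_zero
    rw [borderedTerm, borderedTerm, integral_det_update_elim μ hΨ hκ hh, Nat.factorial_succ]
    push_cast
    field_simp
  rw [hz, tsum_congr hsucc, tsum_neg]
  ring

lemma borderedDet_add_columns (μ : Measure X) [IsFiniteMeasure μ] (hΨ : ∀ j, BddMeas (Ψ j))
    (hκ : BddMeas fun p : (ι ⊕ X) × X => κ p.1 p.2) {h : ι → X → ℂ} (hh : ∀ j, BddMeas (h j)) :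
    borderedDet μ (fun j q => Ψ j q + (Sum.elim (fun _ => 0) (h j) q + ∫ s, κ q s * h j s ∂μ)) κ =
      borderedDet μ Ψ κ := by
  set Ψ' : ι → ι ⊕ X → ℂ := fun j q => Ψ j q + (Sum.elim (fun _ => 0) (h j) q + ∫ s, κ q s * h j s ∂μ)
  have hΨ' : ∀ j, BddMeas (Ψ' j) := fun j =>
    (hΨ j).add ((BddMeas.sumElim (BddMeas.const 0) (hh j)).add (bddMeas_column μ hκ (hh j)))
  -- The columns are altered one at a time. The kernel part is not touched, so the added term for
  -- column `i` is the same whichever other columns have already been altered.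
  suffices H : ∀ J : Finset ι,
      borderedDet μ (fun j => if j ∈ J then Ψ' j else Ψ j) κ = borderedDet μ Ψ κ by
    simpa using H Finset.univ
  intro J
  induction J using Finset.induction_on with
  | empty => simp
  | insert i J hi ih =>
    rw [← ih, ← borderedDet_update_add μ (Ψ := fun j => if j ∈ J then Ψ' j else Ψ j) (κ := κ)
      (fun j => by split_ifs <;> simp [hΨ, hΨ']) hκ (hh i) i]
    congr 1
    ext j q
    rcases eq_or_ne j i with rfl | hj
    · simp [hi, Ψ']
    · simp [hj]

/-- With zeros below the corner every matrix of the series is block triangular, and the corner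
factors out of the whole series. -/
lemma borderedDet_of_zero (μ : Measure X) (h0 : ∀ j s, Ψ j (.inr s) = 0) :
    borderedDet μ Ψ κ = (Matrix.of fun i j => Ψ j (.inl i)).det *
      ∑' n : ℕ, (n.factorial : ℂ)⁻¹ *
        ∫ t, (Matrix.of fun a b => κ (.inr (t a)) (t b)).det ∂Measure.pi fun _ : Fin n => μ := by
  rw [borderedDet, ← tsum_mul_left]
  refine tsum_congr fun n => ?_
  have : ∀ t : Fin n → X, (borderedMatrix Ψ κ t).det = (Matrix.of fun i j => Ψ j (.inl i)).det *
      (Matrix.of fun a b => κ (.inr (t a)) (t b)).det := by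
    intro t
    have h1 : borderedMatrix Ψ κ t = Matrix.fromBlocks (.of fun i j => Ψ j (.inl i))
        (.of fun i l => κ (.inl i) (t l)) 0 (.of fun a b => κ (.inr (t a)) (t b)) := by
      ext (a | a) (b | b) <;> simp [borderedMatrix, h0]
    rw [h1, Matrix.det_fromBlocks_zero₂₁]
  simp only [borderedTerm, this, integral_const_mul]
  ring

end Bordered

end XXZ

/-! ### Point masses as borders of a Fredholm determinant -/

namespace XXZ

open MeasureTheory Set Filter

section PointMasses

set_option linter.unusedSectionVars false

variable {X : Type*} [MeasurableSpace X]

lemma measurable_insertNth {n : ℕ} (m : Fin (n + 1)) :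
    Measurable fun p : X × (Fin n → X) => m.insertNth (α := fun _ => X) p.1 p.2 :=
  (MeasurableEquiv.piFinSuccAbove (fun _ => X) m).symm.measurable

lemma measurable_cons {n : ℕ} :
    Measurable fun p : X × (Fin n → X) => (Fin.cons p.1 p.2 : Fin (n + 1) → X) := by
  simpa only [Fin.insertNth_zero'] using measurable_insertNth (X := X) (n := n) 0

lemma pi_fin_zero (ν : Measure X) :
    Measure.pi (fun _ : Fin 0 => ν) = Measure.dirac (Fin.elim0 : Fin 0 → X) := by
  rw [Measure.pi_of_empty (fun _ : Fin 0 => ν) Fin.elim0]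

lemma integral_cons (μ : Measure X) [IsFiniteMeasure μ] {n : ℕ} {F : (Fin (n + 1) → X) → ℂ}
    (hF : BddMeas F) :
    ∫ t, F t ∂Measure.pi (fun _ : Fin (n + 1) => μ) =
      ∫ s, ∫ t, F (Fin.cons s t) ∂Measure.pi (fun _ : Fin n => μ) ∂μ := by
  rw [integral_insertNth μ 0, integral_prod _ ((hF.comp (measurable_insertNth 0)).integrable _)]
  simp only [Fin.insertNth_zero']

lemma BddMeas.cons_right {n : ℕ} {F : (Fin (n + 1) → X) → ℂ} (hF : BddMeas F) (s : X) :
    BddMeas fun t => F (Fin.cons s t) :=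
  (hF.comp measurable_cons).comp measurable_prodMk_left

/-- Integration of a function with respect to a product measure after adding a point mass, if
the function vanishes whenever two of its arguments are at the point. -/
lemma integral_pi_add_dirac (μ : Measure X) [IsFiniteMeasure μ] (x : X) (n : ℕ) :
    ∀ {Φ : (Fin (n + 1) → X) → ℂ}, BddMeas Φ →
      (∀ t i j, i ≠ j → t i = x → t j = x → Φ t = 0) →
      ∫ t, Φ t ∂Measure.pi (fun _ : Fin (n + 1) => μ + Measure.dirac x) =
        ∫ t, Φ t ∂Measure.pi (fun _ : Fin (n + 1) => μ) +
          ∑ m : Fin (n + 1), ∫ t, Φ (m.insertNth (α := fun _ => X) x t)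
            ∂Measure.pi (fun _ : Fin n => μ) := by
  have step : ∀ {n : ℕ} {Φ : (Fin (n + 1) → X) → ℂ}, BddMeas Φ →
      ∫ t, Φ t ∂Measure.pi (fun _ : Fin (n + 1) => μ + Measure.dirac x) =
        ∫ s, ∫ t, Φ (Fin.cons s t) ∂Measure.pi (fun _ : Fin n => μ + Measure.dirac x) ∂μ +
          ∫ t, Φ (Fin.cons x t) ∂Measure.pi (fun _ : Fin n => μ + Measure.dirac x) := by
    intro n Φ hΦ
    have hI : BddMeas fun s =>
        ∫ t, Φ (Fin.cons s t) ∂Measure.pi (fun _ : Fin n => μ + Measure.dirac x) :=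
      BddMeas.integral_right (f := fun s t => Φ (Fin.cons s t)) (hΦ.comp measurable_cons) _
    rw [integral_cons _ hΦ, integral_add_measure (hI.integrable _) (hI.integrable _),
      integral_dirac' _ _ hI.measurable.stronglyMeasurable]
  induction n with
  | zero =>
    intro Φ hΦ _
    rw [step hΦ, integral_cons μ hΦ, Fin.sum_univ_succ]
    simp [pi_fin_zero, Fin.insertNth_zero']
  | succ n ih =>
    intro Φ hΦ h0
    have hsucc : ∀ s (t : Fin (n + 1) → X) i j, i ≠ j → t i = x → t j = x →
        Φ (Fin.cons s t) = 0 := fun s t i j hij hi hj =>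
      h0 _ i.succ j.succ (by simpa using hij) (by simpa using hi) (by simpa using hj)
    have hins : ∀ m : Fin (n + 1), BddMeas fun p : X × (Fin n → X) =>
        Φ (Fin.cons p.1 (m.insertNth (α := fun _ => X) x p.2)) := fun m => by
      refine (hΦ.comp measurable_cons).comp (measurable_fst.prodMk ?_)
      exact ((measurable_insertNth m).comp measurable_prodMk_left).comp measurable_snd
    rw [step hΦ, ih (hΦ.cons_right x) (hsucc x)]
    -- When the first argument already sits at `x`, a second one at `x` gives zero; only terms with
    -- at most one argument at `x` survive.
    have h1 : ∀ m : Fin (n + 1), ∀ t : Fin n → X,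
        Φ (Fin.cons x (m.insertNth (α := fun _ => X) x t)) = 0 := fun m t =>
      h0 _ 0 m.succ (Fin.succ_ne_zero m).symm (by simp) (by simp)
    simp only [h1, integral_zero, Finset.sum_const_zero, add_zero]
    rw [integral_congr_ae (.of_forall fun s => ih (hΦ.cons_right s) (hsucc s)),
      integral_add, integral_finsetSum, ← integral_cons μ hΦ, add_assoc, Fin.sum_univ_succ (n := n + 1)]
    · congr 1
      rw [add_comm]
      congr 1
      · simp only [Fin.insertNth_zero']
      · refine Finset.sum_congr rfl fun m _ => ?_
        rw [integral_cons μ ((hΦ.comp (measurable_insertNth m.succ)).comp measurable_prodMk_left)]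
        simp only [Fin.insertNth_succ_cons]
    · exact fun m _ => (BddMeas.integral_right (hins m) _).integrable _
    · exact (BddMeas.integral_right (f := fun s t => Φ (Fin.cons s t))
        (hΦ.comp measurable_cons) _).integrable _
    · exact (BddMeas.sum _ fun m _ => BddMeas.integral_right (hins m) _).integrable _

variable {ι : Type*} [Fintype ι] [DecidableEq ι]

/-- The columns of `1 + k` at the points `p`. -/
def pointColumns (k : X → X → ℂ) (p : ι → X) (j : ι) (q : ι ⊕ X) : ℂ :=
  Sum.elim (Pi.single j 1) (fun _ => 0) q + k (Sum.elim p id q) (p j)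

/-- The kernel `k` with the points `p` as additional rows. -/
def pointKernel (k : X → X → ℂ) (p : ι → X) (q : ι ⊕ X) (t : X) : ℂ := k (Sum.elim p id q) t

variable {k : X → X → ℂ}

lemma bddMeas_pointColumns [MeasurableSpace ι] [DiscreteMeasurableSpace ι]
    (hk : BddMeas fun q : X × X => k q.1 q.2) (p : ι → X) (j : ι) :
    BddMeas (pointColumns k p j) := by
  refine BddMeas.add (BddMeas.sumElim ⟨.of_discrete, 1, fun i => ?_⟩ (.const 0)) ?_
  · by_cases h : i = j
    · subst h; simp
    · simp [h]
  · exact hk.comp ((Measurable.sumElim .of_discrete measurable_id).prodMk measurable_const)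

lemma bddMeas_pointKernel [MeasurableSpace ι] [DiscreteMeasurableSpace ι]
    (hk : BddMeas fun q : X × X => k q.1 q.2) (p : ι → X) :
    BddMeas fun q : (ι ⊕ X) × X => pointKernel k p q.1 q.2 :=
  hk.comp (((Measurable.sumElim .of_discrete measurable_id).comp measurable_fst).prodMk
    measurable_snd)

/-- The bordered matrix of the kernel `1 + k` at the points `p` and `k` at the points `t`. -/
abbrev pointMatrix {n : ℕ} (k : X → X → ℂ) (p : ι → X) (t : Fin n → X) :
    Matrix (ι ⊕ Fin n) (ι ⊕ Fin n) ℂ :=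
  borderedMatrix (pointColumns k p) (pointKernel k p) t

lemma det_pointMatrix_eq_zero {n : ℕ} (p : ι → X) (t : Fin n → X) {i j : Fin n} (hij : i ≠ j)
    (ht : t i = t j) : (pointMatrix k p t).det = 0 := by
  refine Matrix.det_zero_of_row_eq (i := .inr i) (j := .inr j) (by simpa using hij) ?_
  ext (a | a) <;> simp [pointMatrix, borderedMatrix, pointColumns, pointKernel, ht]

/-- Moving a point permutes rows and columns simultaneously, which leaves the determinant unchanged.
So all positions of the point mass contribute the same amount. -/
lemma det_pointMatrix_insertNth {n : ℕ} (p : ι → X) (x : X) (t : Fin n → X) (m : Fin (n + 1)) :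
    (pointMatrix k p (m.insertNth (α := fun _ => X) x t)).det =
      (pointMatrix k p (Fin.cons x t)).det := by
  rw [← Matrix.det_submatrix_equiv_self (singleOut ι m),
    ← Matrix.det_submatrix_equiv_self (singleOut ι 0) (pointMatrix k p (Fin.cons x t))]
  congr 1
  have h : ∀ u, singleOut ι m (.inl u) = .inr m := fun _ => rfl
  have h' : ∀ (m : Fin (n + 1)) a, singleOut ι m (.inr a) = Sum.map id m.succAbove a :=
    fun _ _ => rfl
  have h0 : ∀ u, singleOut ι (0 : Fin (n + 1)) (.inl u) = .inr 0 := fun _ => rfl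
  ext (a | a | a) (b | b | b) <;>
    simp [h, h', h0, pointMatrix, borderedMatrix, pointColumns, pointKernel]

/-- The bijection singling out the first of `r + 1` points. -/
def singleOutLeft (r n : ℕ) : Unit ⊕ (Fin r ⊕ Fin n) ≃ Fin (r + 1) ⊕ Fin n where
  toFun := Sum.elim (fun _ => .inl 0) (Sum.map Fin.succ id)
  invFun := Sum.elim (Fin.cases (.inl ()) fun i => .inr (.inl i)) fun l => .inr (.inr l)
  left_inv := by rintro (_ | i | l) <;> rfl
  right_inv := by
    rintro (i | l)
    · cases i using Fin.cases <;> rfl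
    · rfl

/-- The border column of `x` is a unit vector plus a kernel column. By linearity the determinant
splits: the unit vector deletes the row and column of `x`, and the kernel column makes `x` an
ordinary point of the kernel. -/
lemma det_pointMatrix_cons {r n : ℕ} (p : Fin r → X) (x : X) (t : Fin n → X) :
    (pointMatrix k (Fin.cons x p : Fin (r + 1) → X) t).det =
      (pointMatrix k p t).det + (pointMatrix k p (Fin.cons x t : Fin (n + 1) → X)).det := by
  set P : Fin (r + 1) → X := Fin.cons x p
  have hl : ∀ u, singleOutLeft r n (.inl u) = .inl 0 := fun _ => rfl
  have hr : ∀ a, singleOutLeft r n (.inr a) = Sum.map Fin.succ id a := fun _ => rfl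
  have hm : ∀ a : Fin r ⊕ Fin n, (Sum.elim P id (Sum.map id t (Sum.map Fin.succ id a)) : X) =
      Sum.elim p id (Sum.map id t a) := by rintro (a | a) <;> simp [P]
  have h1 : (borderedMatrix (Function.update (pointColumns k P) 0
      (Sum.elim (Pi.single 0 1) fun _ => 0)) (pointKernel k P) t).det =
      (pointMatrix k p t).det := by
    rw [← Matrix.det_submatrix_equiv_self (singleOutLeft r n)]
    have : (borderedMatrix (Function.update (pointColumns k P) 0
        (Sum.elim (Pi.single 0 1) fun _ => 0)) (pointKernel k P) t).submatrix
        (singleOutLeft r n) (singleOutLeft r n) = Matrix.fromBlocks 1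
          (.of fun _ b => borderedMatrix (Function.update (pointColumns k P) 0
            (Sum.elim (Pi.single 0 1) fun _ => 0)) (pointKernel k P) t (.inl 0)
              (singleOutLeft r n (.inr b))) 0 (pointMatrix k p t) := by
      ext (a | a) (b | b)
      · simp [hl, borderedMatrix]
      · rfl
      · rcases a with a | a <;> simp [hl, hr, borderedMatrix]
      · rcases b with b | b
        · simp only [Matrix.submatrix_apply, hr, Matrix.fromBlocks_apply₂₂]
          simp only [borderedMatrix, Matrix.of_apply, Sum.map_inl, Sum.elim_inl, ne_eq,
            Fin.succ_ne_zero, not_false_eq_true, Function.update_of_ne, pointColumns, hm]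
          rcases a with a | a <;> simp [P, Pi.single_apply]
        · simp only [Matrix.submatrix_apply, hr, Matrix.fromBlocks_apply₂₂]
          simp only [borderedMatrix, Matrix.of_apply, Sum.map_inr, Sum.elim_inr, id, pointKernel,
            hm]
    rw [this, Matrix.det_fromBlocks_zero₂₁, Matrix.det_one, one_mul]
  have h2 : (borderedMatrix (Function.update (pointColumns k P) 0
      fun q => k (Sum.elim P id q) x) (pointKernel k P) t).det =
      (pointMatrix k p (Fin.cons x t : Fin (n + 1) → X)).det := by
    rw [← Matrix.det_submatrix_equiv_self (singleOutLeft r n),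
      ← Matrix.det_submatrix_equiv_self (singleOut (Fin r) 0)
        (pointMatrix k p (Fin.cons x t : Fin (n + 1) → X))]
    congr 1
    have h' : ∀ a, singleOut (Fin r) (0 : Fin (n + 1)) (.inr a) = Sum.map id Fin.succ a := by
      rintro (a | a) <;> rfl
    have h0 : ∀ u, singleOut (Fin r) (0 : Fin (n + 1)) (.inl u) = .inr 0 := fun _ => rfl
    ext (a | a | a) (b | b | b) <;>
      simp [hl, hr, h', h0, borderedMatrix, pointColumns, pointKernel, P, Pi.single_apply]
  rw [← h1, ← h2, det_borderedMatrix_update, det_borderedMatrix_update, ← Finset.sum_add_distrib,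
    pointMatrix, ← Function.update_eq_self (0 : Fin (r + 1)) (pointColumns k P),
    det_borderedMatrix_update]
  simp only [Function.update_eq_self]
  exact Finset.sum_congr rfl fun a _ => by simp [pointColumns, P, mul_add]

/-- Let `w n` be the `n`-th term with one extra kernel point fixed at `x`. The point mass adds `w n`
to the term of order `n + 1`, whereas the enlarged border adds it to the term of order `n`; the two
sums agree. -/
lemma borderedDet_add_dirac (μ : Measure X) [IsFiniteMeasure μ]
    (hk : BddMeas fun q : X × X => k q.1 q.2) {r : ℕ} (p : Fin r → X) (x : X) :
    borderedDet (μ + Measure.dirac x) (pointColumns k p) (pointKernel k p) =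
      borderedDet μ (pointColumns k (Fin.cons x p : Fin (r + 1) → X))
        (pointKernel k (Fin.cons x p : Fin (r + 1) → X)) := by
  have hb : ∀ n, BddMeas fun t : Fin n → X => (pointMatrix k p t).det := fun n =>
    bddMeas_det (bddMeas_pointColumns hk p) (bddMeas_pointKernel hk p)
  have hs := summable_borderedTerm (μ + Measure.dirac x) (bddMeas_pointColumns hk p)
    (bddMeas_pointKernel hk p)
  have hs' := summable_borderedTerm μ (bddMeas_pointColumns hk p) (bddMeas_pointKernel hk p)
  set w : ℕ → ℂ := fun n => (n.factorial : ℂ)⁻¹ *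
    ∫ t, (pointMatrix k p (Fin.cons x t)).det ∂Measure.pi fun _ : Fin n => μ
  have hterm : ∀ n, borderedTerm μ (pointColumns k (Fin.cons x p : Fin (r + 1) → X))
      (pointKernel k (Fin.cons x p : Fin (r + 1) → X)) n =
      borderedTerm μ (pointColumns k p) (pointKernel k p) n + w n := by
    intro n
    simp only [borderedTerm, w, ← mul_add]
    rw [← integral_add ((hb n).integrable _) (((hb (n + 1)).cons_right x).integrable _)]
    simp only [← det_pointMatrix_cons]
  have hsucc : ∀ n, borderedTerm (μ + Measure.dirac x) (pointColumns k p) (pointKernel k p)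
      (n + 1) = borderedTerm μ (pointColumns k p) (pointKernel k p) (n + 1) + w n := by
    intro n
    have h1 : ((n : ℂ) + 1) ≠ 0 := by exact_mod_cast n.succ_ne_zero
    rw [borderedTerm, borderedTerm, integral_pi_add_dirac μ x n (hb (n + 1))
      fun t i j hij hi hj => det_pointMatrix_eq_zero p t hij (hi.trans hj.symm)]
    simp only [det_pointMatrix_insertNth, Finset.sum_const, Finset.card_univ, Fintype.card_fin,
      nsmul_eq_mul, w, Nat.factorial_succ]
    push_cast
    field_simp
  have hzero : borderedTerm (μ + Measure.dirac x) (pointColumns k p) (pointKernel k p) 0 =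
      borderedTerm μ (pointColumns k p) (pointKernel k p) 0 := by
    simp only [borderedTerm, pi_fin_zero]
  have hw : Summable w := by
    have := (summable_borderedTerm μ (bddMeas_pointColumns hk (Fin.cons x p : Fin (r + 1) → X))
      (bddMeas_pointKernel hk (Fin.cons x p : Fin (r + 1) → X))).sub hs'
    simpa only [hterm, add_sub_cancel_left] using this
  rw [borderedDet, borderedDet, hs.tsum_eq_zero_add, hzero, tsum_congr hsucc, tsum_congr hterm,
    ((summable_nat_add_iff 1).2 hs').tsum_add hw, hs'.tsum_add hw, hs'.tsum_eq_zero_add, add_assoc]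

/-- Point masses in the measure amount to a border of the Fredholm determinant. -/
theorem borderedDet_add_sum_dirac (hk : BddMeas fun q : X × X => k q.1 q.2) (r : ℕ) :
    ∀ (μ : Measure X) [IsFiniteMeasure μ] (p : Fin r → X),
      borderedDet (μ + ∑ i, Measure.dirac (p i)) (pointColumns k (Fin.elim0 : Fin 0 → X))
        (pointKernel k (Fin.elim0 : Fin 0 → X)) =
      borderedDet μ (pointColumns k p) (pointKernel k p) := by
  induction r with
  | zero =>
    intro μ _ p
    rw [Subsingleton.elim p Fin.elim0]
    simp
  | succ r ih =>
    intro μ _ p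
    rw [Fin.sum_univ_succ, ← add_assoc, ih (μ + Measure.dirac (p 0)) fun i => p i.succ,
      borderedDet_add_dirac μ hk]
    have : (Fin.cons (p 0) fun i => p i.succ : Fin (r + 1) → X) = p := Fin.cons_self_tail p
    rw [this]

end PointMasses

end XXZ

/-! ### Exchange of measures, and the quotient of two Fredholm determinants -/

namespace XXZ

open MeasureTheory Set Filter

section Transfer

set_option linter.unusedSectionVars false

variable {X Y : Type*} [MeasurableSpace X] [MeasurableSpace Y]

lemma bddMeas_comp_mul_prod {S : Set ℂ} {c : X → ℂ} (hc : Measurable c) (hcS : ∀ x, c x ∈ S)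
    {ρ : X → ℂ} (hρ : BddMeas ρ) {n : ℕ} {Φ : (Fin n → ℂ) → ℂ} (hΦ : Measurable Φ)
    (hb : ∃ B, ∀ z : Fin n → ℂ, (∀ i, z i ∈ S) → ‖Φ z‖ ≤ B) :
    BddMeas fun t : Fin n → X => Φ (fun i => c (t i)) * ∏ i, ρ (t i) := by
  refine BddMeas.mul ⟨hΦ.comp ?_, ?_⟩ (.prod _ fun i _ => hρ.comp (measurable_pi_apply i))
  · exact measurable_pi_lambda _ fun i => hc.comp (measurable_pi_apply i)
  · exact hb.imp fun B hB t => hB _ fun i => hcS _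

lemma comp_cons {Z : Type*} (g : Z → ℂ) {n : ℕ} (s : Z) (t : Fin n → Z) :
    (fun i => g ((Fin.cons s t : Fin (n + 1) → Z) i)) =
      (Fin.cons (g s) fun i => g (t i) : Fin (n + 1) → ℂ) := by
  ext i
  cases i using Fin.cases <;> simp

lemma cons_mem {S : Set ℂ} {n : ℕ} {z₀ : ℂ} {z : Fin n → ℂ} (h0 : z₀ ∈ S) (hz : ∀ i, z i ∈ S)
    (i : Fin (n + 1)) : (Fin.cons z₀ z : Fin (n + 1) → ℂ) i ∈ S := by
  cases i using Fin.cases with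
  | zero => simpa using h0
  | succ i => simpa using hz i

lemma bddMeas_cons_mul {S : Set ℂ} {n : ℕ} {Φ : (Fin (n + 1) → ℂ) → ℂ} (hΦ : Measurable Φ)
    {B : ℝ} (hB : ∀ z : Fin (n + 1) → ℂ, (∀ i, z i ∈ S) → ‖Φ z‖ ≤ B) {c ρ : X → ℂ} {d τ : Y → ℂ}
    (hc : Measurable c) (hcS : ∀ x, c x ∈ S) (hρ : BddMeas ρ) (hd : Measurable d)
    (hdS : ∀ y, d y ∈ S) (hτ : BddMeas τ) :
    BddMeas fun p : X × (Fin n → Y) =>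
      (Φ (Fin.cons (c p.1) fun i => d (p.2 i)) * ρ p.1) * ∏ i, τ (p.2 i) := by
  refine BddMeas.mul (BddMeas.mul ⟨?_, B, fun p => hB _ (cons_mem (hcS _) fun i => hdS _)⟩
    (hρ.comp measurable_fst)) (.prod _ fun i _ => hτ.comp (by fun_prop))
  refine (hΦ.comp measurable_cons).comp (Measurable.prodMk (hc.comp measurable_fst) ?_)
  exact measurable_pi_lambda _ fun i => hd.comp (by fun_prop)

/-- If two weighted measures agree on a function in each of its variables, then so do their
product measures. -/
lemma integral_pi_transfer (μ : Measure X) [IsFiniteMeasure μ] (ν : Measure Y) [IsFiniteMeasure ν]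
    {S : Set ℂ} (hS : S.Nonempty) {c ρ : X → ℂ} {d τ : Y → ℂ} (hc : Measurable c)
    (hd : Measurable d) (hcS : ∀ x, c x ∈ S) (hdS : ∀ y, d y ∈ S) (hρ : BddMeas ρ)
    (hτ : BddMeas τ) (n : ℕ) :
    ∀ {Φ : (Fin n → ℂ) → ℂ}, Measurable Φ →
      (∃ B, ∀ z : Fin n → ℂ, (∀ i, z i ∈ S) → ‖Φ z‖ ≤ B) →
      (∀ i (z : Fin n → ℂ), (∀ i, z i ∈ S) →
        ∫ x, Φ (Function.update z i (c x)) * ρ x ∂μ =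
          ∫ y, Φ (Function.update z i (d y)) * τ y ∂ν) →
      ∫ t, Φ (fun i => c (t i)) * ∏ i, ρ (t i) ∂Measure.pi (fun _ : Fin n => μ) =
        ∫ t, Φ (fun i => d (t i)) * ∏ i, τ (t i) ∂Measure.pi (fun _ : Fin n => ν) := by
  induction n with
  | zero =>
    intro Φ _ _ _
    rw [pi_fin_zero, pi_fin_zero, integral_dirac, integral_dirac]
    simp only [Finset.univ_eq_empty, Finset.prod_empty, mul_one]
    congr 1
    exact Subsingleton.elim _ _
  | succ n ih =>
    intro Φ hΦ hb h
    obtain ⟨B, hB⟩ := hb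
    have hΦc : ∀ z₀ : ℂ, Measurable fun z : Fin n → ℂ => Φ (Fin.cons z₀ z) := fun z₀ =>
      (hΦ.comp measurable_cons).comp measurable_prodMk_left
    -- The last `n` variables are exchanged by induction with the first one frozen on the old curve;
    -- after Fubini the first one is exchanged with the others already on the new curve.
    have e1 : ∀ x, ∫ t, Φ (Fin.cons (c x) fun i => c (t i)) * ∏ i, ρ (t i)
          ∂Measure.pi (fun _ : Fin n => μ) =
        ∫ t, Φ (Fin.cons (c x) fun i => d (t i)) * ∏ i, τ (t i)
          ∂Measure.pi (fun _ : Fin n => ν) := fun x => by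
      refine ih (Φ := fun z => Φ (Fin.cons (c x) z)) (hΦc _)
        ⟨B, fun z hz => hB _ (cons_mem (hcS x) hz)⟩ fun i z hz => ?_
      have := h i.succ (Fin.cons (c x) z) (cons_mem (hcS x) hz)
      simpa only [← Fin.cons_update] using this
    -- An arbitrary filler for the first coordinate, which is overwritten by the update.
    obtain ⟨z₀, hz₀⟩ := hS
    have e2 : ∀ t : Fin n → Y, ∫ x, Φ (Fin.cons (c x) fun i => d (t i)) * ρ x ∂μ =
        ∫ y, Φ (Fin.cons (d y) fun i => d (t i)) * τ y ∂ν := fun t => by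
      have := h 0 (Fin.cons z₀ fun i => d (t i)) (cons_mem hz₀ fun i => hdS _)
      simpa only [Fin.update_cons_zero] using this
    have hint := bddMeas_cons_mul hΦ hB hc hcS hρ hd hdS hτ
    have hintY := bddMeas_cons_mul hΦ hB hd hdS hτ hd hdS hτ
    rw [integral_cons μ (bddMeas_comp_mul_prod hc hcS hρ hΦ ⟨B, hB⟩),
      integral_cons ν (bddMeas_comp_mul_prod hd hdS hτ hΦ ⟨B, hB⟩)]
    simp only [Fin.prod_univ_succ, Fin.cons_zero, Fin.cons_succ, comp_cons]
    calc ∫ s, ∫ t, Φ (Fin.cons (c s) fun i => c (t i)) * (ρ s * ∏ i, ρ (t i))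
            ∂Measure.pi (fun _ : Fin n => μ) ∂μ
        = ∫ s, ∫ t, (Φ (Fin.cons (c s) fun i => d (t i)) * ρ s) * ∏ i, τ (t i)
            ∂Measure.pi (fun _ : Fin n => ν) ∂μ := by
          refine integral_congr_ae (.of_forall fun s => ?_)
          have := congrArg (ρ s * ·) (e1 s)
          simp only [← integral_const_mul] at this
          refine Eq.trans ?_ (this.trans ?_) <;>
            exact integral_congr_ae (.of_forall fun t => by ring)
      _ = ∫ t, ∫ s, (Φ (Fin.cons (c s) fun i => d (t i)) * ρ s) * ∏ i, τ (t i) ∂μ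
            ∂Measure.pi (fun _ : Fin n => ν) :=
          integral_integral_swap (hint.integrable _)
      _ = ∫ t, ∫ s, (Φ (Fin.cons (d s) fun i => d (t i)) * τ s) * ∏ i, τ (t i) ∂ν
            ∂Measure.pi (fun _ : Fin n => ν) := by
          refine integral_congr_ae (.of_forall fun t => ?_)
          simp only [integral_mul_const, e2]
      _ = ∫ s, ∫ t, (Φ (Fin.cons (d s) fun i => d (t i)) * τ s) * ∏ i, τ (t i)
            ∂Measure.pi (fun _ : Fin n => ν) ∂ν :=
          (integral_integral_swap (hintY.integrable _)).symm
      _ = _ := by simp only [mul_assoc]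

/-- The terms of the Fredholm series of `1 - K` for a weighted measure. -/
noncomputable def seriesTerm (μ : Measure X) (c ρ : X → ℂ) (K : ℂ → ℂ → ℂ) (n : ℕ) : ℂ :=
  (n.factorial : ℂ)⁻¹ * ∫ t, (Matrix.of fun i j => -K (c (t i)) (c (t j))).det * ∏ i, ρ (t i)
    ∂Measure.pi fun _ : Fin n => μ

lemma measurable_kernel_det {K : ℂ → ℂ → ℂ} (hK : Measurable fun p : ℂ × ℂ => K p.1 p.2) (n : ℕ) :
    Measurable fun z : Fin n → ℂ => (Matrix.of fun i j => -K (z i) (z j)).det := by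
  simp only [Matrix.det_apply', Matrix.of_apply]
  refine Finset.measurable_fun_sum _ fun σ _ => Measurable.const_mul ?_ _
  refine Finset.measurable_fun_prod _ fun i _ => Measurable.neg ?_
  exact hK.comp (f := fun z : Fin n → ℂ => (z (σ i), z i))
    ((measurable_pi_apply _).prodMk (measurable_pi_apply _))

lemma exists_kernel_det_bound {K : ℂ → ℂ → ℂ} {S : Set ℂ} {B : ℝ}
    (hB : ∀ z ∈ S, ∀ w ∈ S, ‖K z w‖ ≤ B) (n : ℕ) : ∃ D, ∀ z : Fin n → ℂ, (∀ i, z i ∈ S) →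
      ‖(Matrix.of fun i j => -K (z i) (z j)).det‖ ≤ D := by
  refine ⟨(√(Fintype.card (Fin n)) * max B 0) ^ Fintype.card (Fin n), fun z hz =>
    norm_det_le_hadamard _ (le_max_right _ _) fun i j => ?_⟩
  simpa using Or.inl (hB _ (hz i) _ (hz j))

lemma bddMeas_kernel {K : ℂ → ℂ → ℂ} (hK : Measurable fun p : ℂ × ℂ => K p.1 p.2)
    {S : Set ℂ} {B : ℝ} (hB : ∀ z ∈ S, ∀ w ∈ S, ‖K z w‖ ≤ B) {c ρ : X → ℂ} (hc : Measurable c)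
    (hcS : ∀ x, c x ∈ S) (hρ : BddMeas ρ) :
    BddMeas fun p : X × X => -K (c p.1) (c p.2) * ρ p.2 := by
  refine BddMeas.mul (BddMeas.neg ⟨?_, B, fun p => hB _ (hcS _) _ (hcS _)⟩)
    (hρ.comp measurable_snd)
  exact hK.comp ((hc.comp measurable_fst).prodMk (hc.comp measurable_snd))

lemma det_kernel_mul_prod (K : ℂ → ℂ → ℂ) (c ρ : X → ℂ) {n : ℕ} (t : Fin n → X) :
    (Matrix.of fun i j => -K (c (t i)) (c (t j)) * ρ (t j)).det =
      (Matrix.of fun i j => -K (c (t i)) (c (t j))).det * ∏ i, ρ (t i) := by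
  rw [mul_comm, ← Matrix.det_mul_row]
  simp only [Matrix.of_apply, mul_comm]

lemma seriesTerm_eq_borderedTerm (μ : Measure X) (c ρ : X → ℂ) (K : ℂ → ℂ → ℂ) (n : ℕ) :
    seriesTerm μ c ρ K n =
      borderedTerm μ (pointColumns (fun s t => -K (c s) (c t) * ρ t) (Fin.elim0 : Fin 0 → X))
        (pointKernel (fun s t => -K (c s) (c t) * ρ t) (Fin.elim0 : Fin 0 → X)) n := by
  rw [seriesTerm, borderedTerm]
  congr 1
  refine integral_congr_ae (.of_forall fun t => ?_)
  simp only
  rw [← det_kernel_mul_prod, ← Matrix.det_submatrix_equiv_self (Equiv.emptySum (Fin 0) (Fin n)).symm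
    (borderedMatrix _ _ t)]
  rfl

lemma summable_seriesTerm (μ : Measure X) [IsFiniteMeasure μ] {K : ℂ → ℂ → ℂ}
    (hK : Measurable fun p : ℂ × ℂ => K p.1 p.2) {S : Set ℂ} {B : ℝ}
    (hB : ∀ z ∈ S, ∀ w ∈ S, ‖K z w‖ ≤ B) {c ρ : X → ℂ} (hc : Measurable c)
    (hcS : ∀ x, c x ∈ S) (hρ : BddMeas ρ) : Summable (seriesTerm μ c ρ K) := by
  rw [funext (seriesTerm_eq_borderedTerm μ c ρ K)]
  have hk := bddMeas_kernel hK hB hc hcS hρ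
  exact summable_borderedTerm μ (bddMeas_pointColumns hk _) (bddMeas_pointKernel hk _)

lemma seriesTerm_transfer (μ : Measure X) [IsFiniteMeasure μ] (ν : Measure Y)
    [IsFiniteMeasure ν] {K : ℂ → ℂ → ℂ} (hK : Measurable fun p : ℂ × ℂ => K p.1 p.2)
    {S : Set ℂ} (hS : S.Nonempty) {B : ℝ} (hB : ∀ z ∈ S, ∀ w ∈ S, ‖K z w‖ ≤ B)
    {c ρ : X → ℂ} {d τ : Y → ℂ} (hc : Measurable c) (hd : Measurable d)
    (hcS : ∀ x, c x ∈ S) (hdS : ∀ y, d y ∈ S) (hρ : BddMeas ρ) (hτ : BddMeas τ)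
    (hT : ∀ (n : ℕ) (i : Fin n) (v : Fin n → ℂ), (∀ i, v i ∈ S) →
      ∫ x, (Matrix.of fun a b => -K (Function.update v i (c x) a)
          (Function.update v i (c x) b)).det * ρ x ∂μ =
        ∫ y, (Matrix.of fun a b => -K (Function.update v i (d y) a)
          (Function.update v i (d y) b)).det * τ y ∂ν) (n : ℕ) :
    seriesTerm μ c ρ K n = seriesTerm ν d τ K n := by
  rw [seriesTerm, seriesTerm, integral_pi_transfer μ ν hS hc hd hcS hdS hρ hτ n
    (measurable_kernel_det hK n) (exists_kernel_det_bound hB n) (hT n)]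

lemma bddMeas_det_update_mul {K : ℂ → ℂ → ℂ} (hK : Measurable fun p : ℂ × ℂ => K p.1 p.2)
    {S : Set ℂ} {B : ℝ} (hB : ∀ z ∈ S, ∀ w ∈ S, ‖K z w‖ ≤ B) {c ρ : X → ℂ} (hc : Measurable c)
    (hcS : ∀ x, c x ∈ S) (hρ : BddMeas ρ) {n : ℕ} (i : Fin n) {v : Fin n → ℂ}
    (hv : ∀ i, v i ∈ S) :
    BddMeas fun x => (Matrix.of fun a b => -K (Function.update v i (c x) a)
      (Function.update v i (c x) b)).det * ρ x := by
  refine BddMeas.mul ⟨?_, ?_⟩ hρ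
  · exact (measurable_kernel_det hK n).comp ((measurable_update v).comp hc)
  · refine (exists_kernel_det_bound hB n).imp fun D hD s => hD _ fun a => ?_
    rcases eq_or_ne a i with rfl | ha
    · simpa using hcS s
    · simpa [ha] using hv a

lemma integral_map_inl_add_dirac (ν : Measure Y) [IsFiniteMeasure ν] {r : ℕ}
    {f : Y ⊕ Fin r → ℂ} (hf : BddMeas f) :
    ∫ s, f s ∂(ν.map Sum.inl + ∑ j, Measure.dirac (Sum.inr j)) =
      ∫ y, f (.inl y) ∂ν + ∑ j, f (.inr j) := by
  have hinl : Measurable (Sum.inl : Y → Y ⊕ Fin r) := measurable_inl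
  rw [integral_add_measure (hf.integrable _) (hf.integrable _),
    integral_map hinl.aemeasurable hf.measurable.aestronglyMeasurable,
    integral_finsetSum_measure fun j _ => hf.integrable _]
  congr 1
  exact Finset.sum_congr rfl fun j _ => integral_dirac' _ _ hf.measurable.stronglyMeasurable

lemma BddMeas.of_fin {r : ℕ} (w : Fin r → ℂ) : BddMeas w :=
  ⟨.of_discrete, ∑ j, ‖w j‖, fun j =>
    Finset.single_le_sum (f := fun j => ‖w j‖) (fun _ _ => norm_nonneg _) (Finset.mem_univ j)⟩

/-- If the weighted measure `(μ, c, ρ)` differs from `(ν, d, τ)` by point masses `w j` at `z j`,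
then the quotient of the Fredholm determinants is a finite determinant built from the solutions
`h j` of the linear integral equations `h j = K (·, z j) + K h j`. -/
theorem tsum_seriesTerm_eq_mul_det (μ : Measure X) [IsFiniteMeasure μ] (ν : Measure Y)
    [IsFiniteMeasure ν] {K : ℂ → ℂ → ℂ} (hK : Measurable fun p : ℂ × ℂ => K p.1 p.2)
    {S : Set ℂ} (hS : S.Nonempty) {B : ℝ} (hB : ∀ z ∈ S, ∀ w ∈ S, ‖K z w‖ ≤ B)
    {c ρ : X → ℂ} {d τ : Y → ℂ} (hc : Measurable c) (hd : Measurable d)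
    (hcS : ∀ x, c x ∈ S) (hdS : ∀ y, d y ∈ S) (hρ : BddMeas ρ) (hτ : BddMeas τ) {r : ℕ}
    {z w : Fin r → ℂ} (hzS : ∀ j, z j ∈ S)
    (hT : ∀ (n : ℕ) (i : Fin n) (v : Fin n → ℂ), (∀ i, v i ∈ S) →
      ∫ x, (Matrix.of fun a b => -K (Function.update v i (c x) a)
          (Function.update v i (c x) b)).det * ρ x ∂μ =
        ∫ y, (Matrix.of fun a b => -K (Function.update v i (d y) a)
          (Function.update v i (d y) b)).det * τ y ∂ν +
        ∑ j, (Matrix.of fun a b => -K (Function.update v i (z j) a)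
          (Function.update v i (z j) b)).det * w j)
    {h : Fin r → ℂ → ℂ} (hh : ∀ j, BddMeas fun y => h j (d y))
    (hhd : ∀ j y, h j (d y) = K (d y) (z j) + ∫ y', K (d y) (d y') * τ y' * h j (d y') ∂ν)
    (hhz : ∀ j i, h j (z i) = K (z i) (z j) + ∫ y', K (z i) (d y') * τ y' * h j (d y') ∂ν) :
    ∑' n, seriesTerm μ c ρ K n =
      (∑' n, seriesTerm ν d τ K n) *
        (Matrix.of fun i j => (1 : Matrix (Fin r) (Fin r) ℂ) i j - w j * h j (z i)).det := by
  have hinl : Measurable (Sum.inl : Y → Y ⊕ Fin r) := measurable_inl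
  -- The points `z j` are adjoined to `Y` as atoms of unit mass. The complex weights `w j` are put
  -- into the density `ρ'`, so that the measures remain positive and finite.
  set ν' : Measure (Y ⊕ Fin r) := ν.map Sum.inl with hν'
  set c' : Y ⊕ Fin r → ℂ := Sum.elim d z with hc'
  set ρ' : Y ⊕ Fin r → ℂ := Sum.elim τ w with hρ'
  have hc'm : Measurable c' := hd.sumElim .of_discrete
  have hc'S : ∀ s, c' s ∈ S := by rintro (y | j); exacts [hdS y, hzS j]
  have hρ'b : BddMeas ρ' := hτ.sumElim (.of_fin w)
  have hmap : ∀ f : Y ⊕ Fin r → ℂ, BddMeas f → ∫ s, f s ∂ν' = ∫ y, f (.inl y) ∂ν := fun f hf =>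
    integral_map hinl.aemeasurable hf.measurable.aestronglyMeasurable
  have hpi : ∀ n, Measure.pi (fun _ : Fin n => ν') =
      (Measure.pi fun _ : Fin n => ν).map fun t i => Sum.inl (t i) := fun n =>
    (Measure.pi_map_pi (fun _ => hinl.aemeasurable)).symm
  set k : Y ⊕ Fin r → Y ⊕ Fin r → ℂ := fun s t => -K (c' s) (c' t) * ρ' t with hkdef
  have hk : BddMeas fun q : (Y ⊕ Fin r) × (Y ⊕ Fin r) => k q.1 q.2 :=
    bddMeas_kernel hK hB hc'm hc'S hρ'b
  have h1 : ∀ n, seriesTerm μ c ρ K n =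
      seriesTerm (ν' + ∑ j, Measure.dirac (Sum.inr j)) c' ρ' K n := by
    refine seriesTerm_transfer μ _ hK hS hB hc hc'm hcS hc'S hρ hρ'b fun n i v hv => ?_
    rw [integral_map_inl_add_dirac ν (bddMeas_det_update_mul hK hB hc'm hc'S hρ'b i hv)]
    exact hT n i v hv
  have hcol : ∀ j, BddMeas fun s => w j * h j (c' s) := fun j => by
    refine (BddMeas.const _).mul ?_
    have := (hh j).sumElim (.of_fin fun i => h j (z i))
    convert this using 1
    ext (y | i) <;> rfl
  -- The linear integral equation for `h j`, read as the action of the kernel `-K ρ'` on `w j * h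
  -- j`. On `Y` the border column becomes `-w K + w h - w (h - K) = 0`; in the corner it becomes `δ
  -- - w K - w (h - K) = δ - w h`.
  have hint : ∀ j (s : Y ⊕ Fin r), ∫ s', k s s' * (w j * h j (c' s')) ∂ν' =
      -(w j * (h j (c' s) - K (c' s) (z j))) := by
    intro j s
    rw [hmap _ ((hk.comp measurable_prodMk_left).mul (hcol j))]
    have h2 : h j (c' s) - K (c' s) (z j) = ∫ y', K (c' s) (d y') * τ y' * h j (d y') ∂ν := by
      rcases s with y | i
      · exact sub_eq_iff_eq_add'.2 (hhd j y)
      · exact sub_eq_iff_eq_add'.2 (hhz j i)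
    rw [h2, ← integral_const_mul, ← integral_neg]
    refine integral_congr_ae (.of_forall fun y => ?_)
    simp only [hkdef, hc', hρ', Sum.elim_inl]
    ring
  have hcols := borderedDet_add_columns ν' (bddMeas_pointColumns hk (Sum.inr : Fin r → Y ⊕ Fin r))
    (bddMeas_pointKernel hk Sum.inr) hcol
  rw [tsum_congr h1, tsum_congr (seriesTerm_eq_borderedTerm _ c' ρ' K)]
  change borderedDet (ν' + ∑ j, Measure.dirac (Sum.inr j)) (pointColumns k Fin.elim0)
    (pointKernel k Fin.elim0) = _
  rw [borderedDet_add_sum_dirac hk r ν' Sum.inr, ← hcols, borderedDet_of_zero, mul_comm]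
  · congr 1
    · refine tsum_congr fun n => ?_
      rw [seriesTerm, hpi, integral_map]
      · congr 1
        refine integral_congr_ae (.of_forall fun t => ?_)
        exact det_kernel_mul_prod K d τ t
      · exact (measurable_pi_lambda _ fun i => hinl.comp (measurable_pi_apply i)).aemeasurable
      · refine (BddMeas.det fun a b => ?_).measurable.aestronglyMeasurable
        exact hk.comp (φ := fun t : Fin n → Y ⊕ Fin r => (t a, t b))
          ((measurable_pi_apply a).prodMk (measurable_pi_apply b))
    · congr 1
      ext i j
      simp only [Matrix.of_apply, pointColumns, pointKernel, Sum.elim_inl, hint]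
      simp only [hkdef, hc', hρ', Sum.elim_inr, Matrix.one_apply, Pi.single_apply]
      ring
  · intro j s
    simp only [pointColumns, pointKernel, Sum.elim_inr, id, hint]
    simp only [hkdef, hc', hρ', Sum.elim_inr]
    ring

end Transfer

end XXZ

/-! ### Contours as weighted measures on the line -/

namespace XXZ

open MeasureTheory Set Filter

namespace Contour

variable (C : Contour)

/-- A contour, extended to a curve on the real line with values on the contour. -/
noncomputable def extend : ℝ → ℂ := IccExtend zero_le_one ((Icc (0 : ℝ) 1).domRestrict C.toFun)

/-- The density of `ρ dz` with respect to the curve parameter. -/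
noncomputable def weight (ρ : ℂ → ℂ) : ℝ → ℂ :=
  (Icc (0 : ℝ) 1).indicator fun t => ρ (C.toFun t) * deriv C.toFun t

lemma extend_of_mem {t : ℝ} (ht : t ∈ Icc (0 : ℝ) 1) : C.extend t = C.toFun t :=
  IccExtend_of_mem _ _ ht

lemma measurable_extend : Measurable C.extend :=
  (continuousOn_iff_continuous_domRestrict.1 C.continuousOn).Icc_extend'.measurable

lemma extend_mem_trace (t : ℝ) : C.extend t ∈ C.trace :=
  C.mem_trace (projIcc (0 : ℝ) 1 zero_le_one t).2

lemma bddMeas_weight {ρ : ℂ → ℂ} (hρ : ContinuousOn ρ C.trace) : BddMeas (C.weight ρ) := by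
  obtain ⟨B, hB0, hB⟩ := C.exists_deriv_bound
  obtain ⟨D, hD⟩ := C.isCompact_trace.exists_bound_of_continuousOn hρ
  refine ⟨?_, |D| * B, fun t => ?_⟩
  · have h1 : C.weight ρ = fun t => (Icc (0 : ℝ) 1).indicator (fun t => ρ (C.toFun t)) t *
        deriv C.toFun t := by
      ext t
      by_cases ht : t ∈ Icc (0 : ℝ) 1 <;> simp [weight, ht]
    rw [h1]
    refine Measurable.mul ?_ (measurable_deriv _)
    have := (C.continuousOn_comp hρ).measurable_piecewise (g := 0) (s := Icc (0 : ℝ) 1)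
      continuousOn_const measurableSet_Icc
    rwa [piecewise_eq_indicator] at this
  · by_cases ht : t ∈ Icc (0 : ℝ) 1
    · rw [weight, indicator_of_mem ht, norm_mul]
      exact mul_le_mul ((hD _ (C.mem_trace ht)).trans (le_abs_self _)) (hB t ht) (norm_nonneg _)
        (abs_nonneg _)
    · rw [weight, indicator_of_notMem ht, norm_zero]
      positivity

lemma integral_extend_mul_weight (f ρ : ℂ → ℂ) :
    ∫ t, f (C.extend t) * C.weight ρ t ∂volume.restrict (Icc (0 : ℝ) 1) =
      C.integral fun z => f z * ρ z := by
  rw [Contour.integral, intervalIntegral.integral_of_le zero_le_one,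
    ← integral_Icc_eq_integral_Ioc]
  refine setIntegral_congr_fun measurableSet_Icc fun t ht => ?_
  simp only [C.extend_of_mem ht, weight, indicator_of_mem ht, mul_assoc]

end Contour

/-- The sign `(-1)^n` is absorbed by changing the sign of the kernel. The clamped parametrisation
and the indicator in the weight have no effect on the cube. -/
lemma fredholmTerm_eq_seriesTerm (C : Contour) (ρ : ℂ → ℂ) (k : ℂ → ℂ → ℂ) (n : ℕ) :
    fredholmTerm C ρ k n =
      seriesTerm (volume.restrict (Icc (0 : ℝ) 1)) C.extend (C.weight ρ) k n := by
  have h1 : Measure.pi (fun _ : Fin n => volume.restrict (Icc (0 : ℝ) 1)) =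
      volume.restrict (Icc (0 : Fin n → ℝ) 1) := by
    rw [← Measure.restrict_pi_pi, ← volume_pi, pi_univ_Icc]
    rfl
  rw [fredholmTerm, seriesTerm, h1, div_eq_inv_mul, mul_assoc, ← integral_const_mul]
  congr 1
  refine setIntegral_congr_fun measurableSet_Icc fun t ht => ?_
  have ht' : ∀ i, t i ∈ Icc (0 : ℝ) 1 := fun i => ⟨ht.1 i, ht.2 i⟩
  have h2 : (Matrix.of fun i j => -k (C.extend (t i)) (C.extend (t j))) =
      -Matrix.of fun i j => k (C.toFun (t i)) (C.toFun (t j)) := by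
    ext i j
    simp [C.extend_of_mem (ht' _)]
  simp only [h2, Matrix.det_neg, Fintype.card_fin, Contour.weight, indicator_of_mem (ht' _),
    mul_assoc]

end XXZ

/-! ### Residues at simple poles, and the auxiliary function as a quotient of entire functions -/

namespace XXZ

open MeasureTheory Set Filter

/-- `P = (z - z₀) * dslope P z₀`, so the quotient has at most a simple pole, with residue `q(z₀) /
P'(z₀)`. -/
lemma removable_div_sub {q P : ℂ → ℂ} {z₀ : ℂ} (hq : AnalyticAt ℂ q z₀) (hP : AnalyticAt ℂ P z₀)
    (h0 : P z₀ = 0) (h1 : deriv P z₀ ≠ 0) :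
    Removable (fun z => q z / P z - q z₀ / deriv P z₀ * (z - z₀)⁻¹) z₀ := by
  have hd : ∀ {f : ℂ → ℂ}, AnalyticAt ℂ f z₀ → AnalyticAt ℂ (dslope f z₀) z₀ := by
    rintro f ⟨p, hp⟩
    exact hp.has_fpower_series_dslope_fslope.analyticAt
  set g : ℂ → ℂ := fun z => q z / dslope P z₀ z
  have hg : AnalyticAt ℂ g z₀ := hq.div (hd hP) (by rwa [dslope_same])
  refine ⟨dslope g z₀, hd hg, ?_⟩
  filter_upwards [self_mem_nhdsWithin] with z hz
  have hz' : z - z₀ ≠ 0 := sub_ne_zero.2 hz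
  have hz'' : z ≠ z₀ := hz
  rw [dslope_of_ne _ hz'', slope_def_field]
  simp only [g, dslope_same]
  rw [dslope_of_ne _ hz'', slope_def_field, h0, sub_zero]
  field_simp

/-- The difference of the integrals of a meromorphic function along two contours, if the windings
differ at simple poles only. -/
theorem Contour.integral_sub_integral {h : ℂ → ℂ} (hh : ∀ z, MeromorphicAt h z) {C D : Contour}
    (hC : ∀ z ∈ C.trace, AnalyticAt ℂ h z) (hD : ∀ z ∈ D.trace, AnalyticAt ℂ h z)
    {ι : Type*} [Fintype ι] {p : ι → ℂ} (hp : Function.Injective p) {r : ι → ℂ}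
    (hpC : ∀ i, p i ∉ C.trace) (hpD : ∀ i, p i ∉ D.trace)
    (hr : ∀ i, Removable (fun z => h z - r i * (z - p i)⁻¹) (p i))
    (hw : ∀ z, ¬ Removable h z → z ∉ range p →
      windingNumber C.toFun z = windingNumber D.toFun z) :
    C.integral h - D.integral h = ∑ i, 2 * Real.pi * Complex.I * r i *
      (windingNumber C.toFun (p i) - windingNumber D.toFun (p i)) := by
  classical
  have hinv : ∀ (i : ι) {z}, z ≠ p i → AnalyticAt ℂ (fun z => (z - p i)⁻¹) z := fun i z hz =>
    (analyticAt_id.sub analyticAt_const).inv (sub_ne_zero.2 hz)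
  have hsum : ∀ (s : Finset ι) {z}, (∀ i ∈ s, z ≠ p i) →
      AnalyticAt ℂ (fun z => ∑ i ∈ s, -r i * (z - p i)⁻¹) z := fun s z hz =>
    Finset.analyticAt_fun_sum _ fun i hi => analyticAt_const.mul (hinv i (hz i hi))
  have hI : ∀ E : Contour, (∀ i, p i ∉ E.trace) → (∀ z ∈ E.trace, AnalyticAt ℂ h z) →
      E.integral (fun z => h z + ∑ i, -r i * (z - p i)⁻¹) = E.integral h -
        ∑ i, 2 * Real.pi * Complex.I * r i * windingNumber E.toFun (p i) := by
    intro E hpE hE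
    have hne : ∀ i, ∀ z ∈ E.trace, z ≠ p i := fun i z hz h => hpE i (h ▸ hz)
    suffices H : ∀ s : Finset ι, E.integral (fun z => h z + ∑ i ∈ s, -r i * (z - p i)⁻¹) =
        E.integral h - ∑ i ∈ s, 2 * Real.pi * Complex.I * r i * windingNumber E.toFun (p i) from
      H _
    intro s
    induction s using Finset.induction_on with
    | empty => simp
    | insert i s hi ih =>
      rw [Finset.sum_insert hi, ← sub_sub, sub_right_comm, ← ih]
      have : E.integral (fun z => -r i * (z - p i)⁻¹) =
          -(2 * Real.pi * Complex.I * r i * windingNumber E.toFun (p i)) := by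
        rw [E.integral_const_mul, E.integral_inv_sub]; ring
      rw [sub_eq_add_neg, ← this, ← E.integral_add]
      · exact E.integral_congr fun w _ => by rw [Finset.sum_insert hi]; ring
      · exact fun z hz => ((hE z hz).add (hsum s fun i _ => hne i z hz)).continuousAt
          |>.continuousWithinAt
      · exact fun z hz => (analyticAt_const.mul (hinv i (hne i z hz))).continuousAt
          |>.continuousWithinAt
  have hE : ∀ E : Contour, (∀ i, p i ∉ E.trace) → (∀ z ∈ E.trace, AnalyticAt ℂ h z) →
      ∀ z ∈ E.trace, AnalyticAt ℂ (fun z => h z + ∑ i, -r i * (z - p i)⁻¹) z :=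
    fun E hpE hE z hz => (hE z hz).add (hsum _ fun i _ h => hpE i (h ▸ hz))
  -- Once the simple polar parts at the `p i` are removed, every remaining singularity has the same
  -- winding number with respect to both contours.
  have key := Contour.integral_eq_integral (C := C) (D := D)
    (h := fun z => h z + ∑ i, -r i * (z - p i)⁻¹) (fun z => by
      refine (hh z).add (MeromorphicAt.fun_sum fun i _ => ?_)
      exact (MeromorphicAt.const _ _).mul
        ((analyticAt_id.sub analyticAt_const).meromorphicAt.inv))
    (hE C hpC hC) (hE D hpD hD) fun z hz => by
      by_contra hne
      refine hz ?_
      by_cases hzp : z ∈ range p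
      · obtain ⟨i, rfl⟩ := hzp
        have h2 := hsum (Finset.univ.erase i) (z := p i) fun j hj h =>
          (Finset.mem_erase.1 hj).1 (hp h.symm)
        refine ((hr i).add (.of_analyticAt h2)).congr (.of_forall fun w => ?_)
        simp only
        rw [← Finset.add_sum_erase _ _ (Finset.mem_univ i)]
        ring
      · have hrem : Removable h z := by
          by_contra hrem
          exact hne (hw z hrem hzp)
        exact hrem.add (.of_analyticAt (hsum _ fun i _ h => hzp ⟨i, h.symm⟩))
  rw [hI C hpC hC, hI D hpD hD] at key
  simp only [mul_sub, Finset.sum_sub_distrib]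
  linear_combination key

section Aux

variable (γ : ℝ) (κ : ℂ) {N M : ℕ} (νo νe : Fin (N + 1) → ℂ) (rt : Fin M → ℂ)

/-- The numerator of the auxiliary function. -/
noncomputable def auxNum (z : ℂ) : ℂ :=
  Complex.exp (2 * Complex.I * γ * κ) *
    (∏ k, Complex.sinh (z - νo k) * Complex.sinh (νe k - z - Complex.I * γ)) *
    ∏ k, Complex.sinh (z - rt k - Complex.I * γ)

/-- The denominator of the auxiliary function. -/
noncomputable def auxDen (z : ℂ) : ℂ :=
  (∏ k, Complex.sinh (z - νo k - Complex.I * γ) * Complex.sinh (νe k - z)) *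
    ∏ k, Complex.sinh (z - rt k + Complex.I * γ)

/-- This holds at every `z`, also at the singular points, because inversion in `ℂ` is multiplicative
even with `0⁻¹ = 0`. -/
lemma aux_eq_div (z : ℂ) :
    aux γ κ νo νe rt z = auxNum γ κ νo νe rt z / auxDen γ νo νe rt z := by
  have hexp : Complex.exp (2 * Complex.I * γ * κ) =
      Complex.exp (Complex.I * γ * κ) * (Complex.exp (-(Complex.I * γ * κ)))⁻¹ := by
    rw [← Complex.exp_neg, ← Complex.exp_add]
    congr 1
    ring
  rw [aux, auxNum, auxDen, vacD, vacA, hexp]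
  simp only [weightB, Finset.prod_mul_distrib, Finset.prod_inv_distrib, div_eq_mul_inv, mul_inv,
    inv_inv]
  ring

lemma differentiable_auxNum : Differentiable ℂ (auxNum γ κ νo νe rt) := by
  unfold auxNum
  fun_prop

lemma differentiable_auxDen : Differentiable ℂ (auxDen γ νo νe rt) := by
  unfold auxDen
  fun_prop

lemma isSingular_of_auxDen_eq_zero {z : ℂ} (h : auxDen γ νo νe rt z = 0) :
    IsSingular γ νo νe rt z := by
  rcases mul_eq_zero.1 h with h | h
  · obtain ⟨k, _, hk⟩ := Finset.prod_eq_zero_iff.1 h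
    rcases mul_eq_zero.1 hk with hk | hk
    · exact .inr (.inl ⟨k, hk⟩)
    · refine .inl ⟨k, ?_⟩
      rw [← neg_sub, Complex.sinh_neg, hk, neg_zero]
  · obtain ⟨k, _, hk⟩ := Finset.prod_eq_zero_iff.1 h
    exact .inr (.inr ⟨k, hk⟩)

end Aux

end XXZ

/-! ### Comparison of `dm_0` on the two contours -/

namespace XXZ

open MeasureTheory Set Filter

lemma densityM0_eq_div {q p : ℂ} {f : ℂ → ℂ} {z : ℂ} (hf : f z = q / p) (hp : p ≠ 0) :
    densityM0 f z = p / (2 * Real.pi * Complex.I * (p + q)) := by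
  rw [densityM0, hf]
  have : (1 : ℂ) + q / p = (p + q) / p := by field_simp
  rw [this, mul_div_assoc', one_div_div]

section

variable {γ : ℝ} {κ : ℂ} {N M nh np : ℕ} {νo νe : Fin (N + 1) → ℂ} {rt : Fin M → ℂ}
  {Cn C0 : Contour} {x : Fin nh → ℂ} {y : Fin np → ℂ}

lemma auxDen_ne_zero_of_trace {C : Contour} (hC : HasStandardPoles γ νo νe rt C) {z : ℂ}
    (hz : z ∈ C.trace) : auxDen γ νo νe rt z ≠ 0 := by
  intro h
  obtain ⟨k, rfl⟩ := hC.2 z (C.trace_subset_hull hz) (isSingular_of_auxDen_eq_zero γ νo νe rt h)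
  exact (hC.1 k).1 hz

/-- On and inside the contours, the zeros of the entire function `den + num` are zeros of `1 + 𝔞`
and regular points of `𝔞`. -/
lemma aux_eq_neg_one_of_add_eq_zero (hν : ∀ j k, Complex.sinh (νo j - νe k) ≠ 0)
    (hCn : IsStateContour γ κ νo νe rt Cn) (hC0 : HasStandardPoles γ νo νe rt C0)
    (hshape : ∀ z ∈ Cn.hull ∪ C0.hull, ∀ w ∈ Cn.hull ∪ C0.hull,
      Complex.sinh (z - w + Complex.I * γ) ≠ 0) {z : ℂ} (hz : z ∈ Cn.hull ∪ C0.hull)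
    (h : auxDen γ νo νe rt z + auxNum γ κ νo νe rt z = 0) :
    auxDen γ νo νe rt z ≠ 0 ∧ aux γ κ νo νe rt z = -1 := by
  -- A zero of `den` on the hulls is some `ν_{2k}`. No factor of `num` vanishes there: those with
  -- `ν_{2j-1}` by `hν`, the others because differences of points of the hulls avoid `±iγ`.
  have hne : auxDen γ νo νe rt z ≠ 0 := by
    intro h0
    have hs := isSingular_of_auxDen_eq_zero γ νo νe rt h0
    obtain ⟨k, rfl⟩ : ∃ k, z = νe k := hz.elim (fun hz => hCn.1.2 z hz hs) fun hz => hC0.2 z hz hs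
    have hmem : ∀ k, νe k ∈ Cn.hull ∪ C0.hull := fun k => .inl (Cn.inside_subset_hull (hCn.1.1 k))
    rw [h0, zero_add] at h
    rcases mul_eq_zero.1 h with h | h
    · rcases mul_eq_zero.1 h with h | h
      · exact Complex.exp_ne_zero _ h
      · obtain ⟨j, _, hj⟩ := Finset.prod_eq_zero_iff.1 h
        rcases mul_eq_zero.1 hj with hj | hj
        · refine hν j k ?_
          rw [← neg_sub, Complex.sinh_neg, hj, neg_zero]
        · refine hshape _ (hmem k) _ (hmem j) ?_
          rw [show νe k - νe j + Complex.I * γ = -(νe j - νe k - Complex.I * γ) by ring,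
            Complex.sinh_neg, hj, neg_zero]
    · obtain ⟨j, _, hj⟩ := Finset.prod_eq_zero_iff.1 h
      refine hshape _ (.inl (Cn.inside_subset_hull (hCn.2.1 j))) _ (hmem k) ?_
      rw [show rt j - νe k + Complex.I * γ = -(νe k - rt j - Complex.I * γ) by ring,
        Complex.sinh_neg, hj, neg_zero]
  refine ⟨hne, ?_⟩
  rw [aux_eq_div, div_eq_iff hne]
  linear_combination h

lemma add_ne_zero_of_trace {C : Contour} (hC : HasStandardPoles γ νo νe rt C)
    (hne : ∀ z ∈ C.trace, aux γ κ νo νe rt z ≠ -1) {z : ℂ} (hz : z ∈ C.trace) :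
    auxDen γ νo νe rt z + auxNum γ κ νo νe rt z ≠ 0 := by
  intro h
  refine hne z hz ?_
  rw [aux_eq_div, div_eq_iff (auxDen_ne_zero_of_trace hC hz)]
  linear_combination h

lemma IsStateContour.aux_ne_neg_one (hCn : IsStateContour γ κ νo νe rt Cn) {z : ℂ}
    (hz : z ∈ Cn.trace) : aux γ κ νo νe rt z ≠ -1 := by
  intro h
  obtain ⟨j, rfl⟩ := hCn.2.2 z (Cn.trace_subset_hull hz) h
  exact (hCn.2.1 j).1 hz

lemma densityM0_eq_of_trace {C : Contour} (hC : HasStandardPoles γ νo νe rt C) {z : ℂ}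
    (hz : z ∈ C.trace) : densityM0 (aux γ κ νo νe rt) z =
      auxDen γ νo νe rt z /
        (2 * Real.pi * Complex.I * (auxDen γ νo νe rt z + auxNum γ κ νo νe rt z)) :=
  densityM0_eq_div (aux_eq_div γ κ νo νe rt z) (auxDen_ne_zero_of_trace hC hz)

lemma continuousOn_densityM0 {C : Contour} (hC : HasStandardPoles γ νo νe rt C)
    (hne : ∀ z ∈ C.trace, aux γ κ νo νe rt z ≠ -1) :
    ContinuousOn (densityM0 (aux γ κ νo νe rt)) C.trace := by
  have hd := (differentiable_auxDen γ νo νe rt).continuous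
  have hn := (differentiable_auxNum γ κ νo νe rt).continuous
  refine ContinuousOn.congr (ContinuousOn.div hd.continuousOn
    (continuous_const.mul (hd.add hn)).continuousOn fun z hz => ?_)
    fun z hz => densityM0_eq_of_trace hC hz
  exact mul_ne_zero (by simp [Real.pi_ne_zero]) (add_ne_zero_of_trace hC hne hz)

lemma hole_mem (hxy : AreHolesAndParticles γ κ νo νe rt C0 x y) (j : Fin nh) :
    x j ∈ C0.inside ∧ aux γ κ νo νe rt (x j) = -1 ∧ x j ∉ range rt := by
  have : x j ∈ range x := ⟨j, rfl⟩
  rwa [hxy.2.2.1] at this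

lemma particle_mem (hxy : AreHolesAndParticles γ κ νo νe rt C0 x y) (j : Fin np) :
    y j ∈ range rt ∧ y j ∉ C0.inside := by
  have : y j ∈ range y := ⟨j, rfl⟩
  rwa [hxy.2.2.2.2] at this

lemma aux_particle (hrt : IsBetheSolution γ κ νo νe rt)
    (hxy : AreHolesAndParticles γ κ νo νe rt C0 x y) (j : Fin np) :
    aux γ κ νo νe rt (y j) = -1 := by
  obtain ⟨k, hk⟩ := (particle_mem hxy j).1
  rw [← hk]
  exact hrt.2 k

lemma particle_mem_inside (hCn : IsStateContour γ κ νo νe rt Cn)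
    (hxy : AreHolesAndParticles γ κ νo νe rt C0 x y) (j : Fin np) : y j ∈ Cn.inside := by
  obtain ⟨k, hk⟩ := (particle_mem hxy j).1
  rw [← hk]
  exact hCn.2.1 k

/-- At a zero of the denominator the quotient takes the default value `0`, which is not `-1`. -/
lemma auxDen_ne_zero_of_aux {z : ℂ} (h : aux γ κ νo νe rt z = -1) :
    auxDen γ νo νe rt z ≠ 0 := by
  intro h0
  rw [aux_eq_div, h0, div_zero] at h
  norm_num at h

lemma add_eq_zero_of_aux {z : ℂ} (h : aux γ κ νo νe rt z = -1) :
    auxDen γ νo νe rt z + auxNum γ κ νo νe rt z = 0 := by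
  have h0 := auxDen_ne_zero_of_aux h
  rw [aux_eq_div, div_eq_iff h0] at h
  rw [h]; ring

/-- `den + num = den (1 + 𝔞)`, and the second factor vanishes at the point. This makes the residue
of `den / (den + num)` equal to `1 / 𝔞'`. -/
lemma deriv_add_of_aux {z : ℂ} (h : aux γ κ νo νe rt z = -1) :
    deriv (fun z => auxDen γ νo νe rt z + auxNum γ κ νo νe rt z) z =
      auxDen γ νo νe rt z * deriv (aux γ κ νo νe rt) z := by
  have h0 := auxDen_ne_zero_of_aux h
  have hd := (differentiable_auxDen γ νo νe rt) z
  have hn := (differentiable_auxNum γ κ νo νe rt) z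
  rw [deriv_fun_add hd hn, funext (aux_eq_div γ κ νo νe rt), deriv_fun_div hn hd h0]
  have h1 := add_eq_zero_of_aux h
  have h2 : auxNum γ κ νo νe rt z = -auxDen γ νo νe rt z := by linear_combination h1
  rw [h2]
  field_simp
  ring

/-- The integrals with respect to `dm₀` along the two contours differ by the contributions of the
holes and particles. -/
theorem integral_densityM0_sub (hν : ∀ j k, Complex.sinh (νo j - νe k) ≠ 0)
    (hrt : IsBetheSolution γ κ νo νe rt)
    (hCn : IsStateContour γ κ νo νe rt Cn) (hC0 : HasStandardPoles γ νo νe rt C0)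
    (hshape : ∀ z ∈ Cn.hull ∪ C0.hull, ∀ w ∈ Cn.hull ∪ C0.hull,
      Complex.sinh (z - w + Complex.I * γ) ≠ 0)
    (hxy : AreHolesAndParticles γ κ νo νe rt C0 x y)
    (hx : ∀ j, deriv (aux γ κ νo νe rt) (x j) ≠ 0)
    (hy : ∀ j, deriv (aux γ κ νo νe rt) (y j) ≠ 0) {f : ℂ → ℂ} (hf : ∀ z, MeromorphicAt f z)
    (hfa : ∀ z ∈ Cn.hull ∪ C0.hull, AnalyticAt ℂ f z) :
    Cn.integral (fun z => f z * densityM0 (aux γ κ νo νe rt) z) -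
        C0.integral (fun z => f z * densityM0 (aux γ κ νo νe rt) z) =
      ∑ i : Fin nh ⊕ Fin np, Sum.elim (fun _ => -1) (fun _ => 1) i /
        deriv (aux γ κ νo νe rt) (Sum.elim x y i) * f (Sum.elim x y i) := by
  set a := aux γ κ νo νe rt with ha
  set den := auxDen γ νo νe rt with hden
  set P : ℂ → ℂ := fun z => auxDen γ νo νe rt z + auxNum γ κ νo νe rt z with hP
  set p : Fin nh ⊕ Fin np → ℂ := Sum.elim x y with hp
  have h2πi : (2 * Real.pi * Complex.I : ℂ) ≠ 0 := by simp [Real.pi_ne_zero]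
  have hdena : ∀ z, AnalyticAt ℂ den z := fun z => (differentiable_auxDen γ νo νe rt).analyticAt z
  have hPa : ∀ z, AnalyticAt ℂ P z := fun z =>
    (hdena z).add ((differentiable_auxNum γ κ νo νe rt).analyticAt z)
  set q : ℂ → ℂ := fun z => f z * ((2 * Real.pi * Complex.I)⁻¹ * den z) with hq
  have hqm : ∀ z, MeromorphicAt q z := fun z =>
    (hf z).mul ((MeromorphicAt.const _ _).mul (hdena z).meromorphicAt)
  have hqa : ∀ z ∈ Cn.hull ∪ C0.hull, AnalyticAt ℂ q z := fun z hz =>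
    (hfa z hz).mul (analyticAt_const.mul (hdena z))
  have hneC : ∀ z ∈ Cn.trace, P z ≠ 0 := fun z hz =>
    add_ne_zero_of_trace hCn.1 (fun z hz => hCn.aux_ne_neg_one hz) hz
  have hne0 : ∀ z ∈ C0.trace, P z ≠ 0 := fun z hz => add_ne_zero_of_trace hC0 hxy.1 hz
  have hap : ∀ i, a (p i) = -1 := by
    rintro (j | j)
    exacts [(hole_mem hxy j).2.1, aux_particle hrt hxy j]
  have hap' : ∀ i, deriv a (p i) ≠ 0 := by
    rintro (j | j)
    exacts [hx j, hy j]
  have hpC : ∀ i, p i ∉ Cn.trace := fun i h => hCn.aux_ne_neg_one h (hap i)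
  have hp0 : ∀ i, p i ∉ C0.trace := fun i h => hxy.1 _ h (hap i)
  have hmem : ∀ i, p i ∈ Cn.hull ∪ C0.hull := by
    rintro (j | j)
    · exact .inr (C0.inside_subset_hull (hole_mem hxy j).1)
    · exact .inl (Cn.inside_subset_hull (particle_mem_inside hCn hxy j))
  have hxC : ∀ j, x j ∉ Cn.hull := fun j h => by
    obtain ⟨k, hk⟩ := hCn.2.2 _ h (hole_mem hxy j).2.1
    exact (hole_mem hxy j).2.2 ⟨k, hk.symm⟩
  have hy0 : ∀ j, y j ∉ C0.hull := by
    rintro j (h | h)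
    exacts [hp0 (.inr j) h, (particle_mem hxy j).2 h]
  have hinj : Function.Injective p :=
    hxy.2.1.sumElim hxy.2.2.2.1 fun i j h =>
      (hole_mem hxy i).2.2 (h ▸ (particle_mem hxy j).1)
  have hC : Cn.integral (fun z => f z * densityM0 a z) = Cn.integral fun z => q z / P z :=
    Cn.integral_congr fun z hz => by
      rw [densityM0_eq_of_trace hCn.1 hz, ← hden, hq, ← div_div]
      simp only [hP]
      ring
  have h0 : C0.integral (fun z => f z * densityM0 a z) = C0.integral fun z => q z / P z :=
    C0.integral_congr fun z hz => by
      rw [densityM0_eq_of_trace hC0 hz, ← hden, hq, ← div_div]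
      simp only [hP]
      ring
  have key := Contour.integral_sub_integral (C := Cn) (D := C0) (h := fun z => q z / P z)
    (fun z => (hqm z).div (hPa z).meromorphicAt)
    (fun z hz => (hqa z (.inl (Cn.trace_subset_hull hz))).div (hPa z) (hneC z hz))
    (fun z hz => (hqa z (.inr (C0.trace_subset_hull hz))).div (hPa z) (hne0 z hz))
    hinj hpC hp0 (r := fun i => q (p i) / deriv P (p i))
    (fun i => removable_div_sub (hqa _ (hmem i)) (hPa _) (add_eq_zero_of_aux (hap i)) (by
      rw [hP, deriv_add_of_aux (hap i)]
      exact mul_ne_zero (auxDen_ne_zero_of_aux (hap i)) (hap' i)))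
    -- A pole on the hulls that is neither hole nor particle is a Bethe root inside both contours,
    -- where both winding numbers are `1`; off the hulls both are `0`.
    fun z hz hzp => by
      by_cases hzh : z ∈ Cn.hull ∪ C0.hull
      · have hPz : P z = 0 := by
          by_contra hPz
          exact hz (.of_analyticAt ((hqa z hzh).div (hPa z) hPz))
        have haz := (aux_eq_neg_one_of_add_eq_zero hν hCn hC0 hshape hzh hPz).2
        by_cases hzn : z ∈ Cn.hull
        · obtain ⟨k, hk⟩ := hCn.2.2 z hzn haz
          have hz0 : z ∈ C0.inside := by
            by_contra hz0
            have : z ∈ range y := by rw [hxy.2.2.2.2]; exact ⟨⟨k, hk.symm⟩, hz0⟩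
            obtain ⟨j, hj⟩ := this
            exact hzp ⟨.inr j, hj⟩
          rw [hk, (hCn.2.1 k).2, ← hk, hz0.2]
        · have hz0 : z ∈ C0.inside := (hzh.resolve_left hzn).resolve_left fun h => hxy.1 z h haz
          have : z ∈ range x := by
            rw [hxy.2.2.1]
            refine ⟨hz0, haz, ?_⟩
            rintro ⟨k, rfl⟩
            exact hzn (Cn.inside_subset_hull (hCn.2.1 k))
          obtain ⟨j, hj⟩ := this
          exact absurd ⟨.inl j, hj⟩ hzp
      · rw [Cn.windingNumber_eq_zero fun h => hzh (.inl h),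
          C0.windingNumber_eq_zero fun h => hzh (.inr h)]
  rw [hC, h0, key]
  refine Finset.sum_congr rfl fun i _ => ?_
  -- Holes lie inside `C0` and outside `Cn`, because only Bethe roots are zeros of `1 + 𝔞` on the
  -- hull of `Cn`. Particles lie inside `Cn` and off the hull of `C0`.
  have hwi : windingNumber Cn.toFun (p i) - windingNumber C0.toFun (p i) =
      Sum.elim (fun _ => -1) (fun _ => 1) i := by
    rcases i with j | j
    · rw [show p (.inl j) = x j from rfl, Cn.windingNumber_eq_zero (hxC j), (hole_mem hxy j).1.2]
      simp
    · rw [show p (.inr j) = y j from rfl, C0.windingNumber_eq_zero (hy0 j), (particle_mem_inside hCn hxy j).2]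
      simp
  have hd : den (p i) ≠ 0 := auxDen_ne_zero_of_aux (hap i)
  have hd' := hap' i
  rw [hwi, hP, deriv_add_of_aux (hap i), hq, ← ha, ← hden]
  field_simp

end

end XXZ

/-! ### Differentiation of the nonlinear integral equation -/

namespace XXZ

open MeasureTheory Set Filter

section Slices

variable {B : ℂ → ℂ → ℂ} {w ζ : ℂ}

lemma hasDerivAt_fst (h : AnalyticAt ℂ (fun p : ℂ × ℂ => B p.1 p.2) (w, ζ)) :
    HasDerivAt (fun w => B w ζ) (fderiv ℂ (fun p : ℂ × ℂ => B p.1 p.2) (w, ζ) (1, 0)) w :=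
  h.differentiableAt.hasFDerivAt.comp_hasDerivAt (f := fun w => (w, ζ)) w
    ((hasDerivAt_id' w).prodMk (hasDerivAt_const w ζ))

lemma hasDerivAt_snd (h : AnalyticAt ℂ (fun p : ℂ × ℂ => B p.1 p.2) (w, ζ)) :
    HasDerivAt (B w) (fderiv ℂ (fun p : ℂ × ℂ => B p.1 p.2) (w, ζ) (0, 1)) ζ :=
  h.differentiableAt.hasFDerivAt.comp_hasDerivAt (f := fun ζ => (w, ζ)) ζ
    ((hasDerivAt_const ζ w).prodMk (hasDerivAt_id' ζ))

lemma continuousAt_fderiv_apply {G : ℂ × ℂ → ℂ} {p : ℂ × ℂ} (h : AnalyticAt ℂ G p) (v : ℂ × ℂ) :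
    ContinuousAt (fun p => fderiv ℂ G p v) p :=
  h.fderiv.continuousAt.clm_apply continuousAt_const

lemma analyticAt_slice (h : AnalyticAt ℂ (fun p : ℂ × ℂ => B p.1 p.2) (w, ζ)) :
    AnalyticAt ℂ (fun w => B w ζ) w :=
  h.comp (f := fun w => (w, ζ)) (analyticAt_id.prod analyticAt_const)

end Slices

namespace Contour

variable (C : Contour)

lemma continuousOn_logOneAdd {f : ℂ → ℂ} (hf : ∀ w ∈ C.trace, AnalyticAt ℂ f w)
    (hne : ∀ w ∈ C.trace, 1 + f w ≠ 0) : ContinuousOn (C.logOneAdd f) (Icc 0 1) := by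
  have h := C.intervalIntegrable (f := fun w => deriv f w / (1 + f w)) fun w hw =>
    ((hf w hw).deriv.continuousAt.div (continuousAt_const.add (hf w hw).continuousAt)
      (hne w hw)).continuousWithinAt
  have := intervalIntegral.continuousOn_primitive_interval (μ := volume)
    (f := fun t => deriv f (C.toFun t) / (1 + f (C.toFun t)) * deriv C.toFun t) (a := 0) (b := 1)
    ((intervalIntegrable_iff_integrableOn_Icc_of_le zero_le_one).1 h |>.mono_set (by
      rw [uIcc_of_le zero_le_one]))
  rwa [uIcc_of_le zero_le_one] at this

/-- For nearby functions the ratio `(1 + f) / (1 + g)` stays in the slit plane, so the difference of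
the two integrated logarithms is a principal logarithm, normalised at the base point. The dependence
on a parameter then becomes explicit. -/
lemma logOneAdd_sub_logOneAdd {f g : ℂ → ℂ} (hf : ∀ w ∈ C.trace, AnalyticAt ℂ f w)
    (hg : ∀ w ∈ C.trace, AnalyticAt ℂ g w) (hfne : ∀ w ∈ C.trace, 1 + f w ≠ 0)
    (hgne : ∀ w ∈ C.trace, 1 + g w ≠ 0)
    (hslit : ∀ w ∈ C.trace, (1 + f w) / (1 + g w) ∈ Complex.slitPlane) {t : ℝ}
    (ht : t ∈ Icc (0 : ℝ) 1) :
    C.logOneAdd f t - C.logOneAdd g t =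
      Complex.log ((1 + f (C.toFun t)) / (1 + g (C.toFun t))) -
        Complex.log ((1 + f (C.toFun 0)) / (1 + g (C.toFun 0))) := by
  have hc : ∀ {f : ℂ → ℂ}, (∀ w ∈ C.trace, AnalyticAt ℂ f w) → (∀ w ∈ C.trace, 1 + f w ≠ 0) →
      ContinuousOn (fun w => deriv f w / (1 + f w)) C.trace := fun hf hne w hw =>
    ((hf w hw).deriv.continuousAt.div (continuousAt_const.add (hf w hw).continuousAt)
      (hne w hw)).continuousWithinAt
  have hi : ∀ {f : ℂ → ℂ}, (∀ w ∈ C.trace, AnalyticAt ℂ f w) → (∀ w ∈ C.trace, 1 + f w ≠ 0) →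
      IntervalIntegrable (fun t => deriv f (C.toFun t) / (1 + f (C.toFun t)) * deriv C.toFun t)
        volume 0 t := fun hf hne =>
    C.intervalIntegrable_of_continuousOn (C.continuousOn_comp (hc hf hne)) (by simp) ht
  rw [logOneAdd, logOneAdd, ← intervalIntegral.integral_sub (hi hf hfne) (hi hg hgne)]
  have key := C.integral_deriv_comp (F := fun w => Complex.log ((1 + f w) / (1 + g w)))
    (F' := fun w => deriv f w / (1 + f w) - deriv g w / (1 + g w)) (fun w hw => ?_)
    ((hc hf hfne).sub (hc hg hgne)) ht
  · rw [← key]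
    simp only [sub_mul]
  · have h1 := (hf w hw).differentiableAt.hasDerivAt.const_add 1
    have h2 := (hg w hw).differentiableAt.hasDerivAt.const_add 1
    refine ((h1.div h2 (hgne w hw)).clog (hslit w hw)).congr_deriv ?_
    have := hfne w hw
    have := hgne w hw
    simp only [Pi.div_apply]
    field_simp

end Contour

/-- Differentiation of a nonlinear integral equation with respect to a parameter. -/
theorem hasDerivAt_of_nlie {C : Contour} {B : ℂ → ℂ → ℂ} {ζ₀ : ℂ}
    (hB : ∀ w ∈ C.trace, AnalyticAt ℂ (fun p : ℂ × ℂ => B p.1 p.2) (w, ζ₀))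
    (hne : ∀ w ∈ C.trace, 1 + B w ζ₀ ≠ 0) {k : ℂ → ℂ} (hk : ContinuousOn k C.trace)
    (hk0 : C.integral k = 0) {b E : ℂ → ℂ} {e : ℂ} (hE : HasDerivAt E (e * E ζ₀) ζ₀)
    (hb : ∀ᶠ ζ in 𝓝 ζ₀, b ζ = E ζ * Complex.exp (-((2 * Real.pi * Complex.I)⁻¹ *
      ∫ t in (0 : ℝ)..1, k (C.toFun t) * C.logOneAdd (fun w => B w ζ) t * deriv C.toFun t))) :
    HasDerivAt b (b ζ₀ * (e - (2 * Real.pi * Complex.I)⁻¹ *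
      C.integral fun w => k w * (deriv (B w) ζ₀ / (1 + B w ζ₀)))) ζ₀ := by
  set G : ℂ × ℂ → ℂ := fun p => B p.1 p.2 with hG
  set D : ℂ → ℂ → ℂ := fun w ζ => fderiv ℂ G (w, ζ) (0, 1) / (1 + B w ζ) with hD
  set lam : ℂ → ℂ → ℂ := fun w ζ => Complex.log ((1 + B w ζ) / (1 + B w ζ₀)) with hlam
  have hcG : ∀ w ∈ C.trace, ContinuousAt G (w, ζ₀) := fun w hw => (hB w hw).continuousAt
  have hcD : ∀ w ∈ C.trace, ContinuousAt (fun p : ℂ × ℂ => D p.1 p.2) (w, ζ₀) := fun w hw =>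
    (continuousAt_fderiv_apply (hB w hw) (0, 1)).div (continuousAt_const.add (hcG w hw)) (hne w hw)
  have hswap : ∀ w : ℂ, Tendsto (fun q : ℂ × ℂ => (q.2, q.1)) (𝓝 (ζ₀, w)) (𝓝 (w, ζ₀)) := fun w =>
    (continuous_snd.prodMk continuous_fst).tendsto _
  obtain ⟨M, hM⟩ := C.isCompact_trace.exists_bound_of_continuousOn (f := fun w => D w ζ₀)
    fun w hw => ((hcD w hw).comp (f := fun w => (w, ζ₀))
      (by fun_prop)).continuousWithinAt
  -- Compactness of the trace gives one neighbourhood of `ζ₀` for all `w`. The second condition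
  -- keeps the ratio in the slit plane, and the third supplies the dominating function.
  have hgood : ∀ᶠ ζ in 𝓝 ζ₀, ∀ w ∈ C.trace, AnalyticAt ℂ G (w, ζ) ∧
      ‖(1 + B w ζ) / (1 + B w ζ₀) - 1‖ < 1 ∧ ‖D w ζ‖ < M + 1 := by
    refine C.isCompact_trace.eventually_forall_of_forall_eventually
      (P := fun ζ w => AnalyticAt ℂ G (w, ζ) ∧
        ‖(1 + B w ζ) / (1 + B w ζ₀) - 1‖ < 1 ∧ ‖D w ζ‖ < M + 1) fun w hw => ?_
    refine ((hswap w).eventually (hB w hw).eventually_analyticAt).and (.and ?_ ?_)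
    · have hc : ContinuousAt (fun p : ℂ × ℂ => ‖(1 + B p.1 p.2) / (1 + B p.1 ζ₀) - 1‖) (w, ζ₀) := by
        have h2 : ContinuousAt (fun p : ℂ × ℂ => B p.1 ζ₀) (w, ζ₀) :=
          ContinuousAt.comp (g := G) (f := fun p : ℂ × ℂ => (p.1, ζ₀)) (x := (w, ζ₀)) (hcG w hw)
            (by fun_prop)
        exact (((continuousAt_const.add (hcG w hw)).div (continuousAt_const.add h2)
          (hne w hw)).sub continuousAt_const).norm
      refine (hswap w).eventually (hc.eventually_lt continuousAt_const ?_)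
      simp [div_self (hne w hw)]
    · refine (hswap w).eventually ((hcD w hw).norm.eventually_lt continuousAt_const ?_)
      exact (hM w hw).trans_lt (lt_add_one M)
  have hslit : ∀ {u : ℂ}, ‖u - 1‖ < 1 → u ∈ Complex.slitPlane := fun hu =>
    Complex.mem_slitPlane_of_norm_lt_one hu |> fun h => by simpa using h
  have hne' : ∀ {w ζ : ℂ}, ‖(1 + B w ζ) / (1 + B w ζ₀) - 1‖ < 1 → 1 + B w ζ ≠ 0 := by
    intro w ζ h h0
    simp [h0] at h
  set L : ℂ → ℂ := fun ζ => C.integral fun w => k w * lam w ζ with hL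
  have hlamd : ∀ {w ζ : ℂ}, w ∈ C.trace → AnalyticAt ℂ G (w, ζ) →
      ‖(1 + B w ζ) / (1 + B w ζ₀) - 1‖ < 1 → HasDerivAt (lam w) (D w ζ) ζ := by
    intro w ζ hw hA hn
    have h1 := (((hasDerivAt_snd hA).const_add 1).div_const (1 + B w ζ₀)).clog (hslit hn)
    refine h1.congr_deriv ?_
    have := hne w hw
    have := hne' hn
    simp only [hD]
    field_simp
    rfl
  have hlamc : ∀ {ζ : ℂ}, (∀ w ∈ C.trace, AnalyticAt ℂ G (w, ζ) ∧
      ‖(1 + B w ζ) / (1 + B w ζ₀) - 1‖ < 1 ∧ ‖D w ζ‖ < M + 1) →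
      ContinuousOn (fun w => lam w ζ) C.trace := by
    intro ζ hζ w hw
    obtain ⟨hA, hn, -⟩ := hζ w hw
    refine ContinuousAt.continuousWithinAt (ContinuousAt.clog ?_ (hslit hn))
    exact (continuousAt_const.add (analyticAt_slice hA).continuousAt).div
      (continuousAt_const.add (analyticAt_slice (hB w hw)).continuousAt) (hne w hw)
  have hLd : HasDerivAt L (C.integral fun w => k w * (deriv (B w) ζ₀ / (1 + B w ζ₀))) ζ₀ := by
    obtain ⟨Bd, hBd0, hBd⟩ := C.exists_deriv_bound
    obtain ⟨Bk, hBk⟩ := C.isCompact_trace.exists_bound_of_continuousOn hk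
    have hcD0 : ContinuousOn (fun w => D w ζ₀) C.trace := fun w hw =>
      ((hcD w hw).comp (f := fun w => (w, ζ₀)) (by fun_prop)).continuousWithinAt
    have := (intervalIntegral.hasDerivAt_integral_of_dominated_loc_of_deriv_le (μ := volume)
      (a := 0) (b := 1) (F := fun ζ t => k (C.toFun t) * lam (C.toFun t) ζ * deriv C.toFun t)
      (F' := fun ζ t => k (C.toFun t) * D (C.toFun t) ζ * deriv C.toFun t)
      (bound := fun _ => |Bk| * (M + 1) * Bd) hgood ?_ ?_ ?_ ?_ (by simp) ?_).2
    · refine this.congr_deriv (C.integral_congr (f := fun w => k w * D w ζ₀) fun w hw => ?_)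
      simp only [hD, (hasDerivAt_snd (hB w hw)).deriv]
      rfl
    · filter_upwards [hgood] with ζ hζ
      exact (intervalIntegrable_iff.1 (C.intervalIntegrable
        (f := fun w => k w * lam w ζ) (hk.mul (hlamc hζ)))).aestronglyMeasurable
    · exact C.intervalIntegrable (f := fun w => k w * lam w ζ₀)
        (hk.mul (hlamc hgood.self_of_nhds))
    · exact (intervalIntegrable_iff.1 (C.intervalIntegrable
        (f := fun w => k w * D w ζ₀) (hk.mul hcD0))).aestronglyMeasurable
    · refine .of_forall fun t ht ζ hζ => ?_
      rw [uIoc_of_le zero_le_one] at ht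
      have ht := Ioc_subset_Icc_self ht
      have hw := C.mem_trace ht
      rw [norm_mul, norm_mul]
      have hM' := (hζ _ hw).2.2.le
      have h1 := (hBk _ hw).trans (le_abs_self _)
      have h2 := (norm_nonneg _).trans hM'
      exact mul_le_mul (mul_le_mul h1 hM' (norm_nonneg _) (abs_nonneg _)) (hBd t ht)
        (norm_nonneg _) (mul_nonneg (abs_nonneg _) h2)
    · refine .of_forall fun t ht ζ hζ => ?_
      rw [uIoc_of_le zero_le_one] at ht
      have hw := C.mem_trace (Ioc_subset_Icc_self ht)
      exact ((hlamd hw (hζ _ hw).1 (hζ _ hw).2.1).const_mul _).mul_const _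
  set J : ℂ → ℂ := fun ζ =>
    ∫ t in (0 : ℝ)..1, k (C.toFun t) * C.logOneAdd (fun w => B w ζ) t * deriv C.toFun t with hJ
  -- Only the ratio of `1 + B` at `ζ` and at `ζ₀` matters. The base point contributes a constant
  -- times the integral of `k`, which vanishes.
  have hJL : ∀ᶠ ζ in 𝓝 ζ₀, J ζ = J ζ₀ + L ζ := by
    filter_upwards [hgood] with ζ hζ
    have hA0 : ∀ w ∈ C.trace, AnalyticAt ℂ (fun w => B w ζ₀) w := fun w hw =>
      analyticAt_slice (hB w hw)
    have hA : ∀ w ∈ C.trace, AnalyticAt ℂ (fun w => B w ζ) w := fun w hw =>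
      analyticAt_slice (hζ w hw).1
    have hl := fun {t : ℝ} (ht : t ∈ Icc (0 : ℝ) 1) => C.logOneAdd_sub_logOneAdd hA hA0
      (fun w hw => hne' (hζ w hw).2.1) hne (fun w hw => hslit (hζ w hw).2.1) ht
    have hi1 : IntervalIntegrable (fun t => k (C.toFun t) *
        C.logOneAdd (fun w => B w ζ₀) t * deriv C.toFun t) volume 0 1 :=
      C.intervalIntegrable_of_continuousOn
        ((C.continuousOn_comp hk).mul (C.continuousOn_logOneAdd hA0 hne)) (by simp) (by simp)
    have hi2 := C.intervalIntegrable (f := fun w => k w * lam w ζ) (hk.mul (hlamc hζ))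
    have hi3 := (C.intervalIntegrable hk).const_mul (-lam (C.toFun 0) ζ)
    have h3 : J ζ₀ + L ζ = J ζ₀ + L ζ + -lam (C.toFun 0) ζ * C.integral k := by
      rw [hk0, mul_zero, add_zero]
    rw [h3]
    simp only [hJ, hL, Contour.integral]
    rw [← intervalIntegral.integral_const_mul, ← intervalIntegral.integral_add hi1 hi2, ← intervalIntegral.integral_add (hi1.add hi2) hi3]
    refine intervalIntegral.integral_congr fun t ht => ?_
    rw [uIcc_of_le zero_le_one] at ht
    have := hl ht
    simp only [hlam]
    linear_combination (k (C.toFun t) * deriv C.toFun t) * this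
  have hb0 : b ζ₀ = E ζ₀ * Complex.exp (-((2 * Real.pi * Complex.I)⁻¹ * J ζ₀)) := hb.self_of_nhds
  have hexp : HasDerivAt (fun ζ => E ζ *
      Complex.exp (-((2 * Real.pi * Complex.I)⁻¹ * (J ζ₀ + L ζ)))) _ ζ₀ :=
    hE.mul (((hLd.const_add (J ζ₀)).const_mul (2 * Real.pi * Complex.I)⁻¹).neg.cexp)
  have hL0 : L ζ₀ = 0 := by
    have : ∀ w ∈ C.trace, k w * lam w ζ₀ = 0 := fun w hw => by
      simp [hlam]
    rw [hL]
    simp only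
    rw [C.integral_congr (g := fun _ => 0) this]
    simp [Contour.integral]
  refine (hexp.congr_of_eventuallyEq ?_).congr_deriv ?_
  · filter_upwards [hb, hJL] with ζ h1 h2
    rw [h1, ← h2]
  · rw [hb0, Pi.neg_apply, hL0, add_zero]
    ring

end XXZ

/-! ### The kernel `K` on a set whose differences avoid `±iγ` -/

namespace XXZ

open MeasureTheory Set Filter

section Kernel

variable {γ : ℝ}

lemma measurable_kernelK (γ : ℝ) : Measurable (kernelK γ) := by
  unfold kernelK
  fun_prop

lemma analyticAt_kernelK {z : ℂ} (h1 : Complex.sinh (z + Complex.I * γ) ≠ 0)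
    (h2 : Complex.sinh (z - Complex.I * γ) ≠ 0) : AnalyticAt ℂ (kernelK γ) z := by
  unfold kernelK
  refine AnalyticAt.sub (AnalyticAt.div ?_ ?_ h1) (AnalyticAt.div ?_ ?_ h2) <;>
    exact Differentiable.analyticAt (by fun_prop) z

lemma meromorphicAt_kernelK_comp (γ : ℝ) {α : ℂ → ℂ} (hα : Differentiable ℂ α) (z : ℂ) :
    MeromorphicAt (fun z => kernelK γ (α z)) z := by
  unfold kernelK
  refine MeromorphicAt.fun_sub (MeromorphicAt.fun_div ?_ ?_) (MeromorphicAt.fun_div ?_ ?_) <;>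
    exact (Differentiable.analyticAt (by fun_prop) z).meromorphicAt

lemma hasDerivAt_expPhase {z : ℂ} (h1 : Complex.sinh (z + Complex.I * γ) ≠ 0)
    (h2 : Complex.sinh (z - Complex.I * γ) ≠ 0) :
    HasDerivAt (expPhase γ) (kernelK γ z * expPhase γ z) z := by
  have e1 : Complex.I * γ + z = z + Complex.I * γ := add_comm _ _
  have e2 : Complex.sinh (Complex.I * γ - z) = -Complex.sinh (z - Complex.I * γ) := by
    rw [← Complex.sinh_neg, neg_sub]
  have e3 : Complex.cosh (Complex.I * γ - z) = Complex.cosh (z - Complex.I * γ) := by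
    rw [← Complex.cosh_neg, neg_sub]
  have h2' : Complex.sinh (Complex.I * γ - z) ≠ 0 := by rwa [e2, neg_ne_zero]
  refine ((((hasDerivAt_id' z).const_add (Complex.I * γ)).csinh).div
    (((hasDerivAt_id' z).const_sub (Complex.I * γ)).csinh) h2').congr_deriv ?_
  simp only [kernelK, expPhase, e1, e2, e3]
  field_simp
  ring

lemma expPhase_ne_zero {z : ℂ} (h1 : Complex.sinh (z + Complex.I * γ) ≠ 0)
    (h2 : Complex.sinh (z - Complex.I * γ) ≠ 0) : expPhase γ z ≠ 0 := by
  refine div_ne_zero (by rwa [add_comm]) ?_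
  rwa [← neg_ne_zero, ← Complex.sinh_neg, neg_sub]

variable {U : Set ℂ}

lemma sinh_sub_sub_ne_zero {z w : ℂ}
    (h : Complex.sinh (w - z + Complex.I * γ) ≠ 0) : Complex.sinh (z - w - Complex.I * γ) ≠ 0 := by
  rw [← neg_ne_zero, ← Complex.sinh_neg]
  convert h using 2
  ring

lemma analyticAt_kernelK_sub
    (hU : ∀ z ∈ U, ∀ w ∈ U, Complex.sinh (z - w + Complex.I * γ) ≠ 0) {z w : ℂ} (hz : z ∈ U)
    (hw : w ∈ U) : AnalyticAt ℂ (kernelK γ) (z - w) :=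
  analyticAt_kernelK (hU z hz w hw) (sinh_sub_sub_ne_zero (hU w hw z hz))

lemma exists_kernelK_bound
    (hU : ∀ z ∈ U, ∀ w ∈ U, Complex.sinh (z - w + Complex.I * γ) ≠ 0) (hUc : IsCompact U) :
    ∃ B, ∀ z ∈ U, ∀ w ∈ U, ‖kernelK γ (z - w)‖ ≤ B := by
  obtain ⟨B, hB⟩ := (hUc.prod hUc).exists_bound_of_continuousOn
    (f := fun p : ℂ × ℂ => kernelK γ (p.1 - p.2)) fun p hp =>
      (ContinuousAt.comp (g := kernelK γ) (f := fun p : ℂ × ℂ => p.1 - p.2)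
        (analyticAt_kernelK_sub hU hp.1 hp.2).continuousAt (by fun_prop)).continuousWithinAt
  exact ⟨B, fun z hz w hw => hB (z, w) ⟨hz, hw⟩⟩

lemma analyticAt_kernelK_comp
    (hU : ∀ z ∈ U, ∀ w ∈ U, Complex.sinh (z - w + Complex.I * γ) ≠ 0) {α β : ℂ → ℂ} {z : ℂ}
    (hα : AnalyticAt ℂ α z) (hβ : AnalyticAt ℂ β z) (hz : α z ∈ U) (hw : β z ∈ U) :
    AnalyticAt ℂ (fun z => kernelK γ (α z - β z)) z :=
  AnalyticAt.comp (g := kernelK γ) (f := fun z => α z - β z)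
    (analyticAt_kernelK_sub hU hz hw) (hα.sub hβ)

lemma integral_kernelK_sub
    (hU : ∀ z ∈ U, ∀ w ∈ U, Complex.sinh (z - w + Complex.I * γ) ≠ 0) {C : Contour}
    (hC : C.hull ⊆ U) {z : ℂ} (hz : z ∈ U) : C.integral (fun η => kernelK γ (z - η)) = 0 :=
  Contour.integral_eq_zero (fun _ => meromorphicAt_kernelK_comp γ (by fun_prop) _) fun _ hη =>
    analyticAt_kernelK_comp hU analyticAt_const analyticAt_id hz (hC hη)

lemma integral_kernelK_mul_kernelK
    (hU : ∀ z ∈ U, ∀ w ∈ U, Complex.sinh (z - w + Complex.I * γ) ≠ 0) {C : Contour}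
    (hC : C.hull ⊆ U) {z w : ℂ} (hz : z ∈ U) (hw : w ∈ U) :
    C.integral (fun η => kernelK γ (z - η) * kernelK γ (η - w)) = 0 :=
  Contour.integral_eq_zero (fun _ => (meromorphicAt_kernelK_comp γ (by fun_prop) _).fun_mul
      (meromorphicAt_kernelK_comp γ (by fun_prop) _)) fun _ hη =>
    (analyticAt_kernelK_comp hU analyticAt_const analyticAt_id hz (hC hη)).fun_mul
      (analyticAt_kernelK_comp hU analyticAt_id analyticAt_const (hC hη) hw)

/-- For functions with values in the range of `K`, the integral against `K` vanishes. -/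
lemma integral_kernelK_mul_range
    (hU : ∀ z ∈ U, ∀ w ∈ U, Complex.sinh (z - w + Complex.I * γ) ≠ 0) (hUc : IsCompact U)
    {C : Contour} (hC : C.hull ⊆ U) {ψ : ℂ → ℂ} (hψ : ContinuousOn ψ C.trace) {g : ℂ → ℂ} {w : ℂ}
    (hw : w ∈ U) (b : ℂ)
    (hg : ∀ η ∈ C.trace, g η = kernelK γ (η - w) + b * C.integral fun μ => kernelK γ (η - μ) * ψ μ) :
    BddMeas (fun t => g (C.extend t)) ∧
      ∀ z ∈ U, C.integral (fun η => kernelK γ (z - η) * g η) = 0 := by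
  set ν := volume.restrict (Icc (0 : ℝ) 1) with hν
  obtain ⟨B, hB⟩ := exists_kernelK_bound hU hUc
  have hmem : ∀ t, C.extend t ∈ U := fun t => hC (C.trace_subset_hull (C.extend_mem_trace t))
  have hm := C.measurable_extend
  have hw1 : BddMeas (C.weight fun _ => 1) := C.bddMeas_weight continuousOn_const
  have hw2 : BddMeas (C.weight ψ) := C.bddMeas_weight hψ
  have hK1 : ∀ z ∈ U, BddMeas fun t => kernelK γ (z - C.extend t) := fun z hz =>
    ⟨(measurable_kernelK γ).comp (hm.const_sub z), B, fun t => hB _ hz _ (hmem t)⟩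
  have hK2 : ∀ w ∈ U, BddMeas fun t => kernelK γ (C.extend t - w) := fun z hz =>
    ⟨(measurable_kernelK γ).comp (hm.sub_const z), B, fun t => hB _ (hmem t) _ hz⟩
  have hK3 : BddMeas fun p : ℝ × ℝ => kernelK γ (C.extend p.1 - C.extend p.2) :=
    ⟨(measurable_kernelK γ).comp ((hm.comp measurable_fst).sub (hm.comp measurable_snd)), B,
      fun p => hB _ (hmem _) _ (hmem _)⟩
  have hF : BddMeas fun p : ℝ × ℝ => kernelK γ (C.extend p.1 - C.extend p.2) * C.weight ψ p.2 :=
    hK3.mul (hw2.comp measurable_snd)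
  have hg' : ∀ t, g (C.extend t) = kernelK γ (C.extend t - w) +
      b * ∫ s, kernelK γ (C.extend t - C.extend s) * C.weight ψ s ∂ν := fun t => by
    rw [hg _ (C.extend_mem_trace t),
      ← C.integral_extend_mul_weight (fun μ => kernelK γ (C.extend t - μ))]
  have hI := hF.integral_right (f := fun t s =>
    kernelK γ (C.extend t - C.extend s) * C.weight ψ s) ν
  refine ⟨?_, fun z hz => ?_⟩
  · rw [funext hg']
    exact (hK2 w hw).add ((BddMeas.const b).mul hI)
  · have h1 : C.integral (fun η => kernelK γ (z - η) * g η) =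
        ∫ t, (kernelK γ (z - C.extend t) * g (C.extend t)) * C.weight (fun _ => 1) t ∂ν := by
      rw [C.integral_extend_mul_weight (fun η => kernelK γ (z - η) * g η)]
      simp only [mul_one]
    have h2 : ∀ t, (kernelK γ (z - C.extend t) * g (C.extend t)) * C.weight (fun _ => 1) t =
        kernelK γ (z - C.extend t) * kernelK γ (C.extend t - w) * C.weight (fun _ => 1) t +
        b * ∫ s, (kernelK γ (z - C.extend t) * kernelK γ (C.extend t - C.extend s) *
          C.weight (fun _ => 1) t) * C.weight ψ s ∂ν := fun t => by
      have : ∫ s, (kernelK γ (z - C.extend t) * kernelK γ (C.extend t - C.extend s) *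
          C.weight (fun _ => 1) t) * C.weight ψ s ∂ν =
          (kernelK γ (z - C.extend t) * C.weight (fun _ => 1) t) *
            ∫ s, kernelK γ (C.extend t - C.extend s) * C.weight ψ s ∂ν := by
        rw [← integral_const_mul]
        exact integral_congr_ae (.of_forall fun s => by ring)
      rw [this, hg']
      ring
    have hF2 : BddMeas fun p : ℝ × ℝ => (kernelK γ (z - C.extend p.1) *
        kernelK γ (C.extend p.1 - C.extend p.2) * C.weight (fun _ => 1) p.1) * C.weight ψ p.2 :=
      ((((hK1 z hz).comp measurable_fst).mul hK3).mul (hw1.comp measurable_fst)).mul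
        (hw2.comp measurable_snd)
    rw [h1]
    simp only [h2]
    rw [integral_add ((((hK1 z hz).mul (hK2 w hw)).mul hw1).integrable _)
      (((BddMeas.const b).mul (hF2.integral_right (f := fun t s => (kernelK γ (z - C.extend t) *
        kernelK γ (C.extend t - C.extend s) * C.weight (fun _ => 1) t) * C.weight ψ s)
        ν)).integrable _), integral_const_mul, integral_integral_swap (hF2.integrable _)]
    -- After Fubini each slice is the integral over `η` of `K(z - η) K(η - w)`, whose integrand is
    -- analytic on the hull.
    have h3 : ∀ {w : ℂ}, w ∈ U → ∫ t, kernelK γ (z - C.extend t) * kernelK γ (C.extend t - w) *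
        C.weight (fun _ => 1) t ∂ν = 0 := fun {w} hw => by
      rw [C.integral_extend_mul_weight (fun η => kernelK γ (z - η) * kernelK γ (η - w))]
      simpa only [mul_one] using integral_kernelK_mul_kernelK hU hC hz hw
    rw [h3 hw]
    simp only [integral_mul_const, h3 (hmem _), zero_mul, integral_zero, mul_zero, add_zero]

end Kernel

end XXZ

/-! ### Moving a single hole or particle -/

namespace XXZ

open MeasureTheory Set Filter

section Perturb

variable {nh np : ℕ}

/-- The parameters `(x, y)` with one of them replaced by `ζ`. -/
def perturb (x : Fin nh → ℂ) (y : Fin np → ℂ) :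
    Fin nh ⊕ Fin np → ℂ → (Fin nh → ℂ) × (Fin np → ℂ)
  | .inl k, ζ => (Function.update x k ζ, y)
  | .inr k, ζ => (x, Function.update y k ζ)

/-- The sign with which the bare phase of a hole or of a particle is counted. -/
def chargeSign (nh np : ℕ) : Fin nh ⊕ Fin np → ℂ := Sum.elim (fun _ => -1) fun _ => 1

lemma chargeSign_mul_self (i : Fin nh ⊕ Fin np) : chargeSign nh np i * chargeSign nh np i = 1 := by
  rcases i with i | i <;> simp [chargeSign]

variable (x : Fin nh → ℂ) (y : Fin np → ℂ)

lemma perturb_self (i : Fin nh ⊕ Fin np) : perturb x y i (Sum.elim x y i) = (x, y) := by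
  rcases i with i | i <;> simp [perturb]

lemma analyticAt_update {n : ℕ} (x : Fin n → ℂ) (k : Fin n) (ζ : ℂ) :
    AnalyticAt ℂ (Function.update x k) ζ := by
  rw [analyticAt_pi_iff]
  intro j
  rcases eq_or_ne j k with rfl | h
  · simp only [Function.update_self]
    exact analyticAt_id
  · simpa [h] using analyticAt_const

lemma analyticAt_perturb (i : Fin nh ⊕ Fin np) (ζ : ℂ) : AnalyticAt ℂ (perturb x y i) ζ := by
  rcases i with i | i
  · exact (analyticAt_update x i ζ).prod analyticAt_const
  · exact analyticAt_const.prod (analyticAt_update y i ζ)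

lemma prod_comp_update {n : ℕ} (g : ℂ → ℂ) (x : Fin n → ℂ) (k : Fin n) (ζ : ℂ) :
    ∏ j, g (Function.update x k ζ j) = g ζ * ∏ j ∈ Finset.univ \ {k}, g (x j) := by
  rw [← Finset.prod_update_of_mem (Finset.mem_univ k)]
  refine Finset.prod_congr rfl fun j _ => ?_
  rcases eq_or_ne j k with rfl | h <;> simp [*]

/-- The derivative of the driving term of the nonlinear integral equation with respect to the
position of a hole or particle. -/
lemma hasDerivAt_driving {γ : ℝ} {z : ℂ} (i : Fin nh ⊕ Fin np) (c : ℂ)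
    (h1 : Complex.sinh (z - Sum.elim x y i + Complex.I * γ) ≠ 0)
    (h2 : Complex.sinh (z - Sum.elim x y i - Complex.I * γ) ≠ 0) :
    HasDerivAt (fun ζ => c * (∏ j, expPhase γ (z - (perturb x y i ζ).1 j)) *
        (∏ k, expPhase γ (z - (perturb x y i ζ).2 k))⁻¹)
      (chargeSign nh np i * kernelK γ (z - Sum.elim x y i) *
        (c * (∏ j, expPhase γ (z - (perturb x y i (Sum.elim x y i)).1 j)) *
        (∏ k, expPhase γ (z - (perturb x y i (Sum.elim x y i)).2 k))⁻¹)) (Sum.elim x y i) := by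
  -- The inner derivative `-1` gives the sign of a hole; for a particle the phase is inverted, and
  -- the logarithmic derivative changes sign once more.
  have h := (hasDerivAt_expPhase h1 h2).comp (h := fun ζ => z - ζ) (Sum.elim x y i)
    ((hasDerivAt_id' _).const_sub z)
  rcases i with i | i
  · simp only [Sum.elim_inl] at h
    simp only [perturb, chargeSign, Sum.elim_inl, prod_comp_update fun w => expPhase γ (z - w)]
    refine (((h.mul_const _).const_mul c).mul_const _).congr_deriv ?_
    ring
  · simp only [Sum.elim_inr] at h h1 h2
    simp only [perturb, chargeSign, Sum.elim_inr, prod_comp_update fun w => expPhase γ (z - w),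
      mul_inv]
    have hne := expPhase_ne_zero h1 h2
    refine (((h.inv hne).mul_const _).const_mul _).congr_deriv ?_
    simp only [Function.comp_apply]
    field_simp

end Perturb

section LinearEquation

variable {γ : ℝ} {κ : ℂ} {N nh np : ℕ} {s : ℤ} {νo νe : Fin (N + 1) → ℂ} {C : Contour}
  {x : Fin nh → ℂ} {y : Fin np → ℂ} {A : ℂ → (Fin nh → ℂ) → (Fin np → ℂ) → ℂ}

lemma eventually_mem_nlieDomain {z : ℂ} (hz : z ∈ nlieDomain γ νo νe C y) :
    ∀ᶠ v in 𝓝 y, z ∈ nlieDomain γ νo νe C v := by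
  obtain ⟨h1, h2, h3, h4⟩ := hz
  have : ∀ᶠ v : Fin np → ℂ in 𝓝 y, ∀ k, Complex.sinh (Complex.I * γ + (z - v k)) ≠ 0 := by
    refine eventually_all.2 fun k => ContinuousAt.eventually_ne ?_ (h4 k)
    exact (Complex.continuous_sinh.comp (by fun_prop :
      Continuous fun v : Fin np → ℂ => Complex.I * γ + (z - v k))).continuousAt
  filter_upwards [this] with v hv using ⟨h1, h2, h3, hv⟩

lemma analyticAt_family (hA : IsSolutionFamily γ κ s νo νe C x y A) {z : ℂ}
    (hz : z ∈ nlieDomain γ νo νe C y) (i : Fin nh ⊕ Fin np) :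
    AnalyticAt ℂ (fun p : ℂ × ℂ => A p.1 (perturb x y i p.2).1 (perturb x y i p.2).2)
      (z, Sum.elim x y i) := by
  have h := hA.holomorphic z hz
  refine AnalyticAt.comp_of_eq (f := fun p : ℂ × ℂ => (p.1, perturb x y i p.2)) h
    (analyticAt_fst.prod ?_) (by rw [perturb_self])
  exact AnalyticAt.comp (g := perturb x y i) (f := fun p : ℂ × ℂ => p.2)
    (analyticAt_perturb x y i _) analyticAt_snd

/-- The derivatives of the solution with respect to the positions of the holes and particles
solve a linear integral equation. -/
theorem hasDerivAt_family (hA : IsSolutionFamily γ κ s νo νe C x y A)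
    (htr : C.trace ⊆ nlieDomain γ νo νe C y) {z : ℂ} (hz : z ∈ nlieDomain γ νo νe C y)
    (hk0 : C.integral (fun w => kernelK γ (z - w)) = 0) (i : Fin nh ⊕ Fin np)
    (h1 : Complex.sinh (z - Sum.elim x y i + Complex.I * γ) ≠ 0)
    (h2 : Complex.sinh (z - Sum.elim x y i - Complex.I * γ) ≠ 0) :
    HasDerivAt (fun ζ => A z (perturb x y i ζ).1 (perturb x y i ζ).2)
      (A z x y * (chargeSign nh np i * kernelK γ (z - Sum.elim x y i) -
        (2 * Real.pi * Complex.I)⁻¹ * C.integral fun w => kernelK γ (z - w) *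
          (deriv (fun ζ => A w (perturb x y i ζ).1 (perturb x y i ζ).2) (Sum.elim x y i) /
            (1 + A w x y)))) (Sum.elim x y i) := by
  have hp := perturb_self x y i
  have hcont := (analyticAt_perturb x y i (Sum.elim x y i)).continuousAt
  rw [ContinuousAt, hp] at hcont
  have hsol := hcont.eventually hA.solves
  have hdom := (hcont.snd_nhds).eventually (eventually_mem_nlieDomain hz)
  have key := hasDerivAt_of_nlie (C := C)
    (B := fun w ζ => A w (perturb x y i ζ).1 (perturb x y i ζ).2) (ζ₀ := Sum.elim x y i)
    (k := fun w => kernelK γ (z - w)) (b := fun ζ => A z (perturb x y i ζ).1 (perturb x y i ζ).2)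
    (fun w hw => analyticAt_family hA (htr hw) i)
    (fun w hw => by simpa only [hp] using hA.solves.self_of_nhds.ne_zero w hw)
    (fun w hw => ?_) hk0
    (hasDerivAt_driving x y i ((-1) ^ s * expDriving γ κ νo νe z) h1 h2) ?_
  · simpa only [hp] using key
  · have h := hz.1 w (C.trace_subset_hull hw)
    exact (ContinuousAt.comp (g := kernelK γ) (f := fun w => z - w)
      (analyticAt_kernelK h.1 h.2).continuousAt (by fun_prop)).continuousWithinAt
  · filter_upwards [hsol, hdom] with ζ h3 h4 using h3.equation z h4

end LinearEquation

end XXZ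

/-! ### The dressed functions and the Jacobian -/

namespace XXZ

open MeasureTheory Set Filter

lemma Contour.weight_eq_mul (C : Contour) (ρ : ℂ → ℂ) (t : ℝ) :
    C.weight ρ t = ρ (C.extend t) * C.weight (fun _ => 1) t := by
  by_cases ht : t ∈ Icc (0 : ℝ) 1
  · simp [weight, ht, C.extend_of_mem ht]
  · simp [weight, ht]

section Dressed

variable {γ : ℝ} {κ : ℂ} {N nh np : ℕ} {s : ℤ} {νo νe : Fin (N + 1) → ℂ} {C : Contour}
  {x : Fin nh → ℂ} {y : Fin np → ℂ} {A : ℂ → (Fin nh → ℂ) → (Fin np → ℂ) → ℂ} {U : Set ℂ}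

/-- The logarithmic derivatives of the solution with respect to the positions of the holes and
particles are, up to a sign, solutions of a linear integral equation with measure `dm_0`. -/
theorem exists_dressed (hA : IsSolutionFamily γ κ s νo νe C x y A)
    (hU : ∀ z ∈ U, ∀ w ∈ U, Complex.sinh (z - w + Complex.I * γ) ≠ 0) (hUc : IsCompact U)
    (hC : C.hull ⊆ U) (hxyU : ∀ i, Sum.elim x y i ∈ U) (htr : C.trace ⊆ nlieDomain γ νo νe C y) :
    ∃ H : Fin nh ⊕ Fin np → ℂ → ℂ, (∀ i, BddMeas fun t => H i (C.extend t)) ∧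
      (∀ i, ∀ z ∈ U, H i z = kernelK γ (z - Sum.elim x y i) +
        ∫ t, kernelK γ (z - C.extend t) * C.weight (densityM0 fun z => A z x y) t *
          H i (C.extend t) ∂volume.restrict (Icc (0 : ℝ) 1)) ∧
      ∀ i, ∀ z ∈ U, z ∈ nlieDomain γ νo νe C y →
        HasDerivAt (fun ζ => A z (perturb x y i ζ).1 (perturb x y i ζ).2)
          (A z x y * (chargeSign nh np i * H i z)) (Sum.elim x y i) := by
  set ν := volume.restrict (Icc (0 : ℝ) 1) with hν
  have h2πi : (2 * Real.pi * Complex.I : ℂ) ≠ 0 := by simp [Real.pi_ne_zero]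
  have hne : ∀ w ∈ C.trace, 1 + A w x y ≠ 0 := hA.solves.self_of_nhds.ne_zero
  have hmem : ∀ t, C.extend t ∈ U := fun t => hC (C.trace_subset_hull (C.extend_mem_trace t))
  set D : Fin nh ⊕ Fin np → ℂ → ℂ := fun i w =>
    deriv (fun ζ => A w (perturb x y i ζ).1 (perturb x y i ζ).2) (Sum.elim x y i) with hD
  set ψ : Fin nh ⊕ Fin np → ℂ → ℂ := fun i w =>
    chargeSign nh np i * (D i w / (1 + A w x y)) with hψ
  set H : Fin nh ⊕ Fin np → ℂ → ℂ := fun i z => kernelK γ (z - Sum.elim x y i) +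
    -(2 * Real.pi * Complex.I)⁻¹ * C.integral fun μ => kernelK γ (z - μ) * ψ i μ with hH
  have hcA : ContinuousOn (fun w => A w x y) C.trace := fun w hw =>
    (hA.solves.self_of_nhds.analytic w hw).continuousAt.continuousWithinAt
  have hcψ : ∀ i, ContinuousOn (ψ i) C.trace := by
    intro i
    refine continuousOn_const.mul (ContinuousOn.div ?_ (continuousOn_const.add hcA) hne)
    intro w hw
    refine ContinuousAt.continuousWithinAt ?_
    have h1 := analyticAt_family hA (htr hw) i
    have h2 : ContinuousAt (fun w => fderiv ℂ (fun p : ℂ × ℂ => A p.1 (perturb x y i p.2).1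
        (perturb x y i p.2).2) (w, Sum.elim x y i) (0, 1)) w :=
      ContinuousAt.comp (f := fun w => (w, Sum.elim x y i))
        (continuousAt_fderiv_apply h1 (0, 1)) (by fun_prop)
    refine h2.congr ?_
    have h3 : ∀ᶠ w in 𝓝 w, AnalyticAt ℂ (fun p : ℂ × ℂ => A p.1 (perturb x y i p.2).1
        (perturb x y i p.2).2) (w, Sum.elim x y i) :=
      (by fun_prop : ContinuousAt (fun w => (w, Sum.elim x y i)) w).eventually
        h1.eventually_analyticAt
    filter_upwards [h3] with w hw
    exact (hasDerivAt_snd (B := fun w ζ => A w (perturb x y i ζ).1 (perturb x y i ζ).2)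
      hw).deriv.symm
  have hd : ∀ i, ∀ z ∈ U, z ∈ nlieDomain γ νo νe C y →
      HasDerivAt (fun ζ => A z (perturb x y i ζ).1 (perturb x y i ζ).2)
        (A z x y * (chargeSign nh np i * H i z)) (Sum.elim x y i) := by
    intro i z hz hz'
    refine (hasDerivAt_family hA htr hz' (integral_kernelK_sub hU hC hz) i (hU _ hz _ (hxyU i))
      (sinh_sub_sub_ne_zero (hU _ (hxyU i) _ hz))).congr_deriv ?_
    have h1 : C.integral (fun μ => kernelK γ (z - μ) * ψ i μ) = chargeSign nh np i *
        C.integral fun w => kernelK γ (z - w) * (D i w / (1 + A w x y)) := by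
      rw [← C.integral_const_mul]
      exact C.integral_congr fun w _ => by simp only [hψ]; ring
    simp only [hH, h1, hD]
    linear_combination (A z x y * (2 * Real.pi * Complex.I)⁻¹ *
      C.integral fun w => kernelK γ (z - w) * (D i w / (1 + A w x y))) * chargeSign_mul_self i
  have hrange := fun i => integral_kernelK_mul_range hU hUc hC (hcψ i) (g := H i) (hxyU i)
    (-(2 * Real.pi * Complex.I)⁻¹) fun η _ => rfl
  refine ⟨H, fun i => (hrange i).1, fun i z hz => ?_, hd⟩
  -- On the contour `ψ = H A / (1 + A)`, where the two signs cancel, and `A / (1 + A) = 1 - 1 / (1 +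
  -- A)`. The first part integrates to zero against `K`, and the second is the measure `dm_0`.
  have hψH : ∀ w ∈ C.trace, ψ i w =
      H i w - (2 * Real.pi * Complex.I) * (densityM0 (fun z => A z x y) w * H i w) := by
    intro w hw
    have h1 := (hd i w (hC (C.trace_subset_hull hw)) (htr hw)).deriv
    have h2 := hne w hw
    simp only [hψ, hD, h1, densityM0]
    field_simp
    linear_combination (A w x y * H i w) * chargeSign_mul_self i
  obtain ⟨B, hB⟩ := exists_kernelK_bound hU hUc
  have hK : BddMeas fun t => kernelK γ (z - C.extend t) :=
    ⟨(measurable_kernelK γ).comp (C.measurable_extend.const_sub z), B, fun t => hB _ hz _ (hmem t)⟩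
  have hρ : ContinuousOn (densityM0 fun z => A z x y) C.trace := by
    unfold densityM0
    exact continuousOn_const.div (continuousOn_const.mul (continuousOn_const.add hcA)) fun w hw =>
      mul_ne_zero h2πi (hne w hw)
  have hw1 : BddMeas (C.weight fun _ => 1) := C.bddMeas_weight continuousOn_const
  have h1 : C.integral (fun μ => kernelK γ (z - μ) * ψ i μ) =
      ∫ t, (kernelK γ (z - C.extend t) * H i (C.extend t) * C.weight (fun _ => 1) t -
        2 * Real.pi * Complex.I * (kernelK γ (z - C.extend t) *
          C.weight (densityM0 fun z => A z x y) t * H i (C.extend t))) ∂ν := by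
    rw [← C.integral_extend_mul_weight (fun μ => kernelK γ (z - μ))]
    refine integral_congr_ae (.of_forall fun t => ?_)
    simp only [C.weight_eq_mul (ψ i), C.weight_eq_mul (densityM0 fun z => A z x y),
      hψH _ (C.extend_mem_trace t)]
    ring
  have h2 : ∫ t, kernelK γ (z - C.extend t) * H i (C.extend t) * C.weight (fun _ => 1) t ∂ν = 0 := by
    rw [C.integral_extend_mul_weight (fun μ => kernelK γ (z - μ) * H i μ)]
    simpa only [mul_one] using (hrange i).2 z hz
  rw [integral_sub (((hK.mul (hrange i).1).mul hw1).integrable _)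
    (((BddMeas.const _).mul ((hK.mul (C.bddMeas_weight hρ)).mul (hrange i).1)).integrable _), h2,
    integral_const_mul] at h1
  conv_lhs => simp only [hH]
  rw [h1, zero_sub, neg_mul_neg, inv_mul_cancel_left₀ h2πi]

end Dressed

section Jacobian

variable {γ : ℝ} {κ : ℂ} {N M nh np : ℕ} {s : ℤ} {νo νe : Fin (N + 1) → ℂ} {C : Contour}
  {rt : Fin M → ℂ} {x : Fin nh → ℂ} {y : Fin np → ℂ}
  {A : ℂ → (Fin nh → ℂ) → (Fin np → ℂ) → ℂ} {U : Set ℂ}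

/-- Away from the zeros of `den` on the hulls the driving terms are regular, so both the reference
contour and the holes and particles lie in the domain of the nonlinear integral equation. -/
lemma mem_nlieDomain (hU : ∀ z ∈ U, ∀ w ∈ U, Complex.sinh (z - w + Complex.I * γ) ≠ 0)
    (hC : C.hull ⊆ U) (hyU : ∀ k, y k ∈ U) {z : ℂ} (hz : z ∈ U)
    (h0 : auxDen γ νo νe rt z ≠ 0) : z ∈ nlieDomain γ νo νe C y := by
  have h1 := Finset.prod_ne_zero_iff.1 (left_ne_zero_of_mul h0)
  refine ⟨fun w hw => ⟨hU z hz w (hC hw), sinh_sub_sub_ne_zero (hU w (hC hw) z hz)⟩,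
    fun k => ?_, fun k => left_ne_zero_of_mul (h1 k (Finset.mem_univ k)), fun k => ?_⟩
  · rw [← neg_ne_zero, ← Complex.sinh_neg, neg_sub]
    exact right_ne_zero_of_mul (h1 k (Finset.mem_univ k))
  · rw [add_comm]
    exact hU z hz _ (hyU k)

lemma eventually_sinh_ne_zero {α : Type*} [TopologicalSpace α] {f : α → ℂ} (hf : Continuous f)
    {z : α} (h : Complex.sinh (f z) ≠ 0) : ∀ᶠ z in 𝓝 z, Complex.sinh (f z) ≠ 0 :=
  ContinuousAt.eventually_ne (g := fun z => Complex.sinh (f z))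
    (Complex.continuous_sinh.comp hf).continuousAt h

lemma nlieDomain_mem_nhds {z : ℂ} (hz : z ∈ nlieDomain γ νo νe C y) :
    nlieDomain γ νo νe C y ∈ 𝓝 z := by
  have h1 : ∀ᶠ z in 𝓝 z, ∀ w ∈ C.hull, Complex.sinh (z - w + Complex.I * γ) ≠ 0 ∧
      Complex.sinh (z - w - Complex.I * γ) ≠ 0 :=
    C.isCompact_hull.eventually_forall_of_forall_eventually
      (P := fun z w => Complex.sinh (z - w + Complex.I * γ) ≠ 0 ∧
        Complex.sinh (z - w - Complex.I * γ) ≠ 0) fun w hw =>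
      (eventually_sinh_ne_zero (f := fun p : ℂ × ℂ => p.1 - p.2 + Complex.I * γ) (by fun_prop)
        (hz.1 w hw).1).and
      (eventually_sinh_ne_zero (f := fun p : ℂ × ℂ => p.1 - p.2 - Complex.I * γ) (by fun_prop)
        (hz.1 w hw).2)
  filter_upwards [h1,
    eventually_all.2 fun k => eventually_sinh_ne_zero (f := fun z => z - νe k) (by fun_prop)
      (hz.2.1 k),
    eventually_all.2 fun k => eventually_sinh_ne_zero (f := fun z => z - νo k - Complex.I * γ)
      (by fun_prop) (hz.2.2.1 k),
    eventually_all.2 fun k => eventually_sinh_ne_zero (f := fun z => Complex.I * γ + (z - y k))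
      (by fun_prop) (hz.2.2.2 k)] with z h1 h2 h3 h4
    using ⟨h1, h2, h3, h4⟩

lemma jacobian_apply (A : ℂ → (Fin nh → ℂ) → (Fin np → ℂ) → ℂ) (x : Fin nh → ℂ) (y : Fin np → ℂ)
    (i k : Fin nh ⊕ Fin np) : jacobian A x y i k =
      deriv (fun ζ => A (Sum.elim (perturb x y k ζ).1 (perturb x y k ζ).2 i) (perturb x y k ζ).1
        (perturb x y k ζ).2) (Sum.elim x y k) := by
  rcases i with i | i <;> rcases k with k | k <;> rfl

/-- Chain rule: the `k`-th parameter enters through the evaluation point, only if `i = k`, and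
through the parameters of the solution. -/
lemma jacobian_eq_add (hA : IsSolutionFamily γ κ s νo νe C x y A) {f : ℂ → ℂ}
    (hf : ∀ z ∈ nlieDomain γ νo νe C y, A z x y = f z)
    (i k : Fin nh ⊕ Fin np) (hz : Sum.elim x y i ∈ nlieDomain γ νo νe C y) :
    jacobian A x y i k = (1 : Matrix _ _ ℂ) i k * deriv f (Sum.elim x y i) +
      deriv (fun ζ => A (Sum.elim x y i) (perturb x y k ζ).1 (perturb x y k ζ).2)
        (Sum.elim x y k) := by
  have h := analyticAt_family hA hz k
  set G := fun p : ℂ × ℂ => A p.1 (perturb x y k p.2).1 (perturb x y k p.2).2 with hG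
  have hc : HasDerivAt (fun ζ => Sum.elim (perturb x y k ζ).1 (perturb x y k ζ).2 i)
      ((1 : Matrix _ _ ℂ) i k) (Sum.elim x y k) := by
    by_cases hik : i = k
    · subst hik
      rw [Matrix.one_apply_eq]
      refine (hasDerivAt_id' (Sum.elim x y i)).congr_of_eventuallyEq (.of_forall fun ζ => ?_)
      rcases i with i | i <;> simp [perturb]
    · rw [Matrix.one_apply_ne hik]
      refine (hasDerivAt_const _ (Sum.elim x y i)).congr_of_eventuallyEq (.of_forall fun ζ => ?_)
      rcases i with i | i <;> rcases k with k | k <;>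
        simp_all [perturb]
  have h0 : Sum.elim (perturb x y k (Sum.elim x y k)).1 (perturb x y k (Sum.elim x y k)).2 i =
      Sum.elim x y i := by rw [perturb_self]
  have h1 : HasFDerivAt G (fderiv ℂ G (Sum.elim x y i, Sum.elim x y k))
      (Sum.elim (perturb x y k (Sum.elim x y k)).1 (perturb x y k (Sum.elim x y k)).2 i,
        Sum.elim x y k) := by
    rw [h0]
    exact h.differentiableAt.hasFDerivAt
  have h2 := h1.comp_hasDerivAt (f := fun ζ =>
    (Sum.elim (perturb x y k ζ).1 (perturb x y k ζ).2 i, ζ)) (Sum.elim x y k)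
    (hc.prodMk (hasDerivAt_id' _))
  have h3 := hasDerivAt_fst (B := fun w ζ => A w (perturb x y k ζ).1 (perturb x y k ζ).2) h
  have h4 := hasDerivAt_snd (B := fun w ζ => A w (perturb x y k ζ).1 (perturb x y k ζ).2) h
  -- The solution and `f` agree on the domain, which is a neighbourhood of the point, so their
  -- derivatives in the first argument agree as well.
  have h5 : deriv f (Sum.elim x y i) =
      fderiv ℂ G (Sum.elim x y i, Sum.elim x y k) (1, 0) := by
    rw [← h3.deriv]
    refine Filter.EventuallyEq.deriv_eq ?_
    filter_upwards [nlieDomain_mem_nhds hz] with w hw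
    rw [perturb_self, hf w hw]
  rw [jacobian_apply, h5]
  refine h2.deriv.trans ?_
  rw [h4.deriv, ← smul_eq_mul, ← map_smul, ← map_add]
  simp

end Jacobian

end XXZ

/-! ### The quotient of the two Fredholm determinants, and the conclusion -/

namespace XXZ

open MeasureTheory Set Filter

section Kernel

variable {γ : ℝ} {U : Set ℂ}

lemma measurable_kernelK_sub (γ : ℝ) : Measurable fun p : ℂ × ℂ => kernelK γ (p.1 - p.2) :=
  (measurable_kernelK γ).comp (measurable_fst.sub measurable_snd)

lemma differentiable_update {n : ℕ} (v : Fin n → ℂ) (i a : Fin n) :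
    Differentiable ℂ fun ζ => Function.update v i ζ a := by
  rcases eq_or_ne a i with rfl | h
  · simp only [Function.update_self]
    fun_prop
  · simp only [Function.update_of_ne h]
    fun_prop

lemma meromorphicAt_det_kernelK (γ : ℝ) {n : ℕ} (v : Fin n → ℂ) (i : Fin n) (z : ℂ) :
    MeromorphicAt (fun ζ => (Matrix.of fun a b => -kernelK γ (Function.update v i ζ a -
      Function.update v i ζ b)).det) z := by
  simp only [Matrix.det_apply', Matrix.of_apply]
  refine MeromorphicAt.fun_sum fun σ _ => (MeromorphicAt.const _ _).fun_mul
    (MeromorphicAt.fun_prod fun a _ => MeromorphicAt.fun_neg ?_)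
  exact meromorphicAt_kernelK_comp γ
    ((differentiable_update v i _).sub (differentiable_update v i _)) z

/-- This and the preceding lemma make the determinant, in one variable with the others fixed, an
admissible test function for comparing `dm_0` on the two contours. -/
lemma analyticAt_det_kernelK
    (hU : ∀ z ∈ U, ∀ w ∈ U, Complex.sinh (z - w + Complex.I * γ) ≠ 0) {n : ℕ} {v : Fin n → ℂ}
    (hv : ∀ a, v a ∈ U) (i : Fin n) {z : ℂ} (hz : z ∈ U) :
    AnalyticAt ℂ (fun ζ => (Matrix.of fun a b => -kernelK γ (Function.update v i ζ a -
      Function.update v i ζ b)).det) z := by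
  have hmem : ∀ a, Function.update v i z a ∈ U := fun a => by
    rcases eq_or_ne a i with rfl | h <;> simp [*]
  simp only [Matrix.det_apply', Matrix.of_apply]
  refine Finset.analyticAt_fun_sum _ fun σ _ => analyticAt_const.fun_mul
    (Finset.analyticAt_fun_prod _ fun a _ => AnalyticAt.fun_neg ?_)
  exact analyticAt_kernelK_comp hU ((differentiable_update v i _).analyticAt z)
    ((differentiable_update v i _).analyticAt z) (hmem _) (hmem _)

lemma summable_fredholmTerm_kernelK
    (hU : ∀ z ∈ U, ∀ w ∈ U, Complex.sinh (z - w + Complex.I * γ) ≠ 0) (hUc : IsCompact U)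
    {C : Contour} (hC : C.hull ⊆ U) {ρ : ℂ → ℂ} (hρ : ContinuousOn ρ C.trace) :
    Summable (fredholmTerm C ρ fun z w => kernelK γ (z - w)) := by
  obtain ⟨B, hB⟩ := exists_kernelK_bound hU hUc
  rw [funext (fredholmTerm_eq_seriesTerm C ρ _)]
  exact summable_seriesTerm _ (measurable_kernelK_sub γ) hB C.measurable_extend
    (fun t => hC (C.trace_subset_hull (C.extend_mem_trace t))) (C.bddMeas_weight hρ)

end Kernel

section StateContour

variable {γ : ℝ} {κ : ℂ} {N M nh np : ℕ} {νo νe : Fin (N + 1) → ℂ} {rt : Fin M → ℂ}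
  {x : Fin nh → ℂ} {y : Fin np → ℂ} {Cn C0 : Contour}

lemma Contour.weight_congr (C : Contour) {ρ σ : ℂ → ℂ} (h : ∀ z ∈ C.trace, ρ z = σ z) :
    C.weight ρ = C.weight σ := by
  ext t
  rw [C.weight_eq_mul ρ, C.weight_eq_mul σ, h _ (C.extend_mem_trace t)]

/-- The Fredholm determinants on the contour of a state and on the reference contour. -/
theorem fredholmDet_eq_mul_det (hν : ∀ j k, Complex.sinh (νo j - νe k) ≠ 0)
    (hrt : IsBetheSolution γ κ νo νe rt)
    (hCn : IsStateContour γ κ νo νe rt Cn) (hC0 : HasStandardPoles γ νo νe rt C0)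
    (hshape : ∀ z ∈ Cn.hull ∪ C0.hull, ∀ w ∈ Cn.hull ∪ C0.hull,
      Complex.sinh (z - w + Complex.I * γ) ≠ 0)
    (hxy : AreHolesAndParticles γ κ νo νe rt C0 x y)
    (hx : ∀ j, deriv (aux γ κ νo νe rt) (x j) ≠ 0)
    (hy : ∀ j, deriv (aux γ κ νo νe rt) (y j) ≠ 0) {H : Fin nh ⊕ Fin np → ℂ → ℂ}
    (hHb : ∀ i, BddMeas fun t => H i (C0.extend t))
    (hH : ∀ i, ∀ z ∈ Cn.hull ∪ C0.hull, H i z = kernelK γ (z - Sum.elim x y i) +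
      ∫ t, kernelK γ (z - C0.extend t) * C0.weight (densityM0 (aux γ κ νo νe rt)) t *
        H i (C0.extend t) ∂volume.restrict (Icc (0 : ℝ) 1)) :
    fredholmDet Cn (densityM0 (aux γ κ νo νe rt)) (fun z w => kernelK γ (z - w)) =
      fredholmDet C0 (densityM0 (aux γ κ νo νe rt)) (fun z w => kernelK γ (z - w)) *
        (Matrix.of fun i k => (1 : Matrix (Fin nh ⊕ Fin np) (Fin nh ⊕ Fin np) ℂ) i k -
          chargeSign nh np k / deriv (aux γ κ νo νe rt) (Sum.elim x y k) *
            H k (Sum.elim x y i)).det := by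
  set a := aux γ κ νo νe rt with ha
  set U := Cn.hull ∪ C0.hull with hUdef
  have hUc : IsCompact U := Cn.isCompact_hull.union C0.isCompact_hull
  have hCnU : Cn.hull ⊆ U := subset_union_left
  have hC0U : C0.hull ⊆ U := subset_union_right
  have hzU : ∀ i, Sum.elim x y i ∈ U := by
    rintro (j | j)
    · exact hC0U (C0.inside_subset_hull (hole_mem hxy j).1)
    · exact hCnU (Cn.inside_subset_hull (particle_mem_inside hCn hxy j))
  have hcS : ∀ t, Cn.extend t ∈ U := fun t => hCnU (Cn.trace_subset_hull (Cn.extend_mem_trace t))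
  have hdS : ∀ t, C0.extend t ∈ U := fun t => hC0U (C0.trace_subset_hull (C0.extend_mem_trace t))
  obtain ⟨B, hB⟩ := exists_kernelK_bound hshape hUc
  set e : Fin nh ⊕ Fin np ≃ Fin (nh + np) := finSumFinEquiv
  have key := tsum_seriesTerm_eq_mul_det (volume.restrict (Icc (0 : ℝ) 1))
    (volume.restrict (Icc (0 : ℝ) 1)) (measurable_kernelK_sub γ) ⟨_, hcS 0⟩ hB
    Cn.measurable_extend C0.measurable_extend hcS hdS
    (Cn.bddMeas_weight (continuousOn_densityM0 hCn.1 fun z hz => hCn.aux_ne_neg_one hz))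
    (C0.bddMeas_weight (continuousOn_densityM0 hC0 hxy.1))
    (z := fun j => Sum.elim x y (e.symm j))
    (w := fun j => chargeSign nh np (e.symm j) / deriv a (Sum.elim x y (e.symm j)))
    (fun j => hzU _) (fun n i v hv => ?_) (h := fun j => H (e.symm j)) (fun j => hHb _)
    (fun j t => hH _ _ (hdS t)) (fun j i => hH _ _ (hzU _))
  · simp only [fredholmDet, fredholmTerm_eq_seriesTerm]
    rw [key, ← Matrix.det_submatrix_equiv_self e.symm]
    congr 2
    ext i j
    simp [Matrix.one_apply]
  · rw [Cn.integral_extend_mul_weight (fun ζ => (Matrix.of fun a b =>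
        -kernelK γ (Function.update v i ζ a - Function.update v i ζ b)).det),
      C0.integral_extend_mul_weight (fun ζ => (Matrix.of fun a b =>
        -kernelK γ (Function.update v i ζ a - Function.update v i ζ b)).det), ← sub_eq_iff_eq_add',
      integral_densityM0_sub hν hrt hCn hC0 hshape hxy hx hy (meromorphicAt_det_kernelK γ v i)
        fun z hz => analyticAt_det_kernelK hshape hv i hz, ← e.symm.sum_comp]
    exact Finset.sum_congr rfl fun j _ => mul_comm _ _

end StateContour

end XXZ

theorem mainTheorem5 (γ : ℝ) (hγ : 0 < γ ∧ γ ≤ Real.pi / 2) (κ : ℂ) (N M nh np : ℕ)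
    (νo νe : Fin (N + 1) → ℂ) (hν : ∀ j k, Complex.sinh (νo j - νe k) ≠ 0)
    (rt : Fin M → ℂ) (hrt : XXZ.IsBetheSolution γ κ νo νe rt)
    (Cn C0 : XXZ.Contour)
    (hCn : XXZ.IsStateContour γ κ νo νe rt Cn)
    (hC0 : XXZ.HasStandardPoles γ νo νe rt C0)
    (hshape : ∀ z ∈ Cn.hull ∪ C0.hull, ∀ w ∈ Cn.hull ∪ C0.hull,
      Complex.sinh (z - w + Complex.I * γ) ≠ 0)
    (x : Fin nh → ℂ) (y : Fin np → ℂ)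
    (hxy : XXZ.AreHolesAndParticles γ κ νo νe rt C0 x y)
    (hx : ∀ j, deriv (XXZ.aux γ κ νo νe rt) (x j) ≠ 0)
    (hy : ∀ j, deriv (XXZ.aux γ κ νo νe rt) (y j) ≠ 0)
    (A : ℂ → (Fin nh → ℂ) → (Fin np → ℂ) → ℂ)
    (hA : XXZ.IsSolutionFamily γ κ ((N : ℤ) + 1 - M) νo νe C0 x y A)
    (hAn : ∀ z ∈ XXZ.nlieDomain γ νo νe C0 y, A z x y = XXZ.aux γ κ νo νe rt z) :
    Summable (XXZ.fredholmTerm Cn (XXZ.densityM0 (XXZ.aux γ κ νo νe rt))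
      (fun z w => XXZ.kernelK γ (z - w))) ∧
    Summable (XXZ.fredholmTerm C0 (XXZ.densityM0 (XXZ.aux γ κ νo νe rt))
      (fun z w => XXZ.kernelK γ (z - w))) ∧
    XXZ.fredholmDet Cn (XXZ.densityM0 (XXZ.aux γ κ νo νe rt))
        (fun z w => XXZ.kernelK γ (z - w)) =
      XXZ.fredholmDet C0 (XXZ.densityM0 (XXZ.aux γ κ νo νe rt))
          (fun z w => XXZ.kernelK γ (z - w)) *
        (∏ j, 1 / deriv (XXZ.aux γ κ νo νe rt) (x j)) *
        (∏ j, 1 / deriv (XXZ.aux γ κ νo νe rt) (y j)) *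
        (XXZ.jacobian A x y).det := by
  open XXZ Set in
  set a := aux γ κ νo νe rt with ha
  set U := Cn.hull ∪ C0.hull with hUdef
  have hUc : IsCompact U := Cn.isCompact_hull.union C0.isCompact_hull
  have hCnU : Cn.hull ⊆ U := subset_union_left
  have hC0U : C0.hull ⊆ U := subset_union_right
  have hyU : ∀ k, y k ∈ U := fun k => hCnU (Cn.inside_subset_hull (particle_mem_inside hCn hxy k))
  have hzU : ∀ i, Sum.elim x y i ∈ U := by
    rintro (j | j)
    exacts [hC0U (C0.inside_subset_hull (hole_mem hxy j).1), hyU j]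
  have hap : ∀ i, a (Sum.elim x y i) = -1 := by
    rintro (j | j)
    exacts [(hole_mem hxy j).2.1, aux_particle hrt hxy j]
  have hap' : ∀ i, deriv a (Sum.elim x y i) ≠ 0 := by
    rintro (j | j)
    exacts [hx j, hy j]
  have htr : C0.trace ⊆ nlieDomain γ νo νe C0 y := fun z hz =>
    mem_nlieDomain hshape hC0U hyU (hC0U (C0.trace_subset_hull hz)) (auxDen_ne_zero_of_trace hC0 hz)
  have hzD : ∀ i, Sum.elim x y i ∈ nlieDomain γ νo νe C0 y := fun i =>
    mem_nlieDomain hshape hC0U hyU (hzU i) (auxDen_ne_zero_of_aux (hap i))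
  have hρn : ContinuousOn (densityM0 a) Cn.trace :=
    continuousOn_densityM0 hCn.1 fun z hz => hCn.aux_ne_neg_one hz
  have hρ0 : ContinuousOn (densityM0 a) C0.trace := continuousOn_densityM0 hC0 hxy.1
  refine ⟨summable_fredholmTerm_kernelK hshape hUc hCnU hρn,
    summable_fredholmTerm_kernelK hshape hUc hC0U hρ0, ?_⟩
  obtain ⟨H, hHb, hH, hHd⟩ := exists_dressed hA hshape hUc hC0U hzU htr
  -- The dressed functions were built with the density of the solution `A`, which on the reference
  -- contour coincides with that of `𝔞_n`.
  rw [C0.weight_congr (σ := densityM0 a) fun z hz => by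
    simp only [densityM0, hAn z (htr hz)]] at hH
  rw [fredholmDet_eq_mul_det hν hrt hCn hC0 hshape hxy hx hy hHb hH]
  -- Since `𝔞 = -1` at the holes and particles, the parameter derivative there is minus the signed
  -- dressed function; taking `𝔞'(z_k)` out of column `k` leaves the matrix of the quotient.
  have hJ : jacobian A x y = Matrix.of fun i k => deriv a (Sum.elim x y k) *
      (Matrix.of fun i k => (1 : Matrix (Fin nh ⊕ Fin np) (Fin nh ⊕ Fin np) ℂ) i k -
        chargeSign nh np k / deriv a (Sum.elim x y k) * H k (Sum.elim x y i)) i k := by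
    ext i k
    rw [jacobian_eq_add hA hAn i k (hzD i), (hHd k _ (hzU i) (hzD i)).deriv, hAn _ (hzD i), hap]
    have h1 : (1 : Matrix (Fin nh ⊕ Fin np) (Fin nh ⊕ Fin np) ℂ) i k * deriv a (Sum.elim x y i) =
        (1 : Matrix (Fin nh ⊕ Fin np) (Fin nh ⊕ Fin np) ℂ) i k * deriv a (Sum.elim x y k) := by
      rcases eq_or_ne i k with rfl | h
      · rfl
      · simp [Matrix.one_apply_ne h]
    have h2 := hap' k
    rw [h1, Matrix.of_apply, Matrix.of_apply]
    field_simp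
    ring
  have hprod : (∏ j, 1 / deriv a (x j)) * (∏ j, 1 / deriv a (y j)) *
      ∏ i, deriv a (Sum.elim x y i) = 1 := by
    rw [Fintype.prod_sum_type]
    simp only [Sum.elim_inl, Sum.elim_inr]
    rw [mul_mul_mul_comm, ← Finset.prod_mul_distrib, ← Finset.prod_mul_distrib]
    simp [hx, hy]
  rw [hJ, Matrix.det_mul_row, mul_assoc (fredholmDet _ _ _), mul_assoc (fredholmDet _ _ _),
    ← mul_assoc (_ * _) (∏ i, deriv a (Sum.elim x y i)), hprod, one_mul]
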